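/- **Setting.** There are $n$ agents and $n$ goods; agent $i$ has utility $u_{ij}\in\mathbb R$ for good $j$. At prices $p\in\mathbb R_{\ge 0}^n$ a bundle $y\in\mathbb R_{\ge0}^n$ is *affordable* if $\sum_j y_j=1$ and $\sum_j p_jy_j\le 1$. An allocation $x\in\mathbb R_{\ge0}^{n\times n}$ and prices $p\ge 0$ form a *Hylland–Zeckhauser (HZ) equilibrium* for $u$ if $\sum_i x_{ij}=1$ for every good $j$ and, for every agent $i$, the bundle $x_i$ is affordable and maximizes $\sum_j u_{ij}y_j$ over all affordable bundles $y$. An instance is *bivalued* if numbers $0\le a_i<b_i$ are given with $u_{ij}\in\{a_i,b_i\}$ for all $i,j$; it is a *unit* instance if all $u_{ij}\in\{0,1\}$. The unit instance of a bivalued instance is obtained by replacing $a_i$ by $0$ and $b_i$ by $1$. **Algorithm 1** (for a unit instance $u$). Let $H$ be the bipartite graph of agents and goods with an edge $ij$ iff $u_{ij}=1$; $N(\cdot)$ denotes neighbourhoods in $H$. 1. If $H$ has a perfect matching, allocate to each agent the good matched to it and set all prices to $0$. 2. Otherwise take a minimum vertex cover $G_1\cup A_2$ of $H$ ($G_1$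 goods, $A_2$ agents); let $A_1,G_2$ be the complements of $A_2,G_1$. Take a maximum matching of $H[A_2,G_2]$, allocate to each agent of $A_2$ the good matched to it, and set the prices of the goods in $G_2$ to $0$. Run the *simplified DPSV algorithm* on $A_1$ and $G_1$: initially all goods of $G_1$ are active with price $1$ and all agents of $A_1$ are present, each with one dollar. While there are active goods, raise the prices of all active goods uniformly, by an amount $\delta\ge0$, until a nonempty set $S$ of active goods is tight, i.e. the total price of $S$ equals the number of present agents in $N(S)$ (while no set of active goods has a total price exceeding the number of present agents in its neighbourhood). Then freeze the prices of $S$: sell the goods of $S$ completely to the present agents in $N(S)$, each of which gets exactly one dollar worth of goods $j\in S$ with utility $1$ for it; the goods of $S$ stop being active and these agents are no longer present. When no good is active, fill up the bundles of the agents in $A_1$ to size $1$ with the unmatched goods of $G_2$. **Computational model.** Random access machines with unit-cost real arithmetic $(+,-,\times,/)$ and comparisons, and index registers. A program is *strongly polynomial* on bivalued instances (input $n,u,a,b$) if its number of steps is at most a polynomial in $n$, for all real inputs, and if for rational inputs all numbers occurring in the computation are rational with encoding length at most a polynomial in the encoding length of the input. **Theorem.** 1. There is a single strongly polynomial program that,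 for every $n$ and every bivalued instance $(u,a,b)$, outputs an HZ equilibrium $(x,p)$ for $u$ whose minimum price is $0$. Moreover it is a combinatorial algorithm: the output $(x,p)$ is an output of Algorithm 1 on the unit instance of $(u,a,b)$. 2. On every unit instance Algorithm 1 can carry out each of its steps and, however its choices (cover, matchings, tight sets, allocations) are made, its output $(x,p)$ is an HZ equilibrium for $u$ whose minimum price is $0$. 3. If the utilities $u_i$ of one agent $i$ are replaced by $u'_{ij}=s\,u_{ij}+h$ $(j=1,\dots,n)$ with $s>0$ and $h\ge0$, then $(x,p)$ is an HZ equilibrium for the old instance if and only if it is one for the new instance. -/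

import Mathlib

noncomputable section

namespace HZ

/-! ## The Hylland–Zeckhauser market on `n` agents (rows) and `n` goods (columns) -/

/-- `y` is a bundle that an agent can buy at prices `p`: nonnegative shares of total size one and of
cost at most one dollar. -/
def Affordable {n : ℕ} (p y : Fin n → ℝ) : Prop :=
  (∀ j, 0 ≤ y j) ∧ ∑ j, y j = 1 ∧ ∑ j, p j * y j ≤ 1

/-- The allocation `x` and the prices `p` form an equilibrium for the utilities `u`. -/
structure IsEquilibrium {n : ℕ} (u x : Fin n → Fin n → ℝ) (p : Fin n → ℝ) : Prop where
  price_nonneg : ∀ j, 0 ≤ p j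
  good_sold : ∀ j, ∑ i, x i j = 1
  affordable : ∀ i, Affordable p (x i)
  optimal : ∀ i y, Affordable p y → ∑ j, u i j * y j ≤ ∑ j, u i j * x i j

/-- The minimum price is zero (this fixes the scale of the prices). -/
def MinPriceZero {n : ℕ} (p : Fin n → ℝ) : Prop :=
  (∀ j, 0 ≤ p j) ∧ (0 < n → ∃ j, p j = 0)

/-- The utilities of agent `i` are picked from `{a i, b i}`, where `0 ≤ a i < b i`. -/
def Bivalued {n : ℕ} (u : Fin n → Fin n → ℝ) (a b : Fin n → ℝ) : Prop :=
  (∀ i, 0 ≤ a i ∧ a i < b i) ∧ ∀ i j, u i j = a i ∨ u i j = b i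

/-- The unit case: all utilities are `0` or `1`. -/
def IsUnit01 {n : ℕ} (u : Fin n → Fin n → ℝ) : Prop :=
  ∀ i j, u i j = 0 ∨ u i j = 1

/-- The unit instance of a bivalued instance: `a i` is replaced by `0` and `b i` by `1`. -/
def toUnit {n : ℕ} (u : Fin n → Fin n → ℝ) (b : Fin n → ℝ) : Fin n → Fin n → ℝ :=
  fun i j => if u i j = b i then 1 else 0

/-- `v'` is equivalent to the utility function `v` of one agent: it arises from `v` by a positive
scaling factor `s` and a nonnegative shift `h`. -/
def EquivalentUtility {n : ℕ} (v v' : Fin n → ℝ) : Prop :=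
  ∃ s h : ℝ, 0 < s ∧ 0 ≤ h ∧ ∀ j, v' j = s * v j + h

/-! ## Algorithm 1 for the unit case

All notions refer to the bipartite graph `H` with an edge from agent `i` to good `j` iff
`u i j = 1`. Choices that the algorithm leaves open (which cover, which matching, which tight set,
which flow) are left open here: the algorithm is a relation between input and possible outputs. -/

section Algorithm1

variable {n : ℕ}

/-- `M` is a matching in the graph `H`. -/
def IsMatching (u : Fin n → Fin n → ℝ) (M : Finset (Fin n × Fin n)) : Prop :=
  (∀ e ∈ M, u e.1 e.2 = 1) ∧ ∀ e ∈ M, ∀ f ∈ M, e.1 = f.1 ∨ e.2 = f.2 → e = f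

/-- `M` is a perfect matching in the graph `H`. -/
def IsPerfectMatching (u : Fin n → Fin n → ℝ) (M : Finset (Fin n × Fin n)) : Prop :=
  IsMatching u M ∧ (∀ i, ∃ j, (i, j) ∈ M) ∧ ∀ j, ∃ i, (i, j) ∈ M

/-- `M` is a matching in the induced subgraph `H[A', G']`. -/
def IsMatchingIn (u : Fin n → Fin n → ℝ) (A' G' : Finset (Fin n))
    (M : Finset (Fin n × Fin n)) : Prop :=
  IsMatching u M ∧ ∀ e ∈ M, e.1 ∈ A' ∧ e.2 ∈ G'

/-- `M` is a maximum matching in the induced subgraph `H[A', G']`. -/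
def IsMaxMatchingIn (u : Fin n → Fin n → ℝ) (A' G' : Finset (Fin n))
    (M : Finset (Fin n × Fin n)) : Prop :=
  IsMatchingIn u A' G' M ∧ ∀ M', IsMatchingIn u A' G' M' → M'.card ≤ M.card

/-- The goods `G₁` and the agents `A₂` together form a vertex cover of `H`. -/
def IsVertexCover (u : Fin n → Fin n → ℝ) (G₁ A₂ : Finset (Fin n)) : Prop :=
  ∀ i j, u i j = 1 → i ∈ A₂ ∨ j ∈ G₁

/-- The goods `G₁` and the agents `A₂` together form a minimum vertex cover of `H`. -/
def IsMinVertexCover (u : Fin n → Fin n → ℝ) (G₁ A₂ : Finset (Fin n)) : Prop :=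
  IsVertexCover u G₁ A₂ ∧
    ∀ G' A', IsVertexCover u G' A' → G₁.card + A₂.card ≤ G'.card + A'.card

/-- A state of the simplified DPSV algorithm: the goods that are still active, the agents whose
money is not yet spent on a frozen set, the current prices, and the current allocation. -/
structure PriceState (n : ℕ) where
  active : Finset (Fin n)
  agents : Finset (Fin n)
  price : Fin n → ℝ
  alloc : Fin n → Fin n → ℝ

/-- At the start the goods of `G₁` are active and have price one; all other goods have price zero. -/
def PriceState.init (A₁ G₁ : Finset (Fin n)) : PriceState n where
  active := G₁
  agents := A₁
  price := fun j => if j ∈ G₁ then 1 else 0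
  alloc := fun _ _ => 0

/-- The remaining agents that are interested in some good of `S`; each of them has one dollar. -/
def PriceState.nbr (u : Fin n → Fin n → ℝ) (s : PriceState n) (S : Finset (Fin n)) :
    Finset (Fin n) :=
  s.agents.filter fun i => ∃ j ∈ S, u i j = 1

/-- The prices after those of the active goods have been raised uniformly by `δ`. -/
def PriceState.raised (s : PriceState n) (δ : ℝ) : Fin n → ℝ :=
  fun j => if j ∈ s.active then s.price j + δ else s.price j

/-- When the prices of the active goods have been raised by `δ`, the set `S` of active goods goes
tight (its total price is the money of the agents interested in it), and no set of active goods
costs more than the money of the agents interested in it, so that no nonempty set was tight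
before. -/
def PriceState.GoesTight (u : Fin n → Fin n → ℝ) (s : PriceState n) (δ : ℝ)
    (S : Finset (Fin n)) : Prop :=
  0 ≤ δ ∧ S.Nonempty ∧ S ⊆ s.active ∧
    (∀ T ⊆ s.active, ∑ j ∈ T, s.raised δ j ≤ (s.nbr u T).card) ∧
    ∑ j ∈ S, s.raised δ j = (s.nbr u S).card

/-- `y` clears the local market of the tight set `S`: each interested agent gets one dollar worth
of those goods in `S` for which it has utility one, and the goods of `S` are fully sold. -/
def PriceState.Clears (u : Fin n → Fin n → ℝ) (s : PriceState n) (δ : ℝ)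
    (S : Finset (Fin n)) (y : Fin n → Fin n → ℝ) : Prop :=
  (∀ i j, 0 ≤ y i j) ∧
    (∀ i j, y i j ≠ 0 → i ∈ s.nbr u S ∧ j ∈ S ∧ u i j = 1) ∧
    (∀ j ∈ S, ∑ i, y i j = 1) ∧
    ∀ i ∈ s.nbr u S, ∑ j, s.raised δ j * y i j = 1

/-- The set `S` is frozen at the raised prices and sold according to `y`. -/
def PriceState.freeze (u : Fin n → Fin n → ℝ) (s : PriceState n) (δ : ℝ)
    (S : Finset (Fin n)) (y : Fin n → Fin n → ℝ) : PriceState n where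
  active := s.active \ S
  agents := s.agents \ s.nbr u S
  price := s.raised δ
  alloc := fun i j => s.alloc i j + y i j

/-- The states that the simplified DPSV algorithm on agents `A₁` and goods `G₁` can reach. It stops
as soon as no good is active. -/
inductive DPSVReaches (u : Fin n → Fin n → ℝ) (A₁ G₁ : Finset (Fin n)) : PriceState n → Prop
  | init : DPSVReaches u A₁ G₁ (PriceState.init A₁ G₁)
  | freeze (s : PriceState n) (δ : ℝ) (S : Finset (Fin n)) (y : Fin n → Fin n → ℝ) :
      DPSVReaches u A₁ G₁ s → s.GoesTight u δ S → s.Clears u δ S y →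
      DPSVReaches u A₁ G₁ (s.freeze u δ S y)

/-- The final allocation `x`. Agents in `A₂` get the good they are matched to by `M`. Agents outside
`A₂` get what the final state `s` of the simplified DPSV algorithm assigns to them of the goods in
`G₁`, and are filled up to size one by goods outside `G₁` that `M` leaves unmatched. -/
structure IsFilledUp (A₂ G₁ : Finset (Fin n)) (M : Finset (Fin n × Fin n)) (s : PriceState n)
    (x : Fin n → Fin n → ℝ) : Prop where
  matched : ∀ i ∈ A₂, ∀ j, x i j = if (i, j) ∈ M then 1 else 0
  bought : ∀ i ∉ A₂, ∀ j ∈ G₁, x i j = s.alloc i j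
  fill_nonneg : ∀ i ∉ A₂, ∀ j ∉ G₁, 0 ≤ x i j
  fill_unmatched : ∀ i ∉ A₂, ∀ j ∉ G₁, x i j ≠ 0 → ∀ k, (k, j) ∉ M
  fill_supply : ∀ j ∉ G₁, ∑ i ∈ A₂ᶜ, x i j ≤ 1
  fill_size : ∀ i ∉ A₂, ∑ j, x i j = 1

/-- `(x, p)` is a possible output of Algorithm 1 on the unit instance `u`. -/
inductive Algorithm1 (u : Fin n → Fin n → ℝ) : (Fin n → Fin n → ℝ) → (Fin n → ℝ) → Prop
  | perfect (M : Finset (Fin n × Fin n)) :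
      IsPerfectMatching u M →
      Algorithm1 u (fun i j => if (i, j) ∈ M then 1 else 0) (fun _ => 0)
  | imperfect (G₁ A₂ : Finset (Fin n)) (M : Finset (Fin n × Fin n)) (s : PriceState n)
      (x : Fin n → Fin n → ℝ) :
      (¬ ∃ M', IsPerfectMatching u M') →
      IsMinVertexCover u G₁ A₂ →
      IsMaxMatchingIn u A₂ G₁ᶜ M →
      DPSVReaches u A₂ᶜ G₁ s → s.active = ∅ →
      IsFilledUp A₂ G₁ M s x →
      Algorithm1 u x s.price

/-- Algorithm 1 can carry out each of its steps, however its earlier choices were made. (Each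
freezing removes an active good, so it also terminates.) -/
def Algorithm1NeverStuck (u : Fin n → Fin n → ℝ) : Prop :=
  (¬ ∃ M, IsPerfectMatching u M) →
    (∃ G₁ A₂, IsMinVertexCover u G₁ A₂) ∧
    ∀ G₁ A₂, IsMinVertexCover u G₁ A₂ →
      (∃ M, IsMaxMatchingIn u A₂ G₁ᶜ M) ∧
      ∀ M, IsMaxMatchingIn u A₂ G₁ᶜ M →
        (∀ i ∈ A₂, ∃ j, (i, j) ∈ M) ∧
        ∀ s, DPSVReaches u A₂ᶜ G₁ s →
          (s.active.Nonempty → ∃ δ S, s.GoesTight u δ S) ∧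
          (∀ δ S, s.GoesTight u δ S → ∃ y, s.Clears u δ S y) ∧
          (s.active = ∅ → ∃ x, IsFilledUp A₂ G₁ M s x)

end Algorithm1

/-! ## The machine model

A random access machine with real arithmetic, programmed in a small imperative language. The store
has index registers (natural numbers), one-dimensional arrays of indices, and two-dimensional arrays
of real numbers; array positions are given by index registers. Every step performs at most one
arithmetic operation or one comparison. Indices can only be set to constants, copied, incremented
and decremented, so that they stay bounded by the input dimension plus a constant plus the number
of steps. -/

/-- The contents of the memory. -/
structure Store where
  reg : ℕ → ℕ
  idx : ℕ → ℕ → ℕ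
  num : ℕ → ℕ → ℕ → ℝ

/-- A reference to the cell of the number array `arr` at the position given by the contents of the
index registers `row` and `col`. -/
structure Ref where
  arr : ℕ
  row : ℕ
  col : ℕ

/-- The real number stored in a cell. -/
def Store.get (s : Store) (r : Ref) : ℝ :=
  s.num r.arr (s.reg r.row) (s.reg r.col)

/-- Write a real number into a cell. -/
def Store.put (s : Store) (r : Ref) (v : ℝ) : Store :=
  { s with num := fun a i j =>
      if a = r.arr ∧ i = s.reg r.row ∧ j = s.reg r.col then v else s.num a i j }

/-- Write a natural number into an index register. -/
def Store.putReg (s : Store) (r v : ℕ) : Store :=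
  { s with reg := Function.update s.reg r v }

/-- Write a natural number into a cell of an index array. -/
def Store.putIdx (s : Store) (a i v : ℕ) : Store :=
  { s with idx := fun a' i' => if a' = a ∧ i' = i then v else s.idx a' i' }

/-- The arithmetic operations. -/
inductive ArithOp
  | add
  | sub
  | mul
  | div

/-- The value of an arithmetic operation (a division by zero yields zero). -/
def ArithOp.eval : ArithOp → ℝ → ℝ → ℝ
  | add, v, w => v + w
  | sub, v, w => v - w
  | mul, v, w => v * w
  | div, v, w => v / w

/-- The tests: comparisons of two index registers or of two numbers, and their negations. -/
inductive Test
  | regEq (r r' : ℕ)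
  | regLt (r r' : ℕ)
  | numEq (c c' : Ref)
  | numLt (c c' : Ref)
  | neg (b : Test)

/-- The truth of a test. -/
def Test.Holds : Test → Store → Prop
  | regEq r r', s => s.reg r = s.reg r'
  | regLt r r', s => s.reg r < s.reg r'
  | numEq c c', s => s.get c = s.get c'
  | numLt c c', s => s.get c < s.get c'
  | neg b, s => ¬ b.Holds s

/-- Programs. -/
inductive Program
  | skip
  | setReg (r k : ℕ)                      -- `reg r := k`
  | copyReg (r r' : ℕ)                    -- `reg r := reg r'`
  | incReg (r : ℕ)                        -- `reg r := reg r + 1`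
  | decReg (r : ℕ)                        -- `reg r := max (reg r - 1) 0`
  | loadIdx (r a r' : ℕ)                  -- `reg r := idx a [reg r']`
  | storeIdx (a r' r : ℕ)                 -- `idx a [reg r'] := reg r`
  | setNum (c : Ref) (z : ℤ)              -- `c := z`
  | copyNum (c c' : Ref)                  -- `c := c'`
  | arith (op : ArithOp) (c c₁ c₂ : Ref)  -- `c := c₁ op c₂`
  | seq (P Q : Program)
  | ite (b : Test) (P Q : Program)
  | while (b : Test) (P : Program)

/-- A configuration: the programs still to be run, in this order, and the store. -/
structure Config where
  todo : List Program
  store : Store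

open Classical in
/-- One step of the machine. The machine has halted when nothing is left to do. -/
def Config.step : Config → Config
  | ⟨[], s⟩ => ⟨[], s⟩
  | ⟨.skip :: k, s⟩ => ⟨k, s⟩
  | ⟨.setReg r v :: k, s⟩ => ⟨k, s.putReg r v⟩
  | ⟨.copyReg r r' :: k, s⟩ => ⟨k, s.putReg r (s.reg r')⟩
  | ⟨.incReg r :: k, s⟩ => ⟨k, s.putReg r (s.reg r + 1)⟩
  | ⟨.decReg r :: k, s⟩ => ⟨k, s.putReg r (s.reg r - 1)⟩
  | ⟨.loadIdx r a r' :: k, s⟩ => ⟨k, s.putReg r (s.idx a (s.reg r'))⟩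
  | ⟨.storeIdx a r' r :: k, s⟩ => ⟨k, s.putIdx a (s.reg r') (s.reg r)⟩
  | ⟨.setNum c z :: k, s⟩ => ⟨k, s.put c z⟩
  | ⟨.copyNum c c' :: k, s⟩ => ⟨k, s.put c (s.get c')⟩
  | ⟨.arith op c c₁ c₂ :: k, s⟩ => ⟨k, s.put c (op.eval (s.get c₁) (s.get c₂))⟩
  | ⟨.seq P Q :: k, s⟩ => ⟨P :: Q :: k, s⟩
  | ⟨.ite b P Q :: k, s⟩ => ⟨(if b.Holds s then P else Q) :: k, s⟩
  | ⟨.while b P :: k, s⟩ => if b.Holds s then ⟨P :: .while b P :: k, s⟩ else ⟨k, s⟩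

/-- The configuration after `t` steps of the program `P` started on the store `s`. -/
def Program.run (P : Program) (s : Store) (t : ℕ) : Config :=
  Config.step^[t] ⟨[P], s⟩

/-- The initial store: `n` is in index register 0, the utilities are in number array 0, and the
values `a` and `b` are in the columns 0 of the number arrays 1 and 2; all other cells hold 0. -/
def inputStore {n : ℕ} (u : Fin n → Fin n → ℝ) (a b : Fin n → ℝ) : Store where
  reg := fun r => if r = 0 then n else 0
  idx := fun _ _ => 0
  num := fun m i j =>
    if h : i < n ∧ j < n ∧ m = 0 then u ⟨i, h.1⟩ ⟨j, h.2.1⟩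
    else if h : i < n ∧ j = 0 ∧ m = 1 then a ⟨i, h.1⟩
    else if h : i < n ∧ j = 0 ∧ m = 2 then b ⟨i, h.1⟩
    else 0

/-- The allocation is read from number array 3. -/
def Store.allocation (s : Store) (n : ℕ) : Fin n → Fin n → ℝ :=
  fun i j => s.num 3 i j

/-- The prices are read from column 0 of number array 4. -/
def Store.prices (s : Store) (n : ℕ) : Fin n → ℝ :=
  fun j => s.num 4 j 0

/-- The encoding length of a rational number: the binary lengths of numerator and denominator. -/
def bitLength (q : ℚ) : ℕ :=
  Nat.size q.num.natAbs + Nat.size q.den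

/-- The encoding length of a rational instance. -/
def inputLength {n : ℕ} (u : Fin n → Fin n → ℚ) (a b : Fin n → ℚ) : ℕ :=
  (∑ i, ∑ j, bitLength (u i j)) + (∑ i, bitLength (a i)) + ∑ i, bitLength (b i)

/-- All numbers in the store are rational numbers of encoding length at most `L`. -/
def Store.LengthLE (s : Store) (L : ℕ) : Prop :=
  ∀ m i j, ∃ q : ℚ, (q : ℝ) = s.num m i j ∧ bitLength q ≤ L

/-- The program `P` runs in strongly polynomial time on bivalued instances: the number of its steps
is bounded by a polynomial in the dimension `n`, whatever the (real) input numbers are, and if the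
input numbers are rational, then all numbers occurring in the computation are rational of encoding
length bounded by a polynomial in the encoding length of the input. -/
def StronglyPolynomial (P : Program) : Prop :=
  (∃ T : Polynomial ℕ, ∀ (n : ℕ) (u : Fin n → Fin n → ℝ) (a b : Fin n → ℝ), Bivalued u a b →
    (P.run (inputStore u a b) (T.eval n)).todo = []) ∧
  ∃ B : Polynomial ℕ, ∀ (n : ℕ) (u : Fin n → Fin n → ℚ) (a b : Fin n → ℚ),
    Bivalued (fun i j => (u i j : ℝ)) (fun i => (a i : ℝ)) (fun i => (b i : ℝ)) →
    ∀ t, (P.run (inputStore (fun i j => (u i j : ℝ)) (fun i => (a i : ℝ)) (fun i => (b i : ℝ)))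
      t).store.LengthLE (B.eval (inputLength u a b))

/-- When the program `P` has halted on the given bivalued instance, its output is `(x, p)`. -/
def Program.Outputs (P : Program) {n : ℕ} (u : Fin n → Fin n → ℝ) (a b : Fin n → ℝ)
    (x : Fin n → Fin n → ℝ) (p : Fin n → ℝ) : Prop :=
  ∃ t, (P.run (inputStore u a b) t).todo = [] ∧
    (P.run (inputStore u a b) t).store.allocation n = x ∧
    (P.run (inputStore u a b) t).store.prices n = p

end HZ

end

/-! Equivalent utilities. Every affordable bundle has size one, so replacing the utilities of an
agent by `c * u + d` with `c > 0` changes the value of all affordable bundles by the same increasing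
map `c * z + d`, and the maximizers stay the same (`IsEquilibrium.of_affine`). A bivalued instance
is such an image of its unit instance, with factor `b i - a i` and shift `a i`.

Algorithm 1. Exchanging a part of a minimum cover for its neighbourhood gives two Hall conditions:
the agents of `A₂` can be matched into `G₂`, and at price one no set of goods in `G₁` costs more
than the money of its neighbours in `A₁`. Without a perfect matching the cover has fewer than `n`
vertices, so some good lies outside `G₁` and keeps price zero. The price raising preserves the
inequality "price of `T` is at most `|N(T)|`" for all sets `T` of active goods. A tight set can be
sold by Hall's theorem for copies (`PriceState.Sound.exists_clears`), and subtracting its equation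
from the inequality for a union restores the invariant for the remaining goods
(`PriceState.Sound.freeze`). A buyer spends its dollar on goods of price `c`, and no good that it
likes is ever cheaper. Hence its utility is `1 / c`, the most that one dollar can buy. Prices in
`G₁` are at least one, so nobody buys more than size one, and the total size still missing equals
the number of goods left over (`isFilledUp_of_uniform`).

The program. One subroutine does the combinatorial work: it matches `K` units of every active good
with `M` slots of every present agent by an auction. A value that is skipped by the levels of the
slots defines a cut (`AuctionInv.matchingCut`), which violates Hall's condition whenever a unit
stays free. With `K = M = 1` the cut yields a perfect matching or a minimum vertex cover. With `K =
|N(T)|` and `M = |T|`, all units are matched if and only if `T` has the least ratio `|N(T)| / |T|`;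
otherwise the cut is a set of smaller ratio. Iterating this from the set of all active goods is
Newton's method. It ends with a set that goes tight first, its new price is `K / M`, and the
matching, in units of size `1 / K`, is a clearing sale (`Represents.freezeTight_of_nonempty`).

Resources. All loops count up to registers that hold `n`, `n²` or `n² (n² + 1)` and are fixed
beforehand. So the program has a total denotation `Program.den`, which the machine reaches within
polynomially many steps (`Program.run_den`). Real numbers arise from integers by counting and
subtracting, and then by at most two nested divisions, which keeps the encoding short
(`Config.step_fitsLevels`). -/

noncomputable section

namespace HZ

/-! ## Denotational semantics of bounded programs -/

/-- Induction on programs. -/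
theorem Program.induct {motive : Program → Prop} (skip : motive .skip)
    (setReg : ∀ r k, motive (.setReg r k)) (copyReg : ∀ r r', motive (.copyReg r r'))
    (incReg : ∀ r, motive (.incReg r)) (decReg : ∀ r, motive (.decReg r))
    (loadIdx : ∀ r a r', motive (.loadIdx r a r')) (storeIdx : ∀ a r' r, motive (.storeIdx a r' r))
    (setNum : ∀ c z, motive (.setNum c z)) (copyNum : ∀ c c', motive (.copyNum c c'))
    (arith : ∀ op c c₁ c₂, motive (.arith op c c₁ c₂))
    (seq : ∀ P Q, motive P → motive Q → motive (.seq P Q))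
    (ite : ∀ b P Q, motive P → motive Q → motive (.ite b P Q))
    (loop : ∀ b P, motive P → motive (.while b P)) (P : Program) : motive P :=
  Program.rec skip setReg copyReg incReg decReg loadIdx storeIdx setNum copyNum arith seq ite loop P

/-- The number of iterations of a counting loop `while reg r < reg e`. -/
def Test.count : Test → Store → ℕ
  | regLt r r', s => s.reg r' - s.reg r
  | _, _ => 0

open Classical in
/-- The effect of a program whose loops are all counting loops. -/
def Program.den : Program → Store → Store
  | skip, s => s
  | setReg r v, s => s.putReg r v
  | copyReg r r', s => s.putReg r (s.reg r')
  | incReg r, s => s.putReg r (s.reg r + 1)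
  | decReg r, s => s.putReg r (s.reg r - 1)
  | loadIdx r a r', s => s.putReg r (s.idx a (s.reg r'))
  | storeIdx a r' r, s => s.putIdx a (s.reg r') (s.reg r)
  | setNum c z, s => s.put c z
  | copyNum c c', s => s.put c (s.get c')
  | arith op c c₁ c₂, s => s.put c (op.eval (s.get c₁) (s.get c₂))
  | seq P Q, s => Q.den (P.den s)
  | ite b P Q, s => if b.Holds s then P.den s else Q.den s
  | .while b P, s => P.den^[b.count s] s

/-- The program may write the index register `x`. -/
def Program.writesReg : Program → ℕ → Bool
  | setReg r _, x => r == x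
  | copyReg r _, x => r == x
  | incReg r, x => r == x
  | decReg r, x => r == x
  | loadIdx r _ _, x => r == x
  | seq P Q, x => P.writesReg x || Q.writesReg x
  | ite _ P Q, x => P.writesReg x || Q.writesReg x
  | .while _ P, x => P.writesReg x
  | _, _ => false

/-- The program may write the index array `x`. -/
def Program.writesIdx : Program → ℕ → Bool
  | storeIdx a _ _, x => a == x
  | seq P Q, x => P.writesIdx x || Q.writesIdx x
  | ite _ P Q, x => P.writesIdx x || Q.writesIdx x
  | .while _ P, x => P.writesIdx x
  | _, _ => false

/-- The program may write the number array `x`. -/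
def Program.writesNum : Program → ℕ → Bool
  | setNum c _, x => c.arr == x
  | copyNum c _, x => c.arr == x
  | arith _ c _ _, x => c.arr == x
  | seq P Q, x => P.writesNum x || Q.writesNum x
  | ite _ P Q, x => P.writesNum x || Q.writesNum x
  | .while _ P, x => P.writesNum x
  | _, _ => false

/-- A loop `while reg r < reg e do P; reg r := reg r + 1` in which `P` does not touch `r`, and
`e < K ≤ r`. -/
def loopShape (K : ℕ) : Test → Program → Bool
  | .regLt r e, .seq P (.incReg r') => r == r' && decide (e < K) && decide (K ≤ r) && !P.writesReg r
  | _, _ => false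

/-- All loops count up to one of the registers below `K`, which are not written. -/
def Program.loopsBounded (K : ℕ) : Program → Bool
  | setReg r _ => decide (K ≤ r)
  | copyReg r _ => decide (K ≤ r)
  | incReg r => decide (K ≤ r)
  | decReg r => decide (K ≤ r)
  | loadIdx r _ _ => decide (K ≤ r)
  | seq P Q => P.loopsBounded K && Q.loopsBounded K
  | ite _ P Q => P.loopsBounded K && Q.loopsBounded K
  | .while b P => loopShape K b P && P.loopsBounded K
  | _ => true

/-- A bound for the number of iterations of a loop, given bounds for the registers. -/
def Test.bound (lim : ℕ → Polynomial ℕ) : Test → Polynomial ℕ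
  | regLt _ e => lim e
  | _ => 0

/-- A bound for the number of steps of a program. -/
def Program.cost (lim : ℕ → Polynomial ℕ) : Program → Polynomial ℕ
  | seq P Q => 1 + P.cost lim + Q.cost lim
  | ite _ P Q => 1 + P.cost lim + Q.cost lim
  | .while b P => 1 + b.bound lim * (1 + P.cost lim)
  | _ => 1

/-! ### Frame rules: memory that a program does not write keeps its contents -/

section Frame

variable {s : Store}

@[simp] theorem Store.reg_putReg (r v x : ℕ) :
    (s.putReg r v).reg x = if x = r then v else s.reg x := by
  simp [Store.putReg, Function.update_apply]
@[simp] theorem Store.idx_putReg (r v : ℕ) : (s.putReg r v).idx = s.idx := rfl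
@[simp] theorem Store.num_putReg (r v : ℕ) : (s.putReg r v).num = s.num := rfl
@[simp] theorem Store.reg_putIdx (a i v : ℕ) : (s.putIdx a i v).reg = s.reg := rfl
@[simp] theorem Store.num_putIdx (a i v : ℕ) : (s.putIdx a i v).num = s.num := rfl
@[simp] theorem Store.idx_putIdx_self (a i v : ℕ) :
    (s.putIdx a i v).idx a = Function.update (s.idx a) i v := by
  funext x; simp [Store.putIdx, Function.update_apply]
@[simp] theorem Store.idx_putIdx_ne {a a' : ℕ} (h : a' ≠ a) (i v : ℕ) :
    (s.putIdx a i v).idx a' = s.idx a' := by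
  funext x; simp [Store.putIdx, h]
@[simp] theorem Store.reg_put (c : Ref) (v : ℝ) : (s.put c v).reg = s.reg := rfl
@[simp] theorem Store.idx_put (c : Ref) (v : ℝ) : (s.put c v).idx = s.idx := rfl
theorem Store.num_put (c : Ref) (v : ℝ) (m i j : ℕ) :
    (s.put c v).num m i j =
      if m = c.arr ∧ i = s.reg c.row ∧ j = s.reg c.col then v else s.num m i j := rfl
@[simp] theorem Store.num_put_ne {c : Ref} {m : ℕ} (h : m ≠ c.arr) (v : ℝ) :
    (s.put c v).num m = s.num m := by
  funext i j; simp [Store.put, h]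

theorem Program.den_reg (P : Program) {x : ℕ} (h : P.writesReg x = false) (s : Store) :
    (P.den s).reg x = s.reg x := by
  induction P using Program.induct generalizing s with
  | seq P Q hP hQ =>
    simp only [writesReg, Bool.or_eq_false_iff] at h
    simp only [den]; rw [hQ h.2, hP h.1]
  | ite b P Q hP hQ =>
    simp only [writesReg, Bool.or_eq_false_iff] at h
    simp only [den]; split_ifs
    · exact hP h.1 s
    · exact hQ h.2 s
  | loop b P hP =>
    simp only [writesReg] at h
    simp only [den]
    generalize b.count s = k
    induction k generalizing s with
    | zero => rfl
    | succ k ih => rw [Function.iterate_succ_apply, ih, hP h]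
  | skip | storeIdx | setNum | copyNum | arith => simp [den]
  | _ =>
    simp only [writesReg, beq_eq_false_iff_ne] at h
    simp [den, Ne.symm h]

theorem Program.den_idx (P : Program) {x : ℕ} (h : P.writesIdx x = false) (s : Store) :
    (P.den s).idx x = s.idx x := by
  induction P using Program.induct generalizing s with
  | seq P Q hP hQ =>
    simp only [writesIdx, Bool.or_eq_false_iff] at h
    simp only [den]; rw [hQ h.2, hP h.1]
  | ite b P Q hP hQ =>
    simp only [writesIdx, Bool.or_eq_false_iff] at h
    simp only [den]; split_ifs
    · exact hP h.1 s
    · exact hQ h.2 s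
  | loop b P hP =>
    simp only [writesIdx] at h
    simp only [den]
    generalize b.count s = k
    induction k generalizing s with
    | zero => rfl
    | succ k ih => rw [Function.iterate_succ_apply, ih, hP h]
  | storeIdx a r' r =>
    simp only [writesIdx, beq_eq_false_iff_ne] at h
    exact Store.idx_putIdx_ne h.symm _ _
  | _ => simp [den]

theorem Program.den_num (P : Program) {x : ℕ} (h : P.writesNum x = false) (s : Store) :
    (P.den s).num x = s.num x := by
  induction P using Program.induct generalizing s with
  | seq P Q hP hQ =>
    simp only [writesNum, Bool.or_eq_false_iff] at h
    simp only [den]; rw [hQ h.2, hP h.1]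
  | ite b P Q hP hQ =>
    simp only [writesNum, Bool.or_eq_false_iff] at h
    simp only [den]; split_ifs
    · exact hP h.1 s
    · exact hQ h.2 s
  | loop b P hP =>
    simp only [writesNum] at h
    simp only [den]
    generalize b.count s = k
    induction k generalizing s with
    | zero => rfl
    | succ k ih => rw [Function.iterate_succ_apply, ih, hP h]
  | setNum c z =>
    simp only [writesNum, beq_eq_false_iff_ne] at h
    exact Store.num_put_ne h.symm _
  | copyNum c z =>
    simp only [writesNum, beq_eq_false_iff_ne] at h
    exact Store.num_put_ne h.symm _
  | arith op c c₁ c₂ =>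
    simp only [writesNum, beq_eq_false_iff_ne] at h
    exact Store.num_put_ne h.symm _
  | _ => simp [den]

/-- The registers below `K` are the loop limits; their constancy makes the number of iterations
known on entry to a loop. -/
theorem Program.writesReg_of_loopsBounded {K : ℕ} {P : Program} (h : P.loopsBounded K)
    {x : ℕ} (hx : x < K) : P.writesReg x = false := by
  induction P using Program.induct with
  | seq P Q hP hQ => simp_all [loopsBounded, writesReg]
  | ite b P Q hP hQ => simp_all [loopsBounded, writesReg]
  | loop b P hP => simp_all [loopsBounded, writesReg]
  | _ => simp_all [loopsBounded, writesReg] <;> omega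

end Frame

/-! ## Running time -/

/-- The limit of a loop is a register that is not written, so there are at most `(lim e).eval n`
iterations, each of which costs one test and one pass through the body. Structural induction adds up
these costs. -/
theorem Program.run_den {K n : ℕ} {lim : ℕ → Polynomial ℕ} (P : Program)
    (hP : P.loopsBounded K) (s : Store) (hs : ∀ e < K, s.reg e = (lim e).eval n) :
    ∃ t ≤ (P.cost lim).eval n, ∀ k, Config.step^[t] ⟨P :: k, s⟩ = ⟨k, P.den s⟩ := by
  induction P using Program.induct generalizing s with
  | seq P Q ihP ihQ =>
    simp only [loopsBounded, Bool.and_eq_true] at hP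
    obtain ⟨t₁, h₁, e₁⟩ := ihP hP.1 s hs
    obtain ⟨t₂, h₂, e₂⟩ := ihQ hP.2 (P.den s) (fun e he => by
      rw [P.den_reg (writesReg_of_loopsBounded hP.1 he), hs e he])
    refine ⟨t₂ + (t₁ + 1), ?_, fun k => ?_⟩
    · simp only [cost, Polynomial.eval_add, Polynomial.eval_one]; omega
    · rw [Function.iterate_add_apply, Function.iterate_succ_apply]
      simp only [Config.step]
      rw [e₁, e₂]; rfl
  | ite b P Q ihP ihQ =>
    simp only [loopsBounded, Bool.and_eq_true] at hP
    by_cases hb : b.Holds s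
    · obtain ⟨t₁, h₁, e₁⟩ := ihP hP.1 s hs
      refine ⟨t₁ + 1, ?_, fun k => ?_⟩
      · simp only [cost, Polynomial.eval_add, Polynomial.eval_one]; omega
      · rw [Function.iterate_succ_apply]
        simp only [Config.step, den, hb, if_true]
        rw [e₁]
    · obtain ⟨t₁, h₁, e₁⟩ := ihQ hP.2 s hs
      refine ⟨t₁ + 1, ?_, fun k => ?_⟩
      · simp only [cost, Polynomial.eval_add, Polynomial.eval_one]; omega
      · rw [Function.iterate_succ_apply]
        simp only [Config.step, den, hb, if_false]
        rw [e₁]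
  | loop b P ih =>
    simp only [loopsBounded, Bool.and_eq_true] at hP
    obtain ⟨hshape, hP⟩ := hP
    match b, P, hshape with
    | .regLt r e, .seq P (.incReg r'), hshape =>
    simp only [loopShape, Bool.and_eq_true, beq_iff_eq, decide_eq_true_eq, Bool.not_eq_true']
      at hshape
    obtain ⟨⟨⟨rfl, he⟩, hr⟩, hw⟩ := hshape
    -- Here `m` is the number of iterations still to come; the leading `1` pays for the last test,
    -- which fails.
    have key : ∀ m (s : Store), (∀ e < K, s.reg e = (lim e).eval n) → s.reg e - s.reg r = m →
        ∃ t ≤ 1 + m * (1 + ((P.seq (.incReg r)).cost lim).eval n), ∀ k,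
          Config.step^[t] ⟨.while (.regLt r e) (P.seq (.incReg r)) :: k, s⟩ =
            ⟨k, (P.seq (.incReg r)).den^[m] s⟩ := by
      intro m
      induction m with
      | zero =>
        intro s hs hm
        refine ⟨1, by omega, fun k => ?_⟩
        have : ¬ (Test.regLt r e).Holds s := by simp only [Test.Holds]; omega
        simp only [Function.iterate_one, Config.step, this, if_false, Function.iterate_zero, id]
      | succ m ihm =>
        intro s hs hm
        obtain ⟨t₁, h₁, e₁⟩ := ih hP s hs
        obtain ⟨t₂, h₂, e₂⟩ := ihm ((P.seq (.incReg r)).den s) (fun e he => by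
            rw [den_reg _ (writesReg_of_loopsBounded hP he), hs e he]) (by
            have hne : e ≠ r := by omega
            rw [den_reg (x := e) _ (writesReg_of_loopsBounded hP he)]
            simp only [den, Store.reg_putReg, if_true]
            rw [den_reg _ hw]; omega)
        refine ⟨t₂ + (t₁ + 1), by rw [Nat.succ_mul]; omega, fun k => ?_⟩
        have : (Test.regLt r e).Holds s := by simp only [Test.Holds]; omega
        rw [Function.iterate_add_apply, Function.iterate_succ_apply]
        simp only [Config.step, this, if_true]
        rw [e₁, e₂, Function.iterate_succ_apply]
    obtain ⟨t, ht, hk⟩ := key (s.reg e - s.reg r) s hs rfl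
    refine ⟨t, ht.trans ?_, hk⟩
    simp only [cost, Test.bound, Polynomial.eval_add, Polynomial.eval_one, Polynomial.eval_mul,
      ← hs e he]
    gcongr
    omega
  | _ => exact ⟨1, by simp [cost], fun k => by simp [Config.step, den]⟩

/-! ## Counting loops -/

/-- `for reg r = 0, …, reg e - 1 do P`. -/
def Program.for (r e : ℕ) (P : Program) : Program :=
  .seq (.setReg r 0) (.while (.regLt r e) (.seq P (.incReg r)))

/-- `if b then P`. -/
def Program.when (b : Test) (P : Program) : Program := .ite b P .skip

/-- Sequential composition of a list of programs. -/
def Program.block : List Program → Program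
  | [] => .skip
  | [P] => P
  | P :: Q :: l => .seq P (block (Q :: l))

/-- The stores `s` and `s'` agree outside of what `P` and the counter `r` can change. -/
structure Program.Frame (P : Program) (r : ℕ) (s s' : Store) : Prop where
  reg : ∀ {x}, x ≠ r → P.writesReg x = false → s'.reg x = s.reg x
  idx : ∀ {x}, P.writesIdx x = false → s'.idx x = s.idx x
  num : ∀ {x}, P.writesNum x = false → s'.num x = s.num x

/-- Loop rule with a built-in frame: in each iteration, whatever `P` does not write still has its
value from the initial store `s`. The invariant is asserted after the counter has been advanced,
since the loop writes `r` after running `P`. -/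
theorem Program.for_induction {r e : ℕ} {P : Program} (I : ℕ → Store → Prop) (s : Store)
    (hr : P.writesReg r = false) (hre : e ≠ r)
    (h0 : I 0 (s.putReg r 0))
    (hstep : ∀ i < s.reg e, ∀ s', s'.reg r = i → P.Frame r s s' → I i s' →
      I (i + 1) ((P.den s').putReg r (i + 1))) :
    I (s.reg e) ((Program.for r e P).den s) := by
  have key : ∀ m ≤ s.reg e, I m ((P.seq (.incReg r)).den^[m] (s.putReg r 0)) ∧
      ((P.seq (.incReg r)).den^[m] (s.putReg r 0)).reg r = m ∧
      P.Frame r s ((P.seq (.incReg r)).den^[m] (s.putReg r 0)) := by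
    intro m
    induction m with
    | zero =>
      intro _
      exact ⟨h0, by simp, ⟨fun hx _ => by simp [hx], fun _ => rfl, fun _ => rfl⟩⟩
    | succ m ih =>
      intro hm
      obtain ⟨h1, h2, h3⟩ := ih (by omega)
      rw [Function.iterate_succ_apply']
      generalize (P.seq (.incReg r)).den^[m] (s.putReg r 0) = s' at h1 h2 h3
      have : (P.seq (.incReg r)).den s' = (P.den s').putReg r (m + 1) := by
        simp only [den]; rw [den_reg _ hr, h2]
      rw [this]
      refine ⟨hstep m (by omega) s' h2 h3 h1, by simp, ⟨fun hx hw => ?_, fun hw => ?_, fun hw => ?_⟩⟩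
      · simp only [Store.reg_putReg, hx, if_false]; rw [den_reg _ hw, h3.reg hx hw]
      · simp only [Store.idx_putReg]; rw [den_idx _ hw, h3.idx hw]
      · simp only [Store.num_putReg]; rw [den_num _ hw, h3.num hw]
  have := (key (s.reg e) le_rfl).1
  simpa [Program.for, den, Test.count, hre] using this

/-- The limit `reg m` is computed by the program itself, so it cannot bound a loop in the sense of
`loopShape`. The loop therefore runs up to `e`, and a test makes the surplus iterations idle. The
invariant stops at `min i (s.reg m)`, and `hI` carries it through the idle iterations, where only
the counter moves. -/
theorem Program.for_when_induction {r e m : ℕ} {P : Program} (I : ℕ → Store → Prop) (s : Store)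
    (hr : P.writesReg r = false) (hre : e ≠ r)
    (hm : P.writesReg m = false) (hrm : m ≠ r) (hle : s.reg m ≤ s.reg e)
    (h0 : I 0 (s.putReg r 0)) (hI : ∀ i s' v, I i s' → I i (s'.putReg r v))
    (hstep : ∀ i < s.reg m, ∀ s', s'.reg r = i → P.Frame r s s' → I i s' →
      I (i + 1) ((P.den s').putReg r (i + 1))) :
    I (s.reg m) ((Program.for r e (.when (.regLt r m) P)).den s) := by
  have := for_induction (r := r) (e := e) (P := .when (.regLt r m) P)
    (fun i s' => I (min i (s.reg m)) s') s (by simpa [when, writesReg] using hr)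
    hre (by simpa using h0) (by
    intro i hi s' hi' hf hI'
    have hf' : P.Frame r s s' := ⟨fun h1 h2 => hf.reg h1 (by simpa [when, writesReg] using h2),
      fun h2 => hf.idx (by simpa [when, writesIdx] using h2),
      fun h2 => hf.num (by simpa [when, writesNum] using h2)⟩
    have hm' : s'.reg m = s.reg m := hf'.reg hrm hm
    simp only [when, den, Test.Holds, hm', hi']
    by_cases h : i < s.reg m
    · rw [if_pos h, min_eq_left (by omega)]
      rw [min_eq_left (by omega)] at hI'
      exact hstep i h s' hi' hf' hI'
    · rw [if_neg h, min_eq_right (by omega)]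
      rw [min_eq_right (by omega)] at hI'
      exact hI _ _ _ hI')
  simpa [hle] using this

/-! ## Encoding lengths

Number arrays are sorted by a level. Arrays of level `0` hold the input and take no part in
arithmetic, arrays of level `1` hold integers to which only sums and differences are written, and
arrays of level `k ≥ 2` receive quotients of numbers of levels `1, …, k - 1`. -/

/-- The program respects the levels of the number arrays. -/
def Program.respects (lev : ℕ → ℕ) : Program → Bool
  | setNum c z => decide (1 ≤ lev c.arr) && decide (|z| ≤ 1)
  | copyNum _ _ => false
  | arith .add c c₁ c₂ => decide (lev c.arr = 1) && decide (lev c₁.arr = 1) && decide (lev c₂.arr = 1)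
  | arith .sub c c₁ c₂ => decide (lev c.arr = 1) && decide (lev c₁.arr = 1) && decide (lev c₂.arr = 1)
  | arith .mul _ _ _ => false
  | arith .div c c₁ c₂ => decide (1 ≤ lev c₁.arr) && decide (1 ≤ lev c₂.arr) &&
      decide (lev c₁.arr < lev c.arr) && decide (lev c₂.arr < lev c.arr)
  | seq P Q => P.respects lev && Q.respects lev
  | ite _ P Q => P.respects lev && Q.respects lev
  | .while _ P => P.respects lev
  | _ => true

/-- A quotient of integers of absolute value at most `2 ^ e`. -/
def IsShortRat (e : ℕ) (v : ℝ) : Prop :=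
  ∃ p q : ℤ, q ≠ 0 ∧ v = p / q ∧ |p| ≤ 2 ^ e ∧ |q| ≤ 2 ^ e

/-- The numbers that arrays of level `k ≥ 1` can hold after `t` steps. -/
def FitsLevel (k t : ℕ) (v : ℝ) : Prop :=
  IsShortRat ((t + 1) * 2 ^ k) v ∧ (k = 1 → ∃ z : ℤ, v = z ∧ |z| ≤ 2 ^ t)

/-- All arrays hold numbers that fit their level, after `t` steps from the store `s₀`. -/
def Store.FitsLevels (s : Store) (lev : ℕ → ℕ) (s₀ : Store) (t : ℕ) : Prop :=
  ∀ m i j, if lev m = 0 then s.num m i j = s₀.num m i j else FitsLevel (lev m) t (s.num m i j)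

theorem IsShortRat.mono {e e' : ℕ} (h : e ≤ e') {v : ℝ} : IsShortRat e v → IsShortRat e' v := by
  rintro ⟨p, q, hq, hv, h1, h2⟩
  have : (2 : ℤ) ^ e ≤ 2 ^ e' := pow_le_pow_right₀ (by norm_num) h
  exact ⟨p, q, hq, hv, h1.trans this, h2.trans this⟩

theorem isShortRat_int {e t : ℕ} (z : ℤ) (hz : |z| ≤ 2 ^ t) (h : t ≤ e) : IsShortRat e z := by
  have : (2 : ℤ) ^ t ≤ 2 ^ e := pow_le_pow_right₀ (by norm_num) h
  exact ⟨z, 1, one_ne_zero, by simp, hz.trans this, by simpa using one_le_pow₀ (by norm_num)⟩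

theorem fitsLevel_int {k t : ℕ} (z : ℤ) (hz : |z| ≤ 2 ^ t) : FitsLevel k t z := by
  refine ⟨isShortRat_int z hz ?_, fun _ => ⟨z, rfl, hz⟩⟩
  have : 1 ≤ 2 ^ k := Nat.one_le_two_pow
  nlinarith

theorem FitsLevel.mono {k t t' : ℕ} (h : t ≤ t') {v : ℝ} : FitsLevel k t v → FitsLevel k t' v := by
  rintro ⟨h1, h2⟩
  refine ⟨h1.mono (by gcongr), fun hk => ?_⟩
  obtain ⟨z, hz, hz'⟩ := h2 hk
  exact ⟨z, hz, hz'.trans (pow_le_pow_right₀ (by norm_num) h)⟩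

theorem IsShortRat.div {e : ℕ} {v w : ℝ} (hv : IsShortRat e v) (hw : IsShortRat e w) :
    IsShortRat (2 * e) (v / w) := by
  obtain ⟨p, q, hq, rfl, h1, h2⟩ := hv
  obtain ⟨p', q', hq', rfl, h1', h2'⟩ := hw
  -- Division by zero yields zero, which is written as `0 / 1`.
  by_cases hp : p' = 0
  · subst hp
    exact ⟨0, 1, one_ne_zero, by simp, by simp, by simpa using one_le_pow₀ (by norm_num)⟩
  refine ⟨p * q', q * p', mul_ne_zero hq hp, ?_, ?_, ?_⟩
  · have : (q : ℝ) ≠ 0 := by exact_mod_cast hq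
    have : (q' : ℝ) ≠ 0 := by exact_mod_cast hq'
    have : (p' : ℝ) ≠ 0 := by exact_mod_cast hp
    push_cast
    field_simp
  · rw [abs_mul, two_mul, pow_add]; gcongr
  · rw [abs_mul, two_mul, pow_add]; gcongr

theorem Store.FitsLevels.succ {lev : ℕ → ℕ} {s₀ s : Store} {t : ℕ} (h : s.FitsLevels lev s₀ t) :
    s.FitsLevels lev s₀ (t + 1) := by
  intro m i j
  have := h m i j
  split_ifs at this ⊢
  · exact this
  · exact this.mono (Nat.le_succ t)

theorem Store.FitsLevels.put {lev : ℕ → ℕ} {s₀ s : Store} {t : ℕ} (h : s.FitsLevels lev s₀ t)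
    {c : Ref} (hc : lev c.arr ≠ 0) {v : ℝ} (hv : FitsLevel (lev c.arr) (t + 1) v) :
    (s.put c v).FitsLevels lev s₀ (t + 1) := by
  intro m i j
  have := h.succ m i j
  rw [Store.num_put]
  by_cases hm : m = c.arr ∧ i = s.reg c.row ∧ j = s.reg c.col
  · rw [if_pos hm, if_neg (by rw [hm.1]; exact hc), hm.1]; exact hv
  · rw [if_neg hm]; exact this

theorem Store.FitsLevels.get {lev : ℕ → ℕ} {s₀ s : Store} {t : ℕ} (h : s.FitsLevels lev s₀ t)
    {c : Ref} (hc : lev c.arr ≠ 0) : FitsLevel (lev c.arr) t (s.get c) := by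
  have := h c.arr (s.reg c.row) (s.reg c.col)
  rwa [if_neg hc] at this

/-- A sum or difference of integers at most doubles their bound `2 ^ t`, which is what one more step
allows. A quotient doubles the exponent `(t + 1) * 2 ^ k`, which is paid for by the higher level of
its target. Quotients never flow back to lower levels, so these doublings do not accumulate over
time. -/
theorem Config.step_fitsLevels {lev : ℕ → ℕ} {s₀ : Store} {t : ℕ} (c : Config)
    (hP : ∀ P ∈ c.todo, P.respects lev = true) (h : c.store.FitsLevels lev s₀ t) :
    (∀ P ∈ c.step.todo, P.respects lev = true) ∧ c.step.store.FitsLevels lev s₀ (t + 1) := by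
  obtain ⟨todo, s⟩ := c
  cases todo with
  | nil => exact ⟨hP, h.succ⟩
  | cons P k =>
    simp only [List.mem_cons, forall_eq_or_imp] at hP
    obtain ⟨hP, hk⟩ := hP
    induction P using Program.induct with
    | seq P Q =>
      simp only [Program.respects, Bool.and_eq_true] at hP
      exact ⟨by simpa [Config.step] using ⟨hP.1, hP.2, hk⟩, h.succ⟩
    | ite b P Q =>
      simp only [Program.respects, Bool.and_eq_true] at hP
      refine ⟨?_, h.succ⟩
      simp only [Config.step, List.mem_cons, forall_eq_or_imp]
      refine ⟨?_, hk⟩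
      split_ifs
      · exact hP.1
      · exact hP.2
    | loop b P =>
      have hP' := hP
      simp only [Program.respects] at hP
      simp only [Config.step]
      split_ifs
      · exact ⟨by simpa using ⟨hP, hP', hk⟩, h.succ⟩
      · exact ⟨hk, h.succ⟩
    | setNum c z =>
      simp only [Program.respects, Bool.and_eq_true, decide_eq_true_eq] at hP
      refine ⟨hk, h.put (by omega) (fitsLevel_int z (hP.2.trans (one_le_pow₀ (by norm_num))))⟩
    | copyNum => simp [Program.respects] at hP
    | arith op c c₁ c₂ =>
      refine ⟨hk, ?_⟩
      have addsub : ∀ {v w x : ℝ}, FitsLevel 1 t v → FitsLevel 1 t w → x = v + w ∨ x = v - w →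
          FitsLevel 1 (t + 1) x := by
        rintro v w x ⟨-, hv⟩ ⟨-, hw⟩ hx
        obtain ⟨z, rfl, hz⟩ := hv rfl
        obtain ⟨z', rfl, hz'⟩ := hw rfl
        rcases hx with rfl | rfl
        · rw [← Int.cast_add]
          refine fitsLevel_int _ ((abs_add_le z z').trans ?_)
          rw [pow_succ]; linarith
        · rw [← Int.cast_sub]
          refine fitsLevel_int _ ((abs_sub z z').trans ?_)
          rw [pow_succ]; linarith
      cases op with
      | add =>
        simp only [Program.respects, Bool.and_eq_true, decide_eq_true_eq] at hP
        obtain ⟨⟨h0, h1⟩, h2⟩ := hP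
        refine h.put (by omega) ?_
        have a1 := h.get (c := c₁) (by omega)
        have a2 := h.get (c := c₂) (by omega)
        rw [h1] at a1; rw [h2] at a2; rw [h0]
        exact addsub a1 a2 (Or.inl rfl)
      | sub =>
        simp only [Program.respects, Bool.and_eq_true, decide_eq_true_eq] at hP
        obtain ⟨⟨h0, h1⟩, h2⟩ := hP
        refine h.put (by omega) ?_
        have a1 := h.get (c := c₁) (by omega)
        have a2 := h.get (c := c₂) (by omega)
        rw [h1] at a1; rw [h2] at a2; rw [h0]
        exact addsub a1 a2 (Or.inr rfl)
      | mul => simp [Program.respects] at hP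
      | div =>
        simp only [Program.respects, Bool.and_eq_true, decide_eq_true_eq] at hP
        obtain ⟨⟨⟨h1, h2⟩, h1'⟩, h2'⟩ := hP
        refine h.put (by omega) ⟨?_, fun h => by omega⟩
        have a1 := (h.get (c := c₁) (by omega)).1
        have a2 := (h.get (c := c₂) (by omega)).1
        obtain ⟨k, hk⟩ : ∃ k, lev c.arr = k + 1 := ⟨lev c.arr - 1, by omega⟩
        have e : ∀ {l}, l < lev c.arr → (t + 1) * 2 ^ l ≤ (t + 1) * 2 ^ k := fun hl => by
          gcongr
          · norm_num
          · omega
        refine ((a1.mono (e h1')).div (a2.mono (e h2'))).mono ?_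
        rw [hk, pow_succ]
        calc 2 * ((t + 1) * 2 ^ k) = (t + 1) * (2 ^ k * 2) := by ring
          _ ≤ (t + 1 + 1) * (2 ^ k * 2) := by gcongr; omega
    | _ => exact ⟨hk, h.succ⟩

theorem Program.run_fitsLevels {lev : ℕ → ℕ} {P : Program} (hP : P.respects lev = true) (s : Store)
    (hs : ∀ m i j, lev m ≠ 0 → s.num m i j = 0) (t : ℕ) :
    (P.run s t).store.FitsLevels lev s t := by
  suffices (∀ Q ∈ (P.run s t).todo, Q.respects lev = true) ∧
    (P.run s t).store.FitsLevels lev s t from this.2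
  induction t with
  | zero =>
    refine ⟨by simpa [run] using hP, fun m i j => ?_⟩
    split_ifs with h
    · rfl
    · change FitsLevel _ _ (s.num m i j)
      rw [hs m i j h]
      simpa using fitsLevel_int (k := lev m) (t := 0) 0 (by simp)
  | succ t ih =>
    have := Config.step_fitsLevels _ ih.1 ih.2
    rw [run, Function.iterate_succ_apply']
    exact this

/-- Reducing a fraction to lowest terms does not enlarge its numerator or denominator. -/
theorem IsShortRat.bitLength {e : ℕ} {v : ℝ} (h : IsShortRat e v) :
    ∃ q : ℚ, (q : ℝ) = v ∧ bitLength q ≤ 2 * (e + 1) := by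
  obtain ⟨p, q, hq, rfl, h1, h2⟩ := h
  refine ⟨Rat.divInt p q, by rw [Rat.divInt_eq_div]; push_cast; rfl, ?_⟩
  have size_le : ∀ (z : ℤ) (k : ℕ), |z| ≤ 2 ^ e → k ≤ z.natAbs → Nat.size k ≤ e + 1 := by
    intro z k hz hk
    rw [Nat.size_le]
    have : (z.natAbs : ℤ) ≤ 2 ^ e := by rwa [Int.natCast_natAbs]
    have : z.natAbs ≤ 2 ^ e := by exact_mod_cast this
    have : 2 ^ e < 2 ^ (e + 1) := Nat.pow_lt_pow_right (by norm_num) (by omega)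
    omega
  have hden : (Rat.divInt p q).den ≤ q.natAbs := by
    have := Rat.den_dvd p q
    exact Nat.le_of_dvd (Int.natAbs_pos.2 hq) (Int.natCast_dvd.1 this)
  have hnum : (Rat.divInt p q).num.natAbs ≤ p.natAbs := by
    by_cases hp : p = 0
    · simp [hp]
    · exact Nat.le_of_dvd (Int.natAbs_pos.2 hp) (Int.natAbs_dvd_natAbs.2 (Rat.num_dvd p hq))
  have a := size_le q _ h2 hden
  have b := size_le p _ h1 hnum
  unfold HZ.bitLength
  omega

theorem eval_nat_mono (T : Polynomial ℕ) {m n : ℕ} (h : m ≤ n) :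
    T.eval m ≤ T.eval n := by
  rw [Polynomial.eval_eq_sum, Polynomial.eval_eq_sum]
  exact Finset.sum_le_sum fun i _ => Nat.mul_le_mul_left _ (Nat.pow_le_pow_left h i)

theorem one_le_bitLength (q : ℚ) : 1 ≤ bitLength q := by
  have : 0 < Nat.size q.den := Nat.size_pos.2 q.den_pos
  unfold bitLength; omega

/-- Every input number has length at least one. This turns bounds that are polynomial in `n` into
bounds that are polynomial in the input length. -/
theorem dim_le_inputLength {n : ℕ} (u : Fin n → Fin n → ℚ) (a b : Fin n → ℚ) :
    n ≤ inputLength u a b := by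
  have : ∑ _i : Fin n, 1 ≤ ∑ i, bitLength (a i) :=
    Finset.sum_le_sum fun i _ => one_le_bitLength _
  simp only [Finset.sum_const, Finset.card_univ, Fintype.card_fin, smul_eq_mul, mul_one] at this
  unfold inputLength
  omega

theorem Program.run_halted {P : Program} {s : Store} {t t' : ℕ} (h : (P.run s t).todo = [])
    (ht : t ≤ t') : P.run s t' = P.run s t := by
  obtain ⟨d, rfl⟩ := Nat.exists_eq_add_of_le ht
  induction d with
  | zero => rfl
  | succ d ih =>
    have := ih (Nat.le_add_right _ _)
    rw [← add_assoc, run, Function.iterate_succ_apply', ← run, this]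
    generalize P.run s t = c at h
    obtain ⟨todo, s⟩ := c
    simp only at h
    subst h
    rfl

/-- A program that respects levels and halts within polynomially many steps is strongly
polynomial. -/
theorem stronglyPolynomial_of_respects {lev : ℕ → ℕ} {P : Program} (hP : P.respects lev = true)
    (k : ℕ) (hlev : ∀ m, if m < 3 then lev m = 0 else 1 ≤ lev m ∧ lev m ≤ k) (T : Polynomial ℕ)
    (hT : ∀ (n : ℕ) (u : Fin n → Fin n → ℝ) (a b : Fin n → ℝ), Bivalued u a b →
      (P.run (inputStore u a b) (T.eval n)).todo = []) :
    StronglyPolynomial P := by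
  -- The first summand is `2 * (e + 1)` from `IsShortRat.bitLength`, with the exponent `e = (T + 1)
  -- * 2 ^ k` of the highest level. The other two cover the input arrays, whose cells hold input
  -- numbers or zero.
  refine ⟨⟨T, hT⟩, .C 2 * ((T + 1) * .C (2 ^ k) + 1) + .X + 1, ?_⟩
  intro n u a b hb t m i j
  set s₀ := inputStore (fun i j => (u i j : ℝ)) (fun i => (a i : ℝ)) (fun i => (b i : ℝ)) with hs₀
  -- The store no longer changes once the machine has halted, so only the first `T.eval n` steps
  -- matter.
  obtain ⟨t', ht', hrun⟩ : ∃ t' ≤ T.eval n, P.run s₀ t = P.run s₀ t' := by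
    by_cases h : t ≤ T.eval n
    · exact ⟨t, h, rfl⟩
    · exact ⟨_, le_rfl, Program.run_halted (hT n _ _ _ hb) (by omega)⟩
  rw [hrun]
  have hfit := P.run_fitsLevels hP s₀ (fun m i j hm => by
    have h3 : ¬ m < 3 := fun h => hm (by have := hlev m; rwa [if_pos h] at this)
    simp only [hs₀, inputStore]
    rw [dif_neg (by omega), dif_neg (by omega), dif_neg (by omega)]) t' m i j
  simp only [Polynomial.eval_add, Polynomial.eval_mul, Polynomial.eval_C, Polynomial.eval_X,
    Polynomial.eval_one]
  have hn := dim_le_inputLength u a b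
  have hTn := eval_nat_mono T hn
  have hl := hlev m
  split_ifs at hfit hl with h0 h3 h3
  · rw [hfit, hs₀]
    simp only [inputStore]
    split_ifs with h1 h2 h3
    · refine ⟨_, rfl, ?_⟩
      have e1 := Finset.single_le_sum (f := fun i => ∑ j, bitLength (u i j)) (fun _ _ => Nat.zero_le _)
        (Finset.mem_univ ⟨i, h1.1⟩)
      have e2 := Finset.single_le_sum (f := fun j => bitLength (u ⟨i, h1.1⟩ j))
        (fun _ _ => Nat.zero_le _) (Finset.mem_univ ⟨j, h1.2.1⟩)
      unfold inputLength; omega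
    · refine ⟨_, rfl, ?_⟩
      have e1 := Finset.single_le_sum (f := fun i => bitLength (a i)) (fun _ _ => Nat.zero_le _)
        (Finset.mem_univ ⟨i, h2.1⟩)
      unfold inputLength; omega
    · refine ⟨_, rfl, ?_⟩
      have e1 := Finset.single_le_sum (f := fun i => bitLength (b i)) (fun _ _ => Nat.zero_le _)
        (Finset.mem_univ ⟨i, h3.1⟩)
      unfold inputLength; omega
    · refine ⟨0, by simp, ?_⟩
      have : bitLength 0 = 1 := by simp [bitLength]
      omega
  · omega
  · omega
  · obtain ⟨q, hq, hq'⟩ := hfit.1.bitLength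
    refine ⟨q, hq, hq'.trans ?_⟩
    have : (t' + 1) * 2 ^ lev m ≤ (T.eval (inputLength u a b) + 1) * 2 ^ k := by
      gcongr
      · omega
      · norm_num
      · exact hl.2
    omega

/-! ## Equivalent utilities -/

/-- Affordable bundles have total size one, so the shift `d` adds the same constant to the value of
each of them. The shift may have either sign, so that the inverse of an admissible change of
utilities is covered as well. -/
theorem IsEquilibrium.of_affine {n : ℕ} {u u' x : Fin n → Fin n → ℝ} {p : Fin n → ℝ}
    (h : ∀ i, ∃ c d : ℝ, 0 < c ∧ ∀ j, u' i j = c * u i j + d) (he : IsEquilibrium u x p) :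
    IsEquilibrium u' x p := by
  refine ⟨he.price_nonneg, he.good_sold, he.affordable, fun i y hy => ?_⟩
  obtain ⟨c, d, hc, hu⟩ := h i
  have key : ∀ z : Fin n → ℝ, ∑ j, z j = 1 → ∑ j, u' i j * z j = c * ∑ j, u i j * z j + d := by
    intro z hz
    have : ∀ j, u' i j * z j = c * (u i j * z j) + d * z j := fun j => by rw [hu j]; ring
    rw [Finset.sum_congr rfl fun j _ => this j, Finset.sum_add_distrib, ← Finset.mul_sum,
      ← Finset.mul_sum, hz, mul_one]
  rw [key y hy.2.1, key _ (he.affordable i).2.1]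
  have := mul_le_mul_of_nonneg_left (he.optimal i y hy) hc.le
  linarith

theorem isEquilibrium_update_iff {n : ℕ} {u : Fin n → Fin n → ℝ} {i : Fin n} {v : Fin n → ℝ}
    (h : EquivalentUtility (u i) v) (x : Fin n → Fin n → ℝ) (p : Fin n → ℝ) :
    IsEquilibrium u x p ↔ IsEquilibrium (Function.update u i v) x p := by
  obtain ⟨s, d, hs, -, hv⟩ := h
  constructor
  · refine .of_affine fun k => ?_
    by_cases hk : k = i
    · subst hk; exact ⟨s, d, hs, fun j => by simp [hv]⟩
    · exact ⟨1, 0, one_pos, fun j => by simp [hk]⟩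
  · refine .of_affine fun k => ?_
    by_cases hk : k = i
    · subst hk
      exact ⟨s⁻¹, -(s⁻¹ * d), inv_pos.2 hs, fun j => by simp [hv]; field_simp; ring⟩
    · exact ⟨1, 0, one_pos, fun j => by simp [hk]⟩

theorem Bivalued.isEquilibrium {n : ℕ} {u : Fin n → Fin n → ℝ} {a b : Fin n → ℝ}
    (h : Bivalued u a b) {x : Fin n → Fin n → ℝ} {p : Fin n → ℝ}
    (he : IsEquilibrium (toUnit u b) x p) : IsEquilibrium u x p := by
  refine he.of_affine fun i => ⟨b i - a i, a i, sub_pos.2 (h.1 i).2, fun j => ?_⟩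
  unfold toUnit
  split_ifs with hj
  · rw [hj]; ring
  · rw [(h.2 i j).resolve_right hj]; ring

/-! ## Minimum vertex covers -/

section Cover

variable {n : ℕ} {u : Fin n → Fin n → ℝ}

theorem exists_isMinVertexCover (u : Fin n → Fin n → ℝ) : ∃ G₁ A₂, IsMinVertexCover u G₁ A₂ := by
  classical
  obtain ⟨⟨G, A⟩, hc, hmin⟩ := Set.exists_min_image
    {c : Finset (Fin n) × Finset (Fin n) | IsVertexCover u c.1 c.2} (fun c => c.1.card + c.2.card)
    (Set.toFinite _) ⟨(Finset.univ, Finset.univ), fun i j _ => Or.inl (Finset.mem_univ _)⟩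
  exact ⟨G, A, hc, fun G' A' h => hmin (G', A') h⟩

theorem exists_isMaxMatchingIn (u : Fin n → Fin n → ℝ) (A G : Finset (Fin n)) :
    ∃ M, IsMaxMatchingIn u A G M := by
  classical
  obtain ⟨M, hc, hmax⟩ := Set.exists_max_image
    {M : Finset (Fin n × Fin n) | IsMatchingIn u A G M} (fun M => M.card)
    (Set.toFinite _) ⟨∅, by simp [IsMatchingIn, IsMatching]⟩
  exact ⟨M, hc, fun M' h => hmax M' h⟩

/-- The agents of `A` who are interested in a good of `T`. -/
abbrev nbrIn (u : Fin n → Fin n → ℝ) (A T : Finset (Fin n)) : Finset (Fin n) :=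
  A.filter fun i => ∃ j ∈ T, u i j = 1

/-- The goods of `G` in which an agent of `X` is interested. -/
abbrev goodsIn (u : Fin n → Fin n → ℝ) (G X : Finset (Fin n)) : Finset (Fin n) :=
  G.filter fun j => ∃ i ∈ X, u i j = 1

/-- Exchange argument: replacing the goods of `T` in the cover by their neighbours outside `A₂`
gives a cover again. The inequality says that the initial prices, all one, are feasible. -/
theorem IsMinVertexCover.card_le_nbrIn {G₁ A₂ : Finset (Fin n)} (h : IsMinVertexCover u G₁ A₂)
    {T : Finset (Fin n)} (hT : T ⊆ G₁) : T.card ≤ (nbrIn u A₂ᶜ T).card := by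
  have := h.2 (G₁ \ T) (A₂ ∪ nbrIn u A₂ᶜ T) (fun i j hij => by
    rcases h.1 i j hij with hi | hj
    · exact Or.inl (Finset.mem_union_left _ hi)
    · by_cases hjT : j ∈ T
      · by_cases hi : i ∈ A₂
        · exact Or.inl (Finset.mem_union_left _ hi)
        · exact Or.inl (Finset.mem_union_right _ (by simpa [hi] using ⟨j, hjT, hij⟩))
      · exact Or.inr (by simp [hj, hjT]))
  have h1 := Finset.card_union_le A₂ (nbrIn u A₂ᶜ T)
  have h2 := Finset.card_sdiff_add_card_eq_card hT
  omega

/-- The mirror image: the agents of `X` are exchanged for the goods outside `G₁` that they like.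
This is Hall's condition for matching `A₂` into the complement of `G₁`. -/
theorem IsMinVertexCover.card_le_goodsIn {G₁ A₂ : Finset (Fin n)} (h : IsMinVertexCover u G₁ A₂)
    {X : Finset (Fin n)} (hX : X ⊆ A₂) : X.card ≤ (goodsIn u G₁ᶜ X).card := by
  have := h.2 (G₁ ∪ goodsIn u G₁ᶜ X) (A₂ \ X) (fun i j hij => by
    rcases h.1 i j hij with hi | hj
    · by_cases hiX : i ∈ X
      · by_cases hj : j ∈ G₁
        · exact Or.inr (Finset.mem_union_left _ hj)
        · exact Or.inr (Finset.mem_union_right _ (by simpa [hj] using ⟨i, hiX, hij⟩))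
      · exact Or.inl (by simp [hi, hiX])
    · exact Or.inr (Finset.mem_union_left _ hj))
  have h1 := Finset.card_union_le G₁ (goodsIn u G₁ᶜ X)
  have h2 := Finset.card_sdiff_add_card_eq_card hX
  omega

/-- Hall's theorem for the agents of `A` and the goods of `G`. -/
theorem exists_matchingIn_of_hall {A G : Finset (Fin n)}
    (h : ∀ X ⊆ A, X.card ≤ (goodsIn u G X).card) :
    ∃ M, IsMatchingIn u A G M ∧ (∀ i ∈ A, ∃ j, (i, j) ∈ M) ∧ M.card = A.card := by
  classical
  obtain ⟨f, hf, hfm⟩ := (Finset.all_card_le_biUnion_card_iff_exists_injective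
    (fun i : A => G.filter fun j => u i j = 1)).1 (by
    intro s
    have := h (s.map (Function.Embedding.subtype _)) (by
      intro i hi
      simp only [Finset.mem_map, Function.Embedding.subtype_apply] at hi
      obtain ⟨a, -, rfl⟩ := hi
      exact a.2)
    rw [Finset.card_map] at this
    refine this.trans (Finset.card_le_card ?_)
    intro j hj
    simp only [goodsIn, Finset.mem_filter, Finset.mem_map, Function.Embedding.subtype_apply] at hj
    obtain ⟨hj, i, ⟨a, ha, rfl⟩, hij⟩ := hj
    exact Finset.mem_biUnion.2 ⟨a, ha, Finset.mem_filter.2 ⟨hj, hij⟩⟩)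
  have hmem : ∀ i : A, f i ∈ G ∧ u i (f i) = 1 := fun i => by simpa using hfm i
  refine ⟨Finset.univ.image fun i : A => ((i : Fin n), f i), ⟨⟨?_, ?_⟩, ?_⟩, ?_, ?_⟩
  · simp only [Finset.mem_image, Finset.mem_univ, true_and]
    rintro _ ⟨i, rfl⟩; exact (hmem i).2
  · simp only [Finset.mem_image, Finset.mem_univ, true_and]
    rintro _ ⟨i, rfl⟩ _ ⟨k, rfl⟩ (h | h)
    · have : i = k := Subtype.ext h
      rw [this]
    · have : i = k := hf h
      rw [this]
  · simp only [Finset.mem_image, Finset.mem_univ, true_and]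
    rintro _ ⟨i, rfl⟩; exact ⟨i.2, (hmem i).1⟩
  · intro i hi
    exact ⟨f ⟨i, hi⟩, Finset.mem_image.2 ⟨⟨i, hi⟩, Finset.mem_univ _, rfl⟩⟩
  · rw [Finset.card_image_of_injective _ (fun i k h => Subtype.ext (Prod.ext_iff.1 h).1)]
    simp

theorem IsMatching.card_image_fst {M : Finset (Fin n × Fin n)} (h : IsMatching u M) :
    (M.image Prod.fst).card = M.card :=
  Finset.card_image_of_injOn fun e he f hf hef => h.2 e he f hf (Or.inl hef)

theorem IsMatching.card_image_snd {M : Finset (Fin n × Fin n)} (h : IsMatching u M) :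
    (M.image Prod.snd).card = M.card :=
  Finset.card_image_of_injOn fun e he f hf hef => h.2 e he f hf (Or.inr hef)

/-- By Hall's theorem some matching has `A₂.card` edges, so a maximum one has as many, and its edges
have distinct ends in `A₂`. -/
theorem IsMinVertexCover.covers_agents {G₁ A₂ : Finset (Fin n)} (h : IsMinVertexCover u G₁ A₂)
    {M : Finset (Fin n × Fin n)} (hM : IsMaxMatchingIn u A₂ G₁ᶜ M) :
    ∀ i ∈ A₂, ∃ j, (i, j) ∈ M := by
  obtain ⟨M', hM', -, hc⟩ := exists_matchingIn_of_hall fun X hX => h.card_le_goodsIn hX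
  have hle := hM.2 M' hM'
  have hsub : M.image Prod.fst ⊆ A₂ := by
    intro i hi
    obtain ⟨e, he, rfl⟩ := Finset.mem_image.1 hi
    exact (hM.1.2 e he).1
  have := Finset.eq_of_subset_of_card_le hsub (by rw [hM.1.1.card_image_fst]; omega)
  intro i hi
  rw [← this] at hi
  obtain ⟨⟨_, j⟩, he, rfl⟩ := Finset.mem_image.1 hi
  exact ⟨j, he⟩

theorem IsMatching.isPerfectMatching {M : Finset (Fin n × Fin n)} (h : IsMatching u M)
    (hc : n ≤ M.card) : IsPerfectMatching u M := by
  refine ⟨h, fun i => ?_, fun j => ?_⟩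
  · have := Finset.eq_univ_of_card (M.image Prod.fst)
      (le_antisymm (Finset.card_le_univ _) (by simpa [h.card_image_fst] using hc))
    obtain ⟨⟨_, j⟩, he, rfl⟩ := Finset.mem_image.1 (this ▸ Finset.mem_univ i)
    exact ⟨j, he⟩
  · have := Finset.eq_univ_of_card (M.image Prod.snd)
      (le_antisymm (Finset.card_le_univ _) (by simpa [h.card_image_snd] using hc))
    obtain ⟨⟨i, _⟩, he, rfl⟩ := Finset.mem_image.1 (this ▸ Finset.mem_univ j)
    exact ⟨i, he⟩

/-- König's theorem by way of Hall's: for every set `X` of agents, the neighbours of `X` and the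
agents outside `X` form a cover. If every cover had at least `n` vertices, then Hall's condition
would hold for all agents. The strict inequality provides goods of price zero and goods to fill up
the bundles with. -/
theorem IsMinVertexCover.card_lt {G₁ A₂ : Finset (Fin n)} (h : IsMinVertexCover u G₁ A₂)
    (hp : ¬ ∃ M, IsPerfectMatching u M) : G₁.card + A₂.card < n := by
  by_contra hn
  refine hp ?_
  obtain ⟨M, hM, -, hc⟩ := exists_matchingIn_of_hall (u := u) (A := Finset.univ) (G := Finset.univ)
    fun X _ => by
      have := h.2 (goodsIn u Finset.univ X) Xᶜ (fun i j hij => by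
        by_cases hi : i ∈ X
        · exact Or.inr (by simpa using ⟨i, hi, hij⟩)
        · exact Or.inl (by simpa using hi))
      have h2 := Finset.card_add_card_compl X
      rw [Fintype.card_fin] at h2
      omega
  exact ⟨M, hM.1.isPerfectMatching (by simp [hc])⟩

end Cover

/-! ## Invariants of the simplified DPSV algorithm -/

section DPSV

variable {n : ℕ} {u : Fin n → Fin n → ℝ} {A₁ G₁ : Finset (Fin n)}

/-- What holds in every state that the simplified DPSV algorithm reaches. -/
structure PriceState.Sound (u : Fin n → Fin n → ℝ) (A₁ G₁ : Finset (Fin n)) (s : PriceState n) :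
    Prop where
  active_subset : s.active ⊆ G₁
  agents_subset : s.agents ⊆ A₁
  active_price : ∃ c ≥ 1, ∀ j ∈ s.active, s.price j = c
  price_outside : ∀ j ∉ G₁, s.price j = 0
  one_le_price : ∀ j ∈ G₁, 1 ≤ s.price j
  feasible : ∀ T ⊆ s.active, ∑ j ∈ T, s.price j ≤ (s.nbr u T).card
  alloc_nonneg : ∀ i j, 0 ≤ s.alloc i j
  alloc_support : ∀ i j, s.alloc i j ≠ 0 →
    (i ∈ A₁ ∧ i ∉ s.agents) ∧ (j ∈ G₁ ∧ j ∉ s.active) ∧ u i j = 1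
  sold : ∀ j ∈ G₁, j ∉ s.active → ∑ i, s.alloc i j = 1
  spent : ∀ i ∈ A₁, i ∉ s.agents → ∑ j, s.price j * s.alloc i j = 1
  -- The price `c` at which agent `i` has bought: the goods bought are frozen at `c`, while the
  -- other goods that it likes can only become dearer.
  cheapest : ∀ i ∈ A₁, i ∉ s.agents → ∃ c ≥ 1, (∀ j ∈ G₁, u i j = 1 → c ≤ s.price j) ∧
    ∀ j, s.alloc i j ≠ 0 → s.price j = c
  -- Every agent interested in a frozen set leaves together with it. Hence an agent who is present
  -- when no good is active likes no good of `G₁`.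
  indifferent : ∀ i ∈ s.agents, ∀ j ∈ G₁, j ∉ s.active → u i j ≠ 1

theorem PriceState.Sound.init (h : ∀ T ⊆ G₁, T.card ≤ (nbrIn u A₁ T).card) :
    (PriceState.init A₁ G₁).Sound u A₁ G₁ where
  active_subset := subset_rfl
  agents_subset := subset_rfl
  active_price := ⟨1, le_rfl, fun j hj => if_pos hj⟩
  price_outside j hj := if_neg hj
  one_le_price j hj := (if_pos hj).ge
  feasible T hT := by
    have : ∑ j ∈ T, (PriceState.init A₁ G₁).price j = T.card := by
      refine (Finset.sum_congr rfl fun j hj => ?_).trans (Finset.sum_const (1 : ℝ)) |>.trans (by simp)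
      exact if_pos (hT hj)
    rw [this]
    exact_mod_cast h T hT
  alloc_nonneg i j := le_rfl
  alloc_support i j h := absurd rfl h
  sold j h h' := absurd h h'
  spent i h h' := absurd h h'
  cheapest i h h' := absurd h h'
  indifferent i _ j h h' := absurd h h'

theorem PriceState.raised_of_mem {s : PriceState n} {δ : ℝ} {j : Fin n} (h : j ∈ s.active) :
    s.raised δ j = s.price j + δ := if_pos h

theorem PriceState.raised_of_notMem {s : PriceState n} {δ : ℝ} {j : Fin n} (h : j ∉ s.active) :
    s.raised δ j = s.price j := if_neg h

theorem PriceState.price_le_raised {s : PriceState n} {δ : ℝ} (hδ : 0 ≤ δ) (j : Fin n) :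
    s.price j ≤ s.raised δ j := by
  unfold PriceState.raised
  split_ifs <;> linarith

theorem PriceState.mem_nbr {s : PriceState n} {T : Finset (Fin n)} {i : Fin n} :
    i ∈ s.nbr u T ↔ i ∈ s.agents ∧ ∃ j ∈ T, u i j = 1 := Finset.mem_filter

/-- What is sold now involves only present agents and active goods, and earlier sales involve
neither, so the two allocations do not interfere. The raise leaves the prices of frozen goods alone,
so past spending stays correct. -/
theorem PriceState.Sound.freeze {s : PriceState n} (h : s.Sound u A₁ G₁) {δ : ℝ}
    {S : Finset (Fin n)} {y : Fin n → Fin n → ℝ} (ht : s.GoesTight u δ S)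
    (hc : s.Clears u δ S y) : (s.freeze u δ S y).Sound u A₁ G₁ := by
  obtain ⟨hδ, hSne, hS, hfeas, htight⟩ := ht
  obtain ⟨hy0, hysupp, hysold, hyspent⟩ := hc
  obtain ⟨c, hc1, hcp⟩ := h.active_price
  have hr : ∀ j ∈ s.active, s.raised δ j = c + δ := fun j hj => by
    rw [raised_of_mem hj, hcp j hj]
  have agents_iff : ∀ i, i ∈ (s.freeze u δ S y).agents ↔ i ∈ s.agents ∧ i ∉ s.nbr u S := fun i => by
    simp [PriceState.freeze]
  have active_iff : ∀ j, j ∈ (s.freeze u δ S y).active ↔ j ∈ s.active ∧ j ∉ S := fun j => by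
    simp [PriceState.freeze]
  have alloc_zero : ∀ i j, i ∈ s.agents ∨ j ∈ s.active → s.alloc i j = 0 := fun i j hij => by
    by_contra h0
    obtain ⟨⟨-, h1⟩, ⟨-, h2⟩, -⟩ := h.alloc_support i j h0
    exact hij.elim h1 h2
  have y_zero : ∀ i j, i ∉ s.nbr u S ∨ j ∉ S → y i j = 0 := fun i j hij => by
    by_contra h0
    obtain ⟨h1, h2, -⟩ := hysupp i j h0
    exact hij.elim (fun h => h h1) fun h => h h2
  have nbr_sub : ∀ {i}, i ∈ s.nbr u S → i ∈ s.agents := fun hi => (mem_nbr.1 hi).1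
  refine ⟨?_, ?_, ?_, ?_, ?_, ?_, ?_, ?_, ?_, ?_, ?_, ?_⟩
  · exact fun j hj => h.active_subset ((active_iff j).1 hj).1
  · exact fun i hi => h.agents_subset ((agents_iff i).1 hi).1
  · exact ⟨c + δ, by linarith, fun j hj => hr j ((active_iff j).1 hj).1⟩
  · intro j hj
    change s.raised δ j = 0
    rw [raised_of_notMem (fun h' => hj (h.active_subset h')), h.price_outside j hj]
  · exact fun j hj => (h.one_le_price j hj).trans (price_le_raised hδ j)
  · intro T hT
    have hTa : T ⊆ s.active := fun j hj => ((active_iff j).1 (hT hj)).1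
    have hd : Disjoint S T := Finset.disjoint_right.2 fun j hj => ((active_iff j).1 (hT hj)).2
    -- The inequality for `S ∪ T` minus the tight equation for `S` leaves the inequality for `T`,
    -- because each neighbour of `S ∪ T` either leaves with `S` or is still a neighbour of `T`.
    have h1 := hfeas (S ∪ T) (Finset.union_subset hS hTa)
    rw [Finset.sum_union hd, htight] at h1
    have h2 : (s.nbr u (S ∪ T)).card ≤
        (s.nbr u S).card + ((s.freeze u δ S y).nbr u T).card := by
      refine (Finset.card_le_card ?_).trans (Finset.card_union_le _ _)
      intro i hi
      obtain ⟨hi, j, hj, hij⟩ := mem_nbr.1 hi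
      by_cases hiS : i ∈ s.nbr u S
      · exact Finset.mem_union_left _ hiS
      · refine Finset.mem_union_right _ (mem_nbr.2 ⟨(agents_iff i).2 ⟨hi, hiS⟩, j, ?_, hij⟩)
        exact (Finset.mem_union.1 hj).resolve_left fun hjS => hiS (mem_nbr.2 ⟨hi, j, hjS, hij⟩)
    have h3 : ((s.nbr u (S ∪ T)).card : ℝ) ≤
        (s.nbr u S).card + ((s.freeze u δ S y).nbr u T).card := by exact_mod_cast h2
    change ∑ j ∈ T, s.raised δ j ≤ _
    linarith
  · exact fun i j => add_nonneg (h.alloc_nonneg i j) (hy0 i j)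
  · intro i j hij
    change s.alloc i j + y i j ≠ 0 at hij
    by_cases h0 : s.alloc i j = 0
    · have hy : y i j ≠ 0 := by intro h'; simp [h0, h'] at hij
      obtain ⟨h1, h2, h3⟩ := hysupp i j hy
      exact ⟨⟨h.agents_subset (nbr_sub h1), fun h' => ((agents_iff i).1 h').2 h1⟩,
        ⟨h.active_subset (hS h2), fun h' => ((active_iff j).1 h').2 h2⟩, h3⟩
    · obtain ⟨⟨h1, h1'⟩, ⟨h2, h2'⟩, h3⟩ := h.alloc_support i j h0
      exact ⟨⟨h1, fun h' => h1' ((agents_iff i).1 h').1⟩,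
        ⟨h2, fun h' => h2' ((active_iff j).1 h').1⟩, h3⟩
  · intro j hj hja
    change ∑ i, (s.alloc i j + y i j) = 1
    rw [Finset.sum_add_distrib]
    by_cases hjS : j ∈ S
    · rw [hysold j hjS, Finset.sum_eq_zero fun i _ => alloc_zero i j (Or.inr (hS hjS)), zero_add]
    · have : j ∉ s.active := fun h' => hja ((active_iff j).2 ⟨h', hjS⟩)
      rw [h.sold j hj this, Finset.sum_eq_zero fun i _ => y_zero i j (Or.inr hjS), add_zero]
  · intro i hi hia
    change ∑ j, s.raised δ j * (s.alloc i j + y i j) = 1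
    by_cases hiS : i ∈ s.nbr u S
    · rw [← hyspent i hiS]
      exact Finset.sum_congr rfl fun j _ => by rw [alloc_zero i j (Or.inl (nbr_sub hiS)), zero_add]
    · have : i ∉ s.agents := fun h' => hia ((agents_iff i).2 ⟨h', hiS⟩)
      rw [← h.spent i hi this]
      refine Finset.sum_congr rfl fun j _ => ?_
      rw [y_zero i j (Or.inl hiS), add_zero]
      by_cases hja : j ∈ s.active
      · rw [alloc_zero i j (Or.inr hja), mul_zero, mul_zero]
      · rw [raised_of_notMem hja]
  · intro i hi hia
    by_cases hiS : i ∈ s.nbr u S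
    · refine ⟨c + δ, by linarith, fun j hj hij => ?_, fun j hij => ?_⟩
      · refine (hr j ?_).ge
        by_contra hja
        exact h.indifferent i (nbr_sub hiS) j hj hja hij
      · change s.alloc i j + y i j ≠ 0 at hij
        rw [alloc_zero i j (Or.inl (nbr_sub hiS)), zero_add] at hij
        exact hr j (hS (hysupp i j hij).2.1)
    · have hia' : i ∉ s.agents := fun h' => hia ((agents_iff i).2 ⟨h', hiS⟩)
      obtain ⟨d, hd, hd1, hd2⟩ := h.cheapest i hi hia'
      refine ⟨d, hd, fun j hj hij => (hd1 j hj hij).trans (price_le_raised hδ j), fun j hij => ?_⟩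
      change s.alloc i j + y i j ≠ 0 at hij
      rw [y_zero i j (Or.inl hiS), add_zero] at hij
      change s.raised δ j = d
      rw [raised_of_notMem (h.alloc_support i j hij).2.1.2, hd2 j hij]
  · intro i hi j hj hja hij
    obtain ⟨hi, hiS⟩ := (agents_iff i).1 hi
    by_cases hjS : j ∈ S
    · exact hiS (mem_nbr.2 ⟨hi, j, hjS, hij⟩)
    · exact h.indifferent i hi j hj (fun h' => hja ((active_iff j).2 ⟨h', hjS⟩)) hij

theorem DPSVReaches.sound (h : ∀ T ⊆ G₁, T.card ≤ (nbrIn u A₁ T).card) {s : PriceState n}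
    (hs : DPSVReaches u A₁ G₁ s) : s.Sound u A₁ G₁ := by
  induction hs with
  | init => exact .init h
  | freeze s δ S y _ ht hc ih => exact ih.freeze ht hc

/-- The prices can be raised until a set goes tight. -/
theorem PriceState.Sound.exists_goesTight {s : PriceState n} (h : s.Sound u A₁ G₁)
    (hne : s.active.Nonempty) : ∃ δ S, s.GoesTight u δ S := by
  classical
  -- The first set to go tight is the one with the least slack per good, and this slack is the
  -- amount of the raise.
  obtain ⟨S, hS, hmin⟩ := Finset.exists_min_image (s.active.powerset.filter Finset.Nonempty)
    (fun T => ((s.nbr u T).card - ∑ j ∈ T, s.price j) / (T.card : ℝ))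
    ⟨s.active, by simpa using hne⟩
  simp only [Finset.mem_filter, Finset.mem_powerset] at hS hmin
  set δ := ((s.nbr u S).card - ∑ j ∈ S, s.price j) / (S.card : ℝ) with hδ
  have hsum : ∀ T ⊆ s.active, ∑ j ∈ T, s.raised δ j = ∑ j ∈ T, s.price j + T.card * δ := by
    intro T hT
    rw [Finset.sum_congr rfl fun j hj => raised_of_mem (hT hj), Finset.sum_add_distrib]
    simp
  have hpos : ∀ {T : Finset (Fin n)}, T.Nonempty → (0 : ℝ) < T.card := fun hT => by
    exact_mod_cast hT.card_pos
  refine ⟨δ, S, ?_, hS.2, hS.1, fun T hT => ?_, ?_⟩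
  · exact div_nonneg (sub_nonneg.2 (h.feasible S hS.1)) (hpos hS.2).le
  · rw [hsum T hT]
    rcases T.eq_empty_or_nonempty with rfl | hTne
    · simp
    · have := hmin T ⟨hT, hTne⟩
      rw [le_div_iff₀ (hpos hTne)] at this
      linarith
  · rw [hsum S hS.1, hδ, mul_div_cancel₀ _ (hpos hS.2).ne']
    ring

/-- The local market of a tight set can be cleared, by Hall's theorem for `|N(S)|` copies of each
good of `S` and `|S|` copies of each agent. -/
theorem PriceState.Sound.exists_clears {s : PriceState n} (h : s.Sound u A₁ G₁) {δ : ℝ}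
    {S : Finset (Fin n)} (ht : s.GoesTight u δ S) : ∃ y, s.Clears u δ S y := by
  classical
  obtain ⟨hδ, hSne, hS, hfeas, htight⟩ := ht
  obtain ⟨c, hc1, hcp⟩ := h.active_price
  set k := (s.nbr u S).card with hk
  set m := S.card with hm
  -- All active goods cost the same, so tightness of `S` becomes the equation `m * q = k`.
  set q := c + δ with hq
  have hr : ∀ j ∈ s.active, s.raised δ j = q := fun j hj => by
    rw [raised_of_mem hj, hcp j hj]
  have hsum : ∀ T ⊆ s.active, ∑ j ∈ T, s.raised δ j = T.card * q := by
    intro T hT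
    rw [Finset.sum_congr rfl fun j hj => hr j (hT hj)]
    simp
  have hmpos : 0 < m := hSne.card_pos
  have hmq : (m : ℝ) * q = k := by rw [← hsum S hS, htight]
  have hq1 : 1 ≤ q := by linarith
  have hkpos : 0 < k := by
    have : (0 : ℝ) < k := by rw [← hmq]; positivity
    exact_mod_cast this
  obtain ⟨f, hf, hfm⟩ := (Finset.all_card_le_biUnion_card_iff_exists_injective
    (fun e : S × Fin k => ((s.nbr u S).filter fun i => u i e.1 = 1) ×ˢ
      (Finset.univ : Finset (Fin m)))).1 (by
    intro X
    set T := (X.image Prod.fst).map (Function.Embedding.subtype _) with hT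
    have hTS : T ⊆ S := fun j hj => by
      obtain ⟨a, -, rfl⟩ := Finset.mem_map.1 hj
      exact a.2
    have h1 : X.card ≤ T.card * k := by
      have : X ⊆ (X.image Prod.fst) ×ˢ (Finset.univ : Finset (Fin k)) := fun e he =>
        Finset.mem_product.2 ⟨Finset.mem_image_of_mem _ he, Finset.mem_univ _⟩
      have := Finset.card_le_card this
      rw [Finset.card_product, Finset.card_univ, Fintype.card_fin] at this
      rwa [hT, Finset.card_map]
    -- Feasibility of `T` reads `T.card * q ≤ |N(T)|`; multiplied by `m` it becomes Hall's
    -- inequality, as `m * q = k`.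
    have h2 : T.card * k ≤ (s.nbr u T).card * m := by
      have := hfeas T (hTS.trans hS)
      rw [hsum T (hTS.trans hS)] at this
      have : (T.card : ℝ) * k ≤ (s.nbr u T).card * m := by
        rw [← hmq]
        have hm0 : (0 : ℝ) < m := by exact_mod_cast hmpos
        nlinarith
      exact_mod_cast this
    refine (h1.trans h2).trans ?_
    have : (s.nbr u T) ×ˢ (Finset.univ : Finset (Fin m)) ⊆ X.biUnion (fun e =>
        ((s.nbr u S).filter fun i => u i e.1 = 1) ×ˢ (Finset.univ : Finset (Fin m))) := by
      rintro ⟨i, v⟩ hiv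
      obtain ⟨hi, j, hj, hij⟩ := mem_nbr.1 (Finset.mem_product.1 hiv).1
      obtain ⟨a, ha, rfl⟩ := Finset.mem_map.1 hj
      obtain ⟨e, he, rfl⟩ := Finset.mem_image.1 ha
      refine Finset.mem_biUnion.2 ⟨e, he, Finset.mem_product.2 ⟨Finset.mem_filter.2 ⟨?_, hij⟩,
        Finset.mem_univ _⟩⟩
      exact mem_nbr.2 ⟨hi, e.1, e.1.2, hij⟩
    have := Finset.card_le_card this
    rwa [Finset.card_product, Finset.card_univ, Fintype.card_fin] at this)
  have hfm' : ∀ e, (f e).1 ∈ s.nbr u S ∧ u (f e).1 e.1 = 1 := fun e => by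
    simpa using hfm e
  -- There are `m * k` copies on either side, so the injection is onto: each agent receives exactly
  -- `m` copies of goods.
  have himg : Finset.univ.image f = (s.nbr u S) ×ˢ (Finset.univ : Finset (Fin m)) := by
    refine Finset.eq_of_subset_of_card_le ?_ ?_
    · intro v hv
      obtain ⟨e, -, rfl⟩ := Finset.mem_image.1 hv
      exact Finset.mem_product.2 ⟨(hfm' e).1, Finset.mem_univ _⟩
    · rw [Finset.card_image_of_injective _ hf]
      simp only [Finset.card_product, Finset.card_univ, Fintype.card_prod, Fintype.card_fin,
        Fintype.card_coe]
      rw [← hk, ← hm, mul_comm]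
  set N : Fin n → Fin n → Finset (S × Fin k) := fun i j =>
    Finset.univ.filter fun e => (f e).1 = i ∧ (e.1 : Fin n) = j with hN
  have hk0 : (k : ℝ) ≠ 0 := by exact_mod_cast hkpos.ne'
  -- One copy of a good stands for the share `1 / k` of it.
  refine ⟨fun i j => (N i j).card / k, fun i j => by positivity, ?_, ?_, ?_⟩
  · intro i j hij
    have : (N i j).card ≠ 0 := by intro h0; simp [h0] at hij
    obtain ⟨e, he⟩ := Finset.card_ne_zero.1 this
    simp only [hN, Finset.mem_filter, Finset.mem_univ, true_and] at he
    obtain ⟨rfl, rfl⟩ := he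
    exact ⟨(hfm' e).1, e.1.2, (hfm' e).2⟩
  · intro j hj
    rw [← Finset.sum_div, ← Nat.cast_sum]
    have : ∑ i, (N i j).card = k := by
      have h1 := Finset.card_eq_sum_card_fiberwise (f := fun e => (f e).1)
        (s := Finset.univ.filter fun e : S × Fin k => (e.1 : Fin n) = j) (t := Finset.univ)
        (fun _ _ => by simp)
      have h2 : (Finset.univ.filter fun e : S × Fin k => (e.1 : Fin n) = j) =
          {⟨j, hj⟩} ×ˢ (Finset.univ : Finset (Fin k)) := by
        ext ⟨a, v⟩
        simp [Subtype.ext_iff, eq_comm]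
      rw [h2, Finset.card_product, Finset.card_singleton, Finset.card_univ, Fintype.card_fin,
        one_mul, ← h2] at h1
      refine Eq.trans (Finset.sum_congr rfl fun i _ => ?_) h1.symm
      congr 1
      ext e
      simp [hN, and_comm]
    rw [this, div_self hk0]
  · intro i hi
    have hcount : ∑ j, (N i j).card = m := by
      have h1 := Finset.card_eq_sum_card_fiberwise (f := fun e : S × Fin k => (e.1 : Fin n))
        (s := Finset.univ.filter fun e : S × Fin k => (f e).1 = i) (t := Finset.univ)
        (fun _ _ => by simp)
      have h2 : (Finset.univ.filter fun e : S × Fin k => (f e).1 = i).image f =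
          {i} ×ˢ (Finset.univ : Finset (Fin m)) := by
        ext ⟨a, v⟩
        simp only [Finset.mem_image, Finset.mem_filter, Finset.mem_univ, true_and,
          Finset.mem_product, Finset.mem_singleton, and_true]
        constructor
        · rintro ⟨e, rfl, he⟩; rw [he]
        · rintro rfl
          have : (a, v) ∈ Finset.univ.image f := by rw [himg]; simpa using hi
          obtain ⟨e, -, he⟩ := Finset.mem_image.1 this
          exact ⟨e, by rw [he], he⟩
      rw [← Finset.card_image_of_injective _ hf, h2, Finset.card_product, Finset.card_singleton,
        Finset.card_univ, Fintype.card_fin, one_mul] at h1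
      rw [h1]
      refine Finset.sum_congr rfl fun j _ => ?_
      congr 1
      ext e
      simp [hN]
    -- An agent pays `q / k` for each of its `m` copies, which makes `m * q / k = 1` dollar.
    have : ∀ j, s.raised δ j * ((N i j).card / (k : ℝ)) = q / k * (N i j).card := by
      intro j
      by_cases hj : j ∈ S
      · rw [hr j (hS hj)]; ring
      · have : (N i j).card = 0 := by
          rw [Finset.card_eq_zero, Finset.eq_empty_iff_forall_notMem]
          intro e he
          simp only [hN, Finset.mem_filter, Finset.mem_univ, true_and] at he
          exact hj (he.2 ▸ e.1.2)
        simp [this]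
    rw [Finset.sum_congr rfl fun j _ => this j, ← Finset.mul_sum, ← Nat.cast_sum, hcount,
      div_mul_eq_mul_div, mul_comm q, hmq, div_self hk0]

end DPSV

/-! ## Algorithm 1 finds equilibria -/

section Correctness

variable {n : ℕ} {u : Fin n → Fin n → ℝ}

theorem IsMatching.indicator_row {M : Finset (Fin n × Fin n)} (h : IsMatching u M) {i j₀ : Fin n}
    (hj : (i, j₀) ∈ M) (j : Fin n) :
    (if (i, j) ∈ M then (1 : ℝ) else 0) = if j = j₀ then 1 else 0 := by
  by_cases hjj : j = j₀
  · subst hjj; simp [hj]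
  · rw [if_neg hjj, if_neg]
    intro hm
    exact hjj (Prod.ext_iff.1 (h.2 _ hm _ hj (Or.inl rfl))).2

theorem IsMatching.indicator_col {M : Finset (Fin n × Fin n)} (h : IsMatching u M) {i₀ j : Fin n}
    (hi : (i₀, j) ∈ M) (i : Fin n) :
    (if (i, j) ∈ M then (1 : ℝ) else 0) = if i = i₀ then 1 else 0 := by
  by_cases hii : i = i₀
  · subst hii; simp [hi]
  · rw [if_neg hii, if_neg]
    intro hm
    exact hii (Prod.ext_iff.1 (h.2 _ hm _ hi (Or.inr rfl))).1

theorem IsUnit01.utility_le_one (hu : IsUnit01 u) {p y : Fin n → ℝ} (hy : Affordable p y)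
    (i : Fin n) : ∑ j, u i j * y j ≤ 1 := by
  rw [← hy.2.1]
  refine Finset.sum_le_sum fun j _ => ?_
  have := hy.1 j
  rcases hu i j with h | h <;> rw [h] <;> linarith

theorem IsPerfectMatching.isEquilibrium (hu : IsUnit01 u) {M : Finset (Fin n × Fin n)}
    (h : IsPerfectMatching u M) :
    IsEquilibrium u (fun i j => if (i, j) ∈ M then 1 else 0) (fun _ => 0) := by
  refine ⟨fun _ => le_rfl, fun j => ?_, fun i => ⟨fun j => ?_, ?_, by simp⟩, fun i y hy => ?_⟩
  · obtain ⟨i₀, hi⟩ := h.2.2 j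
    simp [h.1.indicator_col hi]
  · dsimp only; split_ifs <;> norm_num
  · obtain ⟨j₀, hj⟩ := h.2.1 i
    simp [h.1.indicator_row hj]
  · obtain ⟨j₀, hj⟩ := h.2.1 i
    refine (hu.utility_le_one hy i).trans ?_
    simp [h.1.indicator_row hj, h.1.1 _ hj]

variable {G₁ A₂ : Finset (Fin n)} {M : Finset (Fin n × Fin n)} {s : PriceState n}
  {x : Fin n → Fin n → ℝ}

theorem IsFilledUp.eq_alloc (hM : IsMatchingIn u A₂ G₁ᶜ M) (hs : s.Sound u A₂ᶜ G₁)
    (hx : IsFilledUp A₂ G₁ M s x) (i : Fin n) {j : Fin n} (hj : j ∈ G₁) :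
    x i j = s.alloc i j := by
  by_cases hi : i ∈ A₂
  · rw [hx.matched i hi, if_neg]
    · by_contra h0
      have := (hs.alloc_support i j (Ne.symm h0)).1.1
      simp [hi] at this
    · intro hm
      have := (hM.2 _ hm).2
      simp [hj] at this
  · exact hx.bought i hi j hj

/-- Agents in `A₂` reach utility one, the maximum for bundles of size one. A buyer in `A₁` with best
price `c` reaches `1 / c`, and no affordable bundle exceeds this, because each liked good costs at
least `c`. Goods outside `G₁` are free and do not interest the agents of `A₁`, so filling up changes
neither cost nor utility. -/
theorem IsFilledUp.isEquilibrium (hu : IsUnit01 u) (hc : IsMinVertexCover u G₁ A₂)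
    (hM : IsMaxMatchingIn u A₂ G₁ᶜ M) (hs : s.Sound u A₂ᶜ G₁) (ha : s.active = ∅)
    (hx : IsFilledUp A₂ G₁ M s x) : IsEquilibrium u x s.price := by
  have hcov := hc.covers_agents hM
  have hxa := fun i {j} (hj : j ∈ G₁) => hx.eq_alloc hM.1 hs i hj
  have hrow : ∀ i ∈ A₂, ∃ j₀, j₀ ∉ G₁ ∧ u i j₀ = 1 ∧ ∀ j, x i j = if j = j₀ then 1 else 0 := by
    intro i hi
    obtain ⟨j₀, hj⟩ := hcov i hi
    refine ⟨j₀, by simpa using (hM.1.2 _ hj).2, hM.1.1.1 _ hj, fun j => ?_⟩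
    rw [hx.matched i hi, hM.1.1.indicator_row hj]
  have hx0 : ∀ i j, 0 ≤ x i j := by
    intro i j
    by_cases hi : i ∈ A₂
    · rw [hx.matched i hi]; split_ifs <;> norm_num
    · by_cases hj : j ∈ G₁
      · rw [hxa i hj]; exact hs.alloc_nonneg i j
      · exact hx.fill_nonneg i hi j hj
  have hsize : ∀ i, ∑ j, x i j = 1 := by
    intro i
    by_cases hi : i ∈ A₂
    · obtain ⟨j₀, -, -, h⟩ := hrow i hi
      simp [h]
    · exact hx.fill_size i hi
  have hprice : ∀ j, 0 ≤ s.price j := by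
    intro j
    by_cases hj : j ∈ G₁
    · exact zero_le_one.trans (hs.one_le_price j hj)
    · exact (hs.price_outside j hj).ge
  have hcol_le : ∀ j, ∑ i, x i j ≤ 1 := by
    intro j
    by_cases hj : j ∈ G₁
    · rw [Finset.sum_congr rfl fun i _ => hxa i hj, hs.sold j hj (by simp [ha])]
    · by_cases hm : ∃ k, (k, j) ∈ M
      · obtain ⟨k, hk⟩ := hm
        have : ∀ i, x i j = if i = k then 1 else 0 := by
          intro i
          by_cases hi : i ∈ A₂
          · rw [hx.matched i hi, hM.1.1.indicator_col hk]
          · rw [if_neg (by rintro rfl; exact hi (hM.1.2 _ hk).1)]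
            by_contra h0
            exact hx.fill_unmatched i hi j hj h0 k hk
        simp [this]
      · refine le_trans (le_of_eq ?_) (hx.fill_supply j hj)
        symm
        refine Finset.sum_subset (Finset.subset_univ _) fun i _ hi => ?_
        rw [hx.matched i (by simpa using hi), if_neg fun h => hm ⟨i, h⟩]
  -- Each column sums to at most one, and all entries together sum to `n` because every row sums to
  -- one. So equality holds in each column.
  have hcol : ∀ j, ∑ i, x i j = 1 := by
    have htot : ∑ j, ∑ i, x i j = ∑ _j : Fin n, (1 : ℝ) := by
      rw [Finset.sum_comm]
      exact Finset.sum_congr rfl fun i _ => hsize i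
    intro j
    exact (Finset.sum_eq_sum_iff_of_le fun j _ => hcol_le j).1 htot j (Finset.mem_univ j)
  have hcost : ∀ i, ∑ j, s.price j * x i j = ∑ j, s.price j * s.alloc i j := by
    intro i
    refine Finset.sum_congr rfl fun j _ => ?_
    by_cases hj : j ∈ G₁
    · rw [hxa i hj]
    · rw [hs.price_outside j hj, zero_mul, zero_mul]
  have halloc0 : ∀ i, i ∉ A₂ᶜ ∨ i ∈ s.agents → ∀ j, s.alloc i j = 0 := by
    intro i hi j
    by_contra h0
    have := (hs.alloc_support i j h0).1
    tauto
  have hG : ∀ i ∉ A₂, ∀ j ∉ G₁, u i j = 0 := fun i hi j hj =>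
    (hu i j).resolve_right fun h => (hc.1 i j h).elim hi hj
  refine ⟨hprice, hcol, fun i => ⟨hx0 i, hsize i, ?_⟩, fun i y hy => ?_⟩
  · rw [hcost]
    by_cases hi : i ∈ A₂ᶜ ∧ i ∉ s.agents
    · exact (hs.spent i hi.1 hi.2).le
    · have := halloc0 i (by tauto)
      simp [this]
  · by_cases hi : i ∈ A₂
    · obtain ⟨j₀, -, h1, h⟩ := hrow i hi
      refine (hu.utility_le_one hy i).trans ?_
      simp [h, h1]
    -- An agent of `A₁` who never bought anything has utility zero for all goods, so any bundle is
    -- optimal.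
    · by_cases hia : i ∈ s.agents
      · have : ∀ j, u i j = 0 := fun j => by
          by_cases hj : j ∈ G₁
          · exact (hu i j).resolve_right (hs.indifferent i hia j hj (by simp [ha]))
          · exact hG i hi j hj
        simp [this]
      · obtain ⟨c, hc1, hcle, hceq⟩ := hs.cheapest i (by simpa using hi) hia
        -- Everything bought costs `c` and has utility one, so `c` times the utility is the dollar
        -- spent.
        have h1 : c * ∑ j, u i j * x i j = 1 := by
          rw [← hs.spent i (by simpa using hi) hia, Finset.mul_sum]
          refine Finset.sum_congr rfl fun j _ => ?_
          by_cases hj : j ∈ G₁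
          · rw [hxa i hj]
            by_cases h0 : s.alloc i j = 0
            · simp [h0]
            · rw [(hs.alloc_support i j h0).2.2, hceq j h0, one_mul]
          · rw [hG i hi j hj, hs.price_outside j hj]; ring
        have h2 : c * ∑ j, u i j * y j ≤ 1 := by
          refine le_trans ?_ hy.2.2
          rw [Finset.mul_sum]
          refine Finset.sum_le_sum fun j _ => ?_
          rcases hu i j with h | h
          · rw [h, zero_mul, mul_zero]
            exact mul_nonneg (hprice j) (hy.1 j)
          · rw [h, one_mul]
            refine mul_le_mul_of_nonneg_right (hcle j ?_ h) (hy.1 j)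
            by_contra hj
            rw [hG i hi j hj] at h
            exact zero_ne_one h
        have hcpos : 0 < c := by linarith
        exact le_of_mul_le_mul_left (h2.trans h1.ge) hcpos

/-- The bundles can be filled up uniformly with the goods that are left over. -/
theorem isFilledUp_of_uniform (hp : ¬ ∃ M', IsPerfectMatching u M') (hc : IsMinVertexCover u G₁ A₂)
    (hM : IsMaxMatchingIn u A₂ G₁ᶜ M) (hs : s.Sound u A₂ᶜ G₁) (ha : s.active = ∅)
    (h1 : ∀ i ∈ A₂, ∀ j, x i j = if (i, j) ∈ M then 1 else 0)
    (h2 : ∀ i ∉ A₂, ∀ j ∈ G₁, x i j = s.alloc i j)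
    (h3 : ∀ i ∉ A₂, ∀ j ∉ G₁, x i j = if j ∈ M.image Prod.snd then 0 else
      (1 - ∑ j, s.alloc i j) / ((G₁ᶜ \ M.image Prod.snd).card : ℝ)) : IsFilledUp A₂ G₁ M s x := by
  have hcov := hc.covers_agents hM
  set U := G₁ᶜ \ M.image Prod.snd with hU
  have hMA : M.card = A₂.card := by
    rw [← hM.1.1.card_image_fst]
    congr 1
    ext i
    constructor
    · intro hi
      obtain ⟨e, he, rfl⟩ := Finset.mem_image.1 hi
      exact (hM.1.2 e he).1
    · intro hi
      obtain ⟨j, hj⟩ := hcov i hi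
      exact Finset.mem_image.2 ⟨_, hj, rfl⟩
  -- The matching uses up `A₂.card` goods outside `G₁`; together with `card_lt` this shows that some
  -- goods are left over, so that one can divide by their number.
  have hUcard : U.card + A₂.card + G₁.card = n := by
    have e1 := Finset.card_sdiff_add_card_eq_card (s := M.image Prod.snd) (t := G₁ᶜ) (by
      intro j hj
      obtain ⟨e, he, rfl⟩ := Finset.mem_image.1 hj
      exact (hM.1.2 e he).2)
    rw [hM.1.1.card_image_snd, hMA, ← hU] at e1
    have e2 := Finset.card_add_card_compl G₁
    rw [Fintype.card_fin] at e2
    omega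
  have hlt := hc.card_lt hp
  have hUpos : (0 : ℝ) < U.card := by
    have : 0 < U.card := by omega
    exact_mod_cast this
  have halloc0 : ∀ i j, i ∉ A₂ᶜ ∨ i ∈ s.agents ∨ j ∉ G₁ → s.alloc i j = 0 := by
    intro i j hij
    by_contra h0
    have := hs.alloc_support i j h0
    tauto
  -- Prices in `G₁` are at least one, so a dollar buys at most size one.
  have hdem : ∀ i, ∑ j, s.alloc i j ≤ 1 := by
    intro i
    by_cases hi : i ∈ A₂ᶜ ∧ i ∉ s.agents
    · rw [← hs.spent i hi.1 hi.2]
      refine Finset.sum_le_sum fun j _ => ?_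
      by_cases h0 : s.alloc i j = 0
      · simp [h0]
      · have := hs.one_le_price j (hs.alloc_support i j h0).2.1.1
        nlinarith [hs.alloc_nonneg i j]
    · rw [Finset.sum_eq_zero fun j _ => halloc0 i j (by tauto)]
      exact zero_le_one
  have hmemU : ∀ j, j ∈ U ↔ j ∉ G₁ ∧ j ∉ M.image Prod.snd := fun j => by simp [hU]
  refine ⟨h1, h2, fun i hi j hj => ?_, fun i hi j hj hne k hk => ?_, fun j hj => ?_, fun i hi => ?_⟩
  · rw [h3 i hi j hj]
    split_ifs
    · exact le_rfl
    · exact div_nonneg (sub_nonneg.2 (hdem i)) hUpos.le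
  · rw [h3 i hi j hj, if_pos (Finset.mem_image.2 ⟨_, hk, rfl⟩)] at hne
    exact hne rfl
  · by_cases hjm : j ∈ M.image Prod.snd
    · rw [Finset.sum_eq_zero fun i hi => by rw [h3 i (by simpa using hi) j hj, if_pos hjm]]
      exact zero_le_one
    · rw [Finset.sum_congr rfl fun i hi => by rw [h3 i (by simpa using hi) j hj, if_neg hjm],
        ← Finset.sum_div, div_le_one hUpos, Finset.sum_sub_distrib]
      -- The agents outside `A₂` together buy all of `G₁`. Hence the sizes missing add up to `|A₂ᶜ|
      -- - |G₁|`, which is the number of goods left over, and an equal split respects the supply.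
      have e1 : ∑ i ∈ A₂ᶜ, ∑ j, s.alloc i j = G₁.card := by
        rw [Finset.sum_subset (Finset.subset_univ A₂ᶜ) fun i _ hi =>
          Finset.sum_eq_zero fun j _ => halloc0 i j (Or.inl hi), Finset.sum_comm,
          ← Finset.sum_subset (Finset.subset_univ G₁) fun j _ hj =>
          Finset.sum_eq_zero fun i _ => halloc0 i j (Or.inr (Or.inr hj)),
          Finset.sum_congr rfl fun j hj => hs.sold j hj (by simp [ha])]
        simp
      have e2 := Finset.card_add_card_compl A₂
      rw [Fintype.card_fin] at e2
      have e3 : ((A₂ᶜ).card : ℝ) = U.card + G₁.card := by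
        have : (A₂ᶜ).card = U.card + G₁.card := by omega
        exact_mod_cast this
      rw [e1]
      simp only [Finset.sum_const, nsmul_eq_mul, mul_one]
      linarith
  · have e1 : ∀ j, x i j = s.alloc i j +
        if j ∈ U then (1 - ∑ j, s.alloc i j) / (U.card : ℝ) else 0 := by
      intro j
      by_cases hj : j ∈ G₁
      · rw [h2 i hi j hj, if_neg (by simp [hmemU, hj]), add_zero]
      · rw [h3 i hi j hj, halloc0 i j (Or.inr (Or.inr hj)), zero_add]
        by_cases hjm : j ∈ M.image Prod.snd
        · rw [if_pos hjm, if_neg fun h => ((hmemU j).1 h).2 hjm]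
        · rw [if_neg hjm, if_pos ((hmemU j).2 ⟨hj, hjm⟩)]
    rw [Finset.sum_congr rfl fun j _ => e1 j, Finset.sum_add_distrib, Finset.sum_ite_mem]
    simp only [Finset.univ_inter, Finset.sum_const, nsmul_eq_mul]
    rw [mul_div_cancel₀ _ hUpos.ne']
    ring

theorem algorithm1NeverStuck (u : Fin n → Fin n → ℝ) : Algorithm1NeverStuck u := by
  intro hp
  refine ⟨exists_isMinVertexCover u, fun G₁ A₂ hc => ⟨exists_isMaxMatchingIn u _ _, fun M hM =>
    ⟨hc.covers_agents hM, fun s hs => ?_⟩⟩⟩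
  have hsound := hs.sound fun T hT => hc.card_le_nbrIn hT
  refine ⟨hsound.exists_goesTight, fun δ S => hsound.exists_clears, fun ha => ?_⟩
  refine ⟨fun i j => if i ∈ A₂ then (if (i, j) ∈ M then 1 else 0) else if j ∈ G₁ then s.alloc i j
    else if j ∈ M.image Prod.snd then 0 else
      (1 - ∑ j, s.alloc i j) / ((G₁ᶜ \ M.image Prod.snd).card : ℝ),
    isFilledUp_of_uniform hp hc hM hsound ha (fun i hi j => ?_) (fun i hi j hj => ?_)
      fun i hi j hj => ?_⟩
  · rw [if_pos hi]
  · rw [if_neg hi, if_pos hj]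
  · rw [if_neg hi, if_neg hj]

theorem Algorithm1.isEquilibrium (hu : IsUnit01 u) {p : Fin n → ℝ} (h : Algorithm1 u x p) :
    IsEquilibrium u x p ∧ MinPriceZero p := by
  cases h with
  | perfect M hM =>
    exact ⟨hM.isEquilibrium hu, fun _ => le_rfl, fun hn => ⟨⟨0, hn⟩, rfl⟩⟩
  | imperfect G₁ A₂ M s x hp hc hM hs ha hx =>
    have hsound := hs.sound fun T hT => hc.card_le_nbrIn hT
    have he := hx.isEquilibrium hu hc hM hsound ha
    refine ⟨he, he.price_nonneg, fun _ => ?_⟩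
    have hlt := hc.card_lt hp
    obtain ⟨j, hj⟩ : ∃ j, j ∉ G₁ := by
      by_contra! h
      have := Finset.card_le_card (fun j _ => h j : Finset.univ ⊆ G₁)
      rw [Finset.card_univ, Fintype.card_fin] at this
      omega
    exact ⟨j, hsound.price_outside j hj⟩

end Correctness

/-! ## Bipartite matching by an auction

Units `d < D` bid for slots `q < Q`. A free unit takes the slot of least level among its neighbours,
if this level is below `L`, and raises the level by one. -/

section Auction

variable {D Q L : ℕ} {adj : ℕ → ℕ → Prop} {hold lev : ℕ → ℕ}

/-- The invariants of the auction; `hold q ≥ D` means that the slot `q` is empty. -/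
structure AuctionInv (D Q L : ℕ) (adj : ℕ → ℕ → Prop) (hold lev : ℕ → ℕ) : Prop where
  adj_hold : ∀ q < Q, hold q < D → adj (hold q) q
  inj : ∀ q < Q, ∀ q' < Q, hold q < D → hold q = hold q' → q = q'
  -- Complementary slackness up to one: the slot was of least level among the neighbours when it was
  -- taken and then rose by one, and levels never fall.
  lev_le : ∀ q < Q, hold q < D → ∀ q' < Q, adj (hold q) q' → lev q ≤ lev q' + 1
  -- A slot once taken is never vacated: later bids only replace the unit in it.
  lev_pos : ∀ q < Q, 0 < lev q ↔ hold q < D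
  lev_max : ∀ q < Q, lev q ≤ L

/-- The unit `d` occupies no slot. -/
def IsFree (Q : ℕ) (hold : ℕ → ℕ) (d : ℕ) : Prop := ∀ q < Q, hold q ≠ d

/-- Overwriting `hold b` evicts the former unit, which thereby becomes free. Minimality of `lev b`
gives slackness for the new unit; for the other units it survives because levels only rise. -/
theorem AuctionInv.assign (h : AuctionInv D Q L adj hold lev) {d b : ℕ} (hd : d < D)
    (hfree : IsFree Q hold d) (hadj : adj d b) (hL : lev b < L)
    (hmin : ∀ q < Q, adj d q → lev b ≤ lev q) :
    AuctionInv D Q L adj (Function.update hold b d) (Function.update lev b (lev b + 1)) := by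
  have mono : ∀ q, lev q ≤ Function.update lev b (lev b + 1) q := fun q => by
    rw [Function.update_apply]; split_ifs with hq
    · subst hq; omega
    · exact le_rfl
  refine ⟨fun q hq hD => ?_, fun q hq q' hq' hD he => ?_, fun q hq hD q' hq' ha => ?_,
    fun q hq => ?_, fun q hq => ?_⟩
  · by_cases hqb : q = b
    · subst hqb; simpa using hadj
    · rw [Function.update_of_ne hqb] at hD ⊢
      exact h.adj_hold q hq hD
  · by_cases hqb : q = b <;> by_cases hqb' : q' = b
    · rw [hqb, hqb']
    · subst hqb
      rw [Function.update_self, Function.update_of_ne hqb'] at he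
      exact absurd he.symm (hfree q' hq')
    · subst hqb'
      rw [Function.update_self, Function.update_of_ne hqb] at he
      exact absurd he (hfree q hq)
    · rw [Function.update_of_ne hqb] at hD he
      rw [Function.update_of_ne hqb'] at he
      exact h.inj q hq q' hq' hD he
  · refine le_trans ?_ (Nat.add_le_add_right (mono q') 1)
    by_cases hqb : q = b
    · subst hqb
      rw [Function.update_self] at ha ⊢
      have := hmin q' hq' ha
      omega
    · rw [Function.update_of_ne hqb] at hD ha ⊢
      exact h.lev_le q hq hD q' hq' ha
  · by_cases hqb : q = b
    · subst hqb; simp [hd]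
    · rw [Function.update_of_ne hqb, Function.update_of_ne hqb]; exact h.lev_pos q hq
  · by_cases hqb : q = b
    · subst hqb; rw [Function.update_self]; omega
    · rw [Function.update_of_ne hqb]; exact h.lev_max q hq

/-- A matching of units and slots with a cut, formed by the slots of level greater than `g`, which
shows that it is maximum. -/
structure MatchingCut (D Q : ℕ) (adj : ℕ → ℕ → Prop) (hold lev : ℕ → ℕ) (g : ℕ) : Prop where
  adj_hold : ∀ q < Q, hold q < D → adj (hold q) q
  inj : ∀ q < Q, ∀ q' < Q, hold q < D → hold q = hold q' → q = q'
  high_of_free : ∀ d < D, IsFree Q hold d → ∀ q < Q, adj d q → g < lev q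
  held_of_high : ∀ q < Q, g < lev q → hold q < D ∧ ∀ q' < Q, adj (hold q) q' → g < lev q'
  all_high : (∀ q < Q, hold q < D) → ∀ q < Q, g < lev q

/-- A unit in a slot of level above `g` sees only levels at least `g`, by slackness up to one, and
none equal to `g`, hence only levels above `g`. Free units see only levels at least `L > g`. If all
slots are occupied, then no level is zero, and since all values below `g` occur, `g = 0`. -/
theorem AuctionInv.matchingCut (h : AuctionInv D Q L adj hold lev)
    (hterm : ∀ d < D, IsFree Q hold d → ∀ q < Q, adj d q → L ≤ lev q) {g : ℕ} (hgL : g < L)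
    (hgap : ∀ q < Q, lev q ≠ g) (hocc : ∀ v < g, ∃ q < Q, lev q = v) :
    MatchingCut D Q adj hold lev g := by
  refine ⟨h.adj_hold, h.inj, fun d hd hf q hq ha => hgL.trans_le (hterm d hd hf q hq ha),
    fun q hq hg => ?_, fun hall q hq => ?_⟩
  · have hD := (h.lev_pos q hq).1 (by omega)
    refine ⟨hD, fun q' hq' ha => ?_⟩
    have := h.lev_le q hq hD q' hq' ha
    have := hgap q' hq'
    omega
  · have h0 : g = 0 := by
      by_contra hg
      obtain ⟨q', hq', h'⟩ := hocc 0 (by omega)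
      have := (h.lev_pos q' hq').2 (hall q' hq')
      omega
    rw [h0]
    exact (h.lev_pos q hq).2 (hall q hq)

/-- Pigeonhole: distinct levels need distinct slots. So the search for a gap ends at a value at most
`Q`. -/
theorem le_of_occupied {g : ℕ} (h : ∀ v < g, ∃ q < Q, lev q = v) : g ≤ Q := by
  choose! f hf hf' using h
  have := Finset.card_le_card_of_injOn (s := Finset.range g) (t := Finset.range Q) f
    (fun v hv => by simpa using hf v (by simpa using hv))
    (fun v hv w hw e => by
      rw [← hf' v (by simpa using hv), ← hf' w (by simpa using hw), e])
  simpa using this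

end Auction

/-! ## Copies -/

/-- The entries `f 0, …, f (c - 1)` contain every `j < n` with `src j > 0` exactly `k` times, and
no other numbers. -/
def IsCopies (n k : ℕ) (src : ℕ → ℕ) (c : ℕ) (f : ℕ → ℕ) : Prop :=
  ∀ j, ((Finset.range c).filter fun d => f d = j).card = if j < n ∧ 0 < src j then k else 0

section Copies

variable {n k c : ℕ} {src f : ℕ → ℕ}

theorem IsCopies.mem (h : IsCopies n k src c f) {d : ℕ} (hd : d < c) :
    f d < n ∧ 0 < src (f d) := by
  by_contra hn
  have := h (f d)
  rw [if_neg hn, Finset.card_eq_zero] at this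
  have hm : d ∈ (Finset.range c).filter fun e => f e = f d := by simp [hd]
  rw [this] at hm
  simp at hm

theorem IsCopies.card_filter (h : IsCopies n k src c f) (X : Finset ℕ)
    (hX : ∀ j ∈ X, j < n ∧ 0 < src j) :
    ((Finset.range c).filter fun d => f d ∈ X).card = X.card * k := by
  rw [Finset.card_eq_sum_card_fiberwise (f := f) (t := X) (fun d hd => by
    simpa using (Finset.mem_filter.1 hd).2)]
  rw [Finset.sum_congr rfl fun j hj => ?_, Finset.sum_const, smul_eq_mul]
  rw [Finset.filter_filter, ← (h j).trans (if_pos (hX j hj))]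
  congr 1
  ext d
  simp only [Finset.mem_filter]
  constructor
  · rintro ⟨h1, h2, h3⟩; exact ⟨h1, h3⟩
  · rintro ⟨h1, h3⟩; exact ⟨h1, h3 ▸ hj, h3⟩

theorem IsCopies.card_eq (h : IsCopies n k src c f) :
    c = ((Finset.range n).filter fun j => 0 < src j).card * k := by
  rw [← h.card_filter _ fun j hj => by simpa using hj]
  rw [Finset.filter_true_of_mem fun d hd => by simpa using h.mem (by simpa using hd),
    Finset.card_range]

theorem IsCopies.le (h : IsCopies n k src c f) (hk : k ≤ n) : c ≤ n * n := by
  rw [h.card_eq]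
  exact Nat.mul_le_mul ((Finset.card_filter_le _ _).trans (by simp)) hk

end Copies

/-! ## The program

Index registers. `rN`, `rSq` and `rBig` hold `n`, `n²` and `n²(n² + 1)`, and `rZ` holds zero. -/

notation "rN" => 0
notation "rSq" => 1
notation "rBig" => 2
notation "rZ" => 3
notation "rI" => 4
notation "rJ" => 5
notation "rC" => 6
notation "rUnit" => 7
notation "rSlot" => 8
notation "rRound" => 9
notation "rNewton" => 10
notation "rOuter" => 11
notation "rK" => 12
notation "rM" => 13
notation "rD" => 14
notation "rQ" => 15
notation "rL" => 16
notation "rGap" => 17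
notation "rCount" => 18
notation "rX" => 19
notation "rY" => 20
notation "rBest" => 21
notation "rBid" => 22
notation "rFlag" => 23

/-! Index arrays: the active goods, the present agents, the candidate for a tight set, the good of
each unit, the agent of each slot, the unit in each slot, the level of each slot, and the goods that
are left over. -/

notation "aAct" => 0
notation "aPres" => 1
notation "aTight" => 2
notation "aGood" => 3
notation "aAgent" => 4
notation "aHold" => 5
notation "aLev" => 6
notation "aLeft" => 7

/-! Number cells: one, zero, the real numbers `K`, `M` and `K - M`, a counter, and the number of
goods that are left over. Column zero of number array 8 holds the sizes of the missing parts of the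
bundles. -/

notation "cOne" => Ref.mk 5 3 3
notation "cZero" => Ref.mk 12 3 3
notation "cK" => Ref.mk 6 3 3
notation "cM" => Ref.mk 7 3 3
notation "cDiff" => Ref.mk 11 3 3
notation "cCount" => Ref.mk 9 3 3
notation "cLeft" => Ref.mk 10 3 3

namespace Program

/-- Agent `reg ri` has high utility for good `reg rj`. -/
abbrev edge (ri rj : ℕ) : Test := .numEq ⟨0, ri, rj⟩ ⟨2, ri, rZ⟩

/-- Run `P` for all slots. -/
abbrev forSlots (P : Program) : Program := .for rSlot rSq (.when (.regLt rSlot rQ) P)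

/-- List `reg mult` copies of every index with a positive entry in `src`. -/
def copies (src dst mult cnt : ℕ) : Program :=
  .block [.setReg cnt 0,
    .for rJ rN (.block [.loadIdx rX src rJ, .when (.regLt rZ rX)
      (.for rC rN (.when (.regLt rC mult) (.block [.storeIdx dst cnt rJ, .incReg cnt])))])]

/-- Examine one slot as a candidate for the unit `rUnit` of the good `rY`. -/
def examineSlot : Program :=
  .block [.loadIdx rX aHold rSlot, .when (.regEq rX rUnit) (.setReg rFlag 1),
    .loadIdx rX aAgent rSlot, .when (edge rX rY)
      (.block [.loadIdx rX aLev rSlot,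
        .when (.regLt rX rBest) (.block [.copyReg rBest rX, .copyReg rBid rSlot])])]

/-- Find out whether a unit is free, and the neighbour of least level. -/
def findSlot : Program :=
  .block [.loadIdx rY aGood rUnit, .copyReg rBest rL, .setReg rFlag 0, forSlots examineSlot]

/-- Put the unit into the slot found. -/
def takeSlot : Program :=
  .when (.regEq rFlag rZ) (.when (.regLt rBest rL)
    (.block [.storeIdx aHold rBid rUnit, .incReg rBest, .storeIdx aLev rBid rBest]))

def bid : Program := .block [findSlot, takeSlot]

/-- The content `reg rD` marks an empty slot, as the units are numbered below it. -/
def clearSlots : Program :=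
  .for rSlot rSq (.block [.storeIdx aHold rSlot rD, .storeIdx aLev rSlot rZ])

def round : Program := .for rUnit rSq (.when (.regLt rUnit rD) bid)

/-- The gap may rise several times during one pass, and a slot inspected before the gap rose to its
level is then missed; hence the repetition in `findGap`. -/
def gapPass : Program :=
  forSlots (.block [.loadIdx rX aLev rSlot, .when (.regEq rX rGap) (.incReg rGap)])

def findGap : Program := .block [.setReg rGap 0, .for rUnit rBig gapPass]

/-- Match `reg rK` units of every active good with `reg rM` slots of every present agent. -/
def matching : Program :=
  .block [copies aAct aGood rK rD, copies aPres aAgent rM rQ, clearSlots, .for rRound rBig round,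
    findGap]

def countHeld : Program :=
  .block [.setReg rCount 0, forSlots (.block [.loadIdx rX aHold rSlot,
    .when (.regLt rX rD) (.incReg rCount)])]

/-- The active goods all of whose neighbouring slots lie above the gap. -/
def cut : Program :=
  .for rJ rN (.block [.loadIdx rX aAct rJ, .storeIdx aTight rJ rX,
    forSlots (.block [.loadIdx rX aAgent rSlot, .when (edge rX rJ)
      (.block [.loadIdx rX aLev rSlot, .ite (.regLt rGap rX) .skip (.storeIdx aTight rJ rZ)])])])

/-- Set the flag if agent `reg rI` is present and interested in a good of the tight set. -/
def testNbr : Program :=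
  .block [.setReg rFlag 0, .loadIdx rX aPres rI, .when (.regLt rZ rX)
    (.for rJ rN (.block [.loadIdx rX aTight rJ, .when (.regLt rZ rX)
      (.when (edge rI rJ) (.setReg rFlag 1))]))]

/-- The number of goods becomes the number `M` of slots per agent, and in `countAgents` the number
of agents becomes the number `K` of units per good. Each count is kept twice, as an index for making
copies and as a real number for divisions. -/
def countGoods : Program :=
  .block [.setReg rM 0, .setNum cM 0, .for rJ rN (.block [.loadIdx rX aTight rJ,
    .when (.regLt rZ rX) (.block [.incReg rM, .arith .add cM cM cOne])])]

def countAgents : Program :=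
  .block [.setReg rK 0, .setNum cK 0, .for rI rN (.block [testNbr,
    .when (.regLt rZ rFlag) (.block [.incReg rK, .arith .add cK cK cOne])])]

/-- A neighbour of the tight set gets `M` units of size `1 / K`, so the size `(K - M) / K` of its
bundle is missing. -/
def removeAgents : Program :=
  .block [.arith .sub cDiff cK cM, .for rI rN (.block [testNbr, .when (.regLt rZ rFlag)
    (.block [.storeIdx aPres rI rZ, .arith .div ⟨8, rI, rZ⟩ cDiff cK])])]

/-- Count the slots of agent `reg rI` that are occupied by units of good `reg rJ`. -/
def countShare : Program :=
  .block [.setNum cCount 0, forSlots (.block [.loadIdx rX aAgent rSlot, .when (.regEq rX rI)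
    (.block [.loadIdx rX aHold rSlot, .when (.regLt rX rD)
      (.block [.loadIdx rX aGood rX, .when (.regEq rX rJ) (.arith .add cCount cCount cOne)])])])]

def sellGoods : Program :=
  .for rJ rN (.block [.loadIdx rX aTight rJ, .when (.regLt rZ rX)
    (.block [.storeIdx aAct rJ rZ,
      .for rI rN (.block [countShare, .arith .div ⟨3, rI, rJ⟩ cCount cK])])])

def setPrices : Program :=
  .for rJ rN (.block [.loadIdx rX aTight rJ, .when (.regLt rZ rX) (.arith .div ⟨4, rJ, rZ⟩ cK cM)])

/-- The search for a tight set starts from the set of all active goods. -/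
def copyActive : Program :=
  .for rJ rN (.block [.loadIdx rX aAct rJ, .storeIdx aTight rJ rX])

def testLeft : Program :=
  .block [.setReg rFlag 1, .for rI rN (.ite (.numEq ⟨3, rI, rJ⟩ cZero) .skip (.setReg rFlag 0))]

def countLeft : Program :=
  .block [.setNum cLeft 0, .for rJ rN (.block [testLeft, .storeIdx aLeft rJ rFlag,
    .when (.regLt rZ rFlag) (.arith .add cLeft cLeft cOne)])]

def shareLeft : Program :=
  .for rJ rN (.block [.loadIdx rX aLeft rJ, .when (.regLt rZ rX)
    (.for rI rN (.arith .div ⟨3, rI, rJ⟩ ⟨8, rI, rZ⟩ cLeft))])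

/-- Indices can only be incremented, so products are computed by counting. -/
def squares : Program := .for rI rN (.for rJ rN (.incReg rSq))

def bounds : Program := .for rI rSq (.block [.for rJ rSq (.incReg rBig), .incReg rBig])

/-- With `K = M = 1` the first matching has one unit per good and one slot per agent. The missing
size of every bundle starts at one. -/
def setup : Program :=
  .block [.setNum cOne 1, .setReg rX 1, .for rI rN (.block [.storeIdx aAct rI rX,
    .storeIdx aPres rI rX, .setNum ⟨8, rI, rZ⟩ 1]), .copyReg rL rSq, .incReg rL,
    .setReg rK 1, .setReg rM 1, .setNum cK 1, .setNum cM 1]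

/-- Replace the candidate by a set of smaller ratio, if there is one. -/
def improve : Program :=
  .block [countGoods, countAgents, matching, countHeld, .when (.regLt rCount rD) cut]

/-- Find a tight set and freeze it. -/
def freezeTight : Program :=
  .block [copyActive, .for rNewton rBig improve, countGoods, countAgents, matching, removeAgents,
    sellGoods, setPrices]

/-- The first cut serves as `G₂`. Selling it like a tight set gives the agents of `A₂` their matched
goods and leaves `G₁` active and `A₁` present. No prices are set at that point, so those of `G₂`
remain zero. If the matching is perfect, no good stays active. -/
def body : Program :=
  .block [setup, matching, cut, removeAgents, sellGoods, .for rOuter rN freezeTight,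
    countLeft, shareLeft]

/-- The program that solves bivalued instances. -/
def solve : Program := .block [squares, bounds, body]

/-- The levels of the number arrays of the program. -/
def levels (m : ℕ) : ℕ :=
  -- Prices and missing sizes are quotients of counts or differences of counts. The allocation is
  -- one level higher because filling up divides a missing size by a count.
  if m < 3 then 0 else if m = 3 then 3 else if m = 4 ∨ m = 8 then 2 else 1

theorem solve_respects : solve.respects levels = true := by decide +kernel

/-- A register can limit loops only where it is not written. So `n²` is computed with limit `n`,
then `n² (n² + 1)` with limits up to `n²`, and only the main part uses all three registers. -/
theorem squares_loopsBounded : squares.loopsBounded 1 = true := by decide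
theorem bounds_loopsBounded : bounds.loopsBounded 2 = true := by decide
theorem body_loopsBounded : body.loopsBounded 3 = true := by decide +kernel

end Program

/-! ## Verification of the subroutines -/

/-- The registers and cells that are constant during the main part of the program, for the graph
`E` of agents and goods. -/
structure Base (n : ℕ) (E : ℕ → ℕ → Prop) (s : Store) : Prop where
  dim : s.reg rN = n
  sq : s.reg rSq = n * n
  big : s.reg rBig = n * n * (n * n + 1)
  zero : s.reg rZ = 0
  top : s.reg rL = n * n + 1
  one : s.num 5 0 0 = 1
  edge : ∀ i j, s.num 0 i j = s.num 2 i 0 ↔ E i j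

/-- The program does not write to the constant registers and cells. -/
def Program.keepsBase (P : Program) : Bool :=
  !(P.writesReg rN || P.writesReg rSq || P.writesReg rBig || P.writesReg rZ || P.writesReg rL ||
    P.writesNum 5 || P.writesNum 0 || P.writesNum 2)

variable {n : ℕ} {E : ℕ → ℕ → Prop} {s s' : Store}

theorem Base.putReg (h : Base n E s) {r : ℕ} (hr : 4 ≤ r ∧ r ≠ rL) (v : ℕ) :
    Base n E (s.putReg r v) := by
  refine ⟨?_, ?_, ?_, ?_, ?_, h.one, h.edge⟩ <;> rw [Store.reg_putReg, if_neg (by omega)]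
  exacts [h.dim, h.sq, h.big, h.zero, h.top]

theorem Base.den (h : Base n E s) {P : Program} (hP : P.keepsBase = true) : Base n E (P.den s) := by
  simp only [Program.keepsBase, Bool.not_eq_true', Bool.or_eq_false_iff] at hP
  obtain ⟨⟨⟨⟨⟨⟨⟨h0, h1⟩, h2⟩, h3⟩, h4⟩, h5⟩, h6⟩, h7⟩ := hP
  refine ⟨?_, ?_, ?_, ?_, ?_, ?_, fun i j => ?_⟩
  · rw [P.den_reg h0, h.dim]
  · rw [P.den_reg h1, h.sq]
  · rw [P.den_reg h2, h.big]
  · rw [P.den_reg h3, h.zero]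
  · rw [P.den_reg h4, h.top]
  · rw [P.den_num h5, h.one]
  · rw [P.den_num h6, P.den_num h7, h.edge]

theorem Base.frame (h : Base n E s) {P : Program} {r : ℕ} (hr : 4 ≤ r ∧ r ≠ rL)
    (hP : P.keepsBase = true) (hf : P.Frame r s s') : Base n E s' := by
  simp only [Program.keepsBase, Bool.not_eq_true', Bool.or_eq_false_iff] at hP
  obtain ⟨⟨⟨⟨⟨⟨⟨h0, h1⟩, h2⟩, h3⟩, h4⟩, h5⟩, h6⟩, h7⟩ := hP
  refine ⟨?_, ?_, ?_, ?_, ?_, ?_, fun i j => ?_⟩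
  · rw [hf.reg (by omega) h0, h.dim]
  · rw [hf.reg (by omega) h1, h.sq]
  · rw [hf.reg (by omega) h2, h.big]
  · rw [hf.reg (by omega) h3, h.zero]
  · rw [hf.reg (by omega) h4, h.top]
  · rw [hf.num h5, h.one]
  · rw [hf.num h6, hf.num h7, h.edge]

open Classical in
theorem Program.den_when (b : Test) (P : Program) (s : Store) :
    (Program.when b P).den s = if b.Holds s then P.den s else s := rfl

theorem Program.den_block_cons (P Q : Program) (l : List Program) (s : Store) :
    (Program.block (P :: Q :: l)).den s = (Program.block (Q :: l)).den (P.den s) := rfl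

theorem Program.den_block_single (P : Program) (s : Store) :
    (Program.block [P]).den s = P.den s := rfl

theorem IsCopies.skip {i k c : ℕ} {src f : ℕ → ℕ} (h : IsCopies i k src c f) (hi : ¬ 0 < src i) :
    IsCopies (i + 1) k src c f := by
  intro j
  rw [h j]
  by_cases hj : j = i
  · subst hj; simp [hi]
  · have : j < i + 1 ↔ j < i := by omega
    simp [this]

theorem IsCopies.extend {i k c : ℕ} {src f f' : ℕ → ℕ} (h : IsCopies i k src c f) (hi : 0 < src i)
    (hf : ∀ d, f' d = if c ≤ d ∧ d < c + k then i else f d) :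
    IsCopies (i + 1) k src (c + k) f' := by
  have hlow : ∀ d < c, f' d = f d := fun d hd => by rw [hf, if_neg (by omega)]
  intro j
  by_cases hj : j = i
  · subst hj
    rw [if_pos ⟨by omega, hi⟩]
    have : (Finset.range (c + k)).filter (fun d => f' d = j) = Finset.Ico c (c + k) := by
      ext d
      simp only [Finset.mem_filter, Finset.mem_range, Finset.mem_Ico]
      constructor
      · rintro ⟨h1, h2⟩
        refine ⟨?_, h1⟩
        by_contra hd
        rw [hlow d (by omega)] at h2
        have := (h.mem (d := d) (by omega)).1
        omega
      · rintro ⟨h1, h2⟩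
        exact ⟨h2, by rw [hf, if_pos ⟨h1, h2⟩]⟩
    rw [this]
    simp
  · have e : (j < i + 1 ∧ 0 < src j) ↔ (j < i ∧ 0 < src j) := by
      constructor <;> rintro ⟨h1, h2⟩ <;> exact ⟨by omega, h2⟩
    simp only [e]
    rw [← h j]
    congr 1
    ext d
    simp only [Finset.mem_filter, Finset.mem_range]
    constructor
    · rintro ⟨h1, h2⟩
      by_cases hd : d < c
      · exact ⟨hd, by rw [← hlow d hd, h2]⟩
      · rw [hf, if_pos (by omega)] at h2
        omega
    · rintro ⟨h1, h2⟩
      exact ⟨by omega, by rw [hlow d h1, h2]⟩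

/-! ### The lists of copies -/

namespace Program

theorem copies_inner {dst mult cnt : ℕ} (hb : Base n E s) (hk : s.reg mult ≤ n)
    (hm : 11 < mult) (hc : 11 < cnt) (hmc : mult ≠ cnt) :
    let t := (Program.for rC rN (.when (.regLt rC mult)
      (.block [.storeIdx dst cnt rJ, .incReg cnt]))).den s
    t.reg cnt = s.reg cnt + s.reg mult ∧ ∀ d, t.idx dst d =
      if s.reg cnt ≤ d ∧ d < s.reg cnt + s.reg mult then s.reg rJ else s.idx dst d := by
  intro t
  refine for_when_induction (fun i s' => s'.reg cnt = s.reg cnt + i ∧ ∀ d, s'.idx dst d =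
      if s.reg cnt ≤ d ∧ d < s.reg cnt + i then s.reg rJ else s.idx dst d) s ?_ (by decide) ?_
      (by omega) (by rw [hb.dim]; exact hk) ?_ ?_ ?_
  · simp [block, writesReg]; omega
  · simp [block, writesReg]; omega
  · refine ⟨by simp; omega, fun d => ?_⟩
    rw [if_neg (by omega)]; rfl
  · rintro i s' v ⟨h1, h2⟩
    refine ⟨?_, h2⟩
    rw [Store.reg_putReg, if_neg (by omega), h1]
  · rintro i hi s' hr hf ⟨h1, h2⟩
    have hJ : s'.reg rJ = s.reg rJ := hf.reg (by decide) (by simp [block, writesReg]; omega)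
    have hc6 : cnt ≠ 6 := by omega
    simp only [den_block_cons, den_block_single, den, Store.reg_putReg, hc6, if_false, if_true,
      Store.idx_putReg,
      Store.idx_putIdx_self, Store.reg_putIdx, hJ, h1]
    refine ⟨by omega, fun d => ?_⟩
    rw [Function.update_apply, h2 d]
    split_ifs <;> first | rfl | omega

theorem copies_spec {src dst mult cnt : ℕ} (hb : Base n E s) (hk : s.reg mult ≤ n)
    (hm : 11 < mult ∧ mult < rL) (hc : 11 < cnt ∧ cnt < rL) (hmc : mult ≠ cnt) (hsd : src ≠ dst) :
    IsCopies n (s.reg mult) (s.idx src) (((copies src dst mult cnt).den s).reg cnt)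
      (((copies src dst mult cnt).den s).idx dst) := by
  have h := for_induction (r := rJ) (e := rN) (P := .block [.loadIdx rX src rJ, .when (.regLt rZ rX)
      (.for rC rN (.when (.regLt rC mult) (.block [.storeIdx dst cnt rJ, .incReg cnt])))])
    (fun i s' => IsCopies i (s.reg mult) (s.idx src) (s'.reg cnt) (s'.idx dst))
    (s.putReg cnt 0) (by simp [block, writesReg, when, Program.for]; omega) (by decide) (by
      intro j
      simp) (by
    intro i hi s' hr hf hI
    have hb' : Base n E s' := (hb.putReg (r := cnt) (by omega) 0).frame (by decide) (by
      simp [keepsBase, block, writesReg, writesNum, when, Program.for]; omega) hf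
    have hmult : s'.reg mult = s.reg mult := by
      rw [hf.reg (by omega) (by simp [block, writesReg, when, Program.for]; omega), Store.reg_putReg,
        if_neg hmc]
    have hsrc : s'.idx src = s.idx src := by
      rw [hf.idx (by simp [block, writesIdx, when, Program.for]; omega), Store.idx_putReg]
    have hc5 : cnt ≠ 5 := by omega
    have hc19 : cnt ≠ 19 := by omega
    have hm19 : mult ≠ 19 := by omega
    simp only [den_block_cons, den_block_single, den, den_when, Test.Holds, Store.reg_putReg, hc5,
      if_false, Store.idx_putReg,
      if_true, Nat.reduceEqDiff, hb'.zero, hr]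
    by_cases h0 : 0 < s'.idx src i
    · have hin := copies_inner (dst := dst) (hb'.putReg (r := rX) (by decide) (s'.idx src i))
        (mult := mult) (cnt := cnt) (by simp [hm19, hmult, hk]) hm.1 hc.1 hmc
      simp only [Store.reg_putReg, hm19, hc19, if_false, Store.idx_putReg, hmult, Nat.reduceEqDiff,
        hr] at hin
      rw [if_pos h0, hin.1]
      exact hI.extend (by rwa [← hsrc]) hin.2
    · rw [if_neg h0]
      simp only [Store.reg_putReg, hc19, if_false, Store.idx_putReg]
      exact hI.skip (by rwa [← hsrc]))
  have e0 : (0 : ℕ) ≠ cnt := by omega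
  simp only [Store.reg_putReg, e0, if_false, hb.dim] at h
  exact h

end Program

/-! ### The auction and the gap between its levels -/

namespace Program

open Classical in
theorem examineSlot_spec (hb : Base n E s) :
    (examineSlot.den s).reg rFlag =
        (if s.idx aHold (s.reg rSlot) = s.reg rUnit then 1 else s.reg rFlag) ∧
      ((examineSlot.den s).reg rBest, (examineSlot.den s).reg rBid) =
        if E (s.idx aAgent (s.reg rSlot)) (s.reg rY) ∧ s.idx aLev (s.reg rSlot) < s.reg rBest then
          (s.idx aLev (s.reg rSlot), s.reg rSlot) else (s.reg rBest, s.reg rBid) := by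
  have he := hb.edge (s.idx aAgent (s.reg rSlot)) (s.reg rY)
  simp only [examineSlot, den_block_cons, den_block_single, den, den_when, Test.Holds, edge,
    Store.get]
  by_cases h1 : s.idx aHold (s.reg rSlot) = s.reg rUnit <;>
  by_cases h2 : E (s.idx aAgent (s.reg rSlot)) (s.reg rY) <;>
  by_cases h3 : s.idx aLev (s.reg rSlot) < s.reg rBest <;>
  simp [h1, h2, h3, he, hb.zero]

/-- The register `rBest` starts at the top level `n² + 1`, so a smaller value means that a slot has
been found, and slots at the top level are never offered. -/
theorem findSlot_spec (hb : Base n E s) (hQ : s.reg rQ ≤ n * n) :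
    ((findSlot.den s).reg rFlag = 0 ↔ IsFree (s.reg rQ) (s.idx aHold) (s.reg rUnit)) ∧
    ((findSlot.den s).reg rBest < n * n + 1 →
      (findSlot.den s).reg rBid < s.reg rQ ∧
      E (s.idx aAgent ((findSlot.den s).reg rBid)) (s.idx aGood (s.reg rUnit)) ∧
      s.idx aLev ((findSlot.den s).reg rBid) = (findSlot.den s).reg rBest) ∧
    ∀ q < s.reg rQ, E (s.idx aAgent q) (s.idx aGood (s.reg rUnit)) →
      (findSlot.den s).reg rBest ≤ s.idx aLev q ∨ n * n + 1 ≤ s.idx aLev q := by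
  set s₁ := ((s.putReg rY (s.idx aGood (s.reg rUnit))).putReg rBest (s.reg rL)).putReg rFlag 0 with hs₁
  have hb₁ : Base n E s₁ := ((hb.putReg (by decide) _).putReg (by decide) _).putReg (by decide) _
  have hden : findSlot.den s = (forSlots examineSlot).den s₁ := by
    simp [findSlot, den_block_cons, den_block_single, den, hs₁]
  have key := for_when_induction (r := rSlot) (e := rSq) (m := rQ) (P := examineSlot)
    (fun i t => (t.reg rFlag = 0 ↔ IsFree i (s.idx aHold) (s.reg rUnit)) ∧
      (t.reg rBest < n * n + 1 → t.reg rBid < i ∧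
        E (s.idx aAgent (t.reg rBid)) (s.idx aGood (s.reg rUnit)) ∧
        s.idx aLev (t.reg rBid) = t.reg rBest) ∧
      t.reg rBest ≤ n * n + 1 ∧
      ∀ q < i, E (s.idx aAgent q) (s.idx aGood (s.reg rUnit)) →
        t.reg rBest ≤ s.idx aLev q ∨ n * n + 1 ≤ s.idx aLev q) s₁
    (by decide) (by decide) (by decide) (by decide) (by rw [hb₁.sq]; simpa [hs₁] using hQ)
    ⟨by simp [hs₁, IsFree], by simp [hs₁, hb.top], by simp [hs₁, hb.top], by simp⟩
    (fun i t v h => h)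
    (by
      rintro i hi t hr hf ⟨h1, h2, h3, h4⟩
      have hbt : Base n E t := hb₁.frame (by decide) (by decide) hf
      have hspec := examineSlot_spec hbt
      have f1 : t.reg rUnit = s.reg rUnit := (hf.reg (by decide) (by decide)).trans (by simp [hs₁])
      have f2 : t.reg rY = s.idx aGood (s.reg rUnit) :=
        (hf.reg (by decide) (by decide)).trans (by simp [hs₁])
      have f3 : t.idx = s.idx := by
        funext a
        rw [hf.idx (by simp [examineSlot, block, writesIdx, Program.when])]
        simp [hs₁]
      rw [hr, f1, f2, f3] at hspec
      obtain ⟨e1, e2⟩ := hspec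
      refine ⟨?_, ?_⟩
      · rw [Store.reg_putReg, if_neg (by decide), e1]
        by_cases hh : s.idx aHold i = s.reg rUnit
        · simp only [hh, if_true, one_ne_zero, false_iff]
          exact fun h => h i (by omega) hh
        · rw [if_neg hh, h1]
          constructor
          · intro h q hq
            rcases Nat.lt_succ_iff_lt_or_eq.1 hq with h' | rfl
            · exact h q h'
            · exact hh
          · exact fun h q hq => h q (by omega)
      · simp only [Store.reg_putReg, Nat.reduceEqDiff, if_false]
        by_cases hh : E (s.idx aAgent i) (s.idx aGood (s.reg rUnit)) ∧ s.idx aLev i < t.reg rBest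
        · rw [if_pos hh, Prod.mk.injEq] at e2
          rw [e2.1, e2.2]
          refine ⟨fun _ => ⟨by omega, hh.1, rfl⟩, by omega, fun q hq hE => ?_⟩
          rcases Nat.lt_succ_iff_lt_or_eq.1 hq with h' | rfl
          · have := h4 q h' hE
            omega
          · exact Or.inl le_rfl
        · rw [if_neg hh, Prod.mk.injEq] at e2
          rw [e2.1, e2.2]
          refine ⟨fun h => ⟨(h2 h).1.trans (by omega), (h2 h).2⟩, h3, fun q hq hE => ?_⟩
          rcases Nat.lt_succ_iff_lt_or_eq.1 hq with h' | rfl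
          · exact h4 q h' hE
          · have : ¬ s.idx aLev q < t.reg rBest := fun h => hh ⟨hE, h⟩
            omega)
  have hQ₁ : s₁.reg rQ = s.reg rQ := by simp [hs₁]
  rw [hQ₁] at key
  rw [hden]
  exact ⟨key.1, key.2.1, key.2.2.2⟩

/-- The adjacency of units and slots. -/
abbrev unitAdj (E : ℕ → ℕ → Prop) (s : Store) (d q : ℕ) : Prop :=
  E (s.idx aAgent q) (s.idx aGood d)

/-- No free unit can bid. -/
def AuctionOver (n : ℕ) (E : ℕ → ℕ → Prop) (s : Store) : Prop :=
  ∀ d < s.reg rD, IsFree (s.reg rQ) (s.idx aHold) d → ∀ q < s.reg rQ, unitAdj E s d q →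
    n * n + 1 ≤ s.idx aLev q

/-- The effect of one bid. -/
theorem bid_spec (hb : Base n E s) (hQ : s.reg rQ ≤ n * n) (hd : s.reg rUnit < s.reg rD)
    (hinv : AuctionInv (s.reg rD) (s.reg rQ) (n * n + 1) (unitAdj E s) (s.idx aHold) (s.idx aLev)) :
    AuctionInv (s.reg rD) (s.reg rQ) (n * n + 1) (unitAdj E s) ((bid.den s).idx aHold)
        ((bid.den s).idx aLev) ∧
      ((∑ q ∈ Finset.range (s.reg rQ), s.idx aLev q <
          ∑ q ∈ Finset.range (s.reg rQ), (bid.den s).idx aLev q ∧ ¬ AuctionOver n E s) ∨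
        (bid.den s).idx aHold = s.idx aHold ∧ (bid.den s).idx aLev = s.idx aLev ∧
        (IsFree (s.reg rQ) (s.idx aHold) (s.reg rUnit) → ∀ q < s.reg rQ,
          unitAdj E s (s.reg rUnit) q → n * n + 1 ≤ s.idx aLev q)) := by
  obtain ⟨h1, h2, h3⟩ := findSlot_spec hb hQ
  have hbt : Base n E (findSlot.den s) := hb.den (by decide)
  have e5 : (findSlot.den s).idx aHold = s.idx aHold := findSlot.den_idx (by decide) s
  have e6 : (findSlot.den s).idx aLev = s.idx aLev := findSlot.den_idx (by decide) s
  have eu : (findSlot.den s).reg rUnit = s.reg rUnit := findSlot.den_reg (by decide) s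
  have hden : bid.den s = takeSlot.den (findSlot.den s) := rfl
  rw [hden]
  generalize findSlot.den s = t at *
  simp only [takeSlot, den_block_cons, den_block_single, den, den_when, Test.Holds, hbt.zero,
    hbt.top]
  by_cases hf : t.reg rFlag = 0
  · rw [if_pos hf]
    have hfree := h1.1 hf
    by_cases hbest : t.reg rBest < n * n + 1
    · rw [if_pos hbest]
      obtain ⟨hbid, hadj, hlev⟩ := h2 hbest
      simp only [Store.reg_putReg, Store.reg_putIdx, Store.idx_putReg, Nat.reduceEqDiff, if_true,
        if_false, Store.idx_putIdx_self, Store.idx_putIdx_ne, ne_eq, not_false_iff, e5, e6, eu]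
      rw [← hlev]
      refine ⟨hinv.assign hd hfree hadj (by omega) fun q hq ha => ?_, Or.inl ⟨?_, fun hover => ?_⟩⟩
      · have := h3 q hq ha
        omega
      · refine Finset.sum_lt_sum (fun q _ => ?_) ⟨t.reg rBid, by simpa using hbid, by simp⟩
        rw [Function.update_apply]
        split_ifs with hq
        · rw [hq]; omega
        · exact le_rfl
      · have := hover _ hd hfree _ hbid hadj
        omega
    · rw [if_neg hbest, e5, e6]
      refine ⟨hinv, Or.inr ⟨rfl, rfl, fun _ q hq ha => ?_⟩⟩
      have := h3 q hq ha
      omega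
  · rw [if_neg hf, e5, e6]
    exact ⟨hinv, Or.inr ⟨rfl, rfl, fun h => absurd (h1.2 h) hf⟩⟩

/-- The sum of the levels is a potential. Either some bid in the round raises it, or all units have
been tried on unchanged slots without success, and then the auction is over. -/
theorem round_spec (hb : Base n E s) (hQ : s.reg rQ ≤ n * n) (hD : s.reg rD ≤ n * n)
    (hinv : AuctionInv (s.reg rD) (s.reg rQ) (n * n + 1) (unitAdj E s) (s.idx aHold) (s.idx aLev)) :
    AuctionInv (s.reg rD) (s.reg rQ) (n * n + 1) (unitAdj E s) ((round.den s).idx aHold)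
        ((round.den s).idx aLev) ∧
      ((∑ q ∈ Finset.range (s.reg rQ), s.idx aLev q <
          ∑ q ∈ Finset.range (s.reg rQ), (round.den s).idx aLev q ∧ ¬ AuctionOver n E s) ∨
        (round.den s).idx aHold = s.idx aHold ∧ (round.den s).idx aLev = s.idx aLev ∧
        AuctionOver n E s) := by
  have key := for_when_induction (r := rUnit) (e := rSq) (m := rD) (P := bid)
    (fun i t => AuctionInv (s.reg rD) (s.reg rQ) (n * n + 1) (unitAdj E s) (t.idx aHold)
        (t.idx aLev) ∧ ((∑ q ∈ Finset.range (s.reg rQ), s.idx aLev q <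
          ∑ q ∈ Finset.range (s.reg rQ), t.idx aLev q ∧ ¬ AuctionOver n E s) ∨
        t.idx aHold = s.idx aHold ∧ t.idx aLev = s.idx aLev ∧
        ∀ d < i, IsFree (s.reg rQ) (s.idx aHold) d → ∀ q < s.reg rQ, unitAdj E s d q →
          n * n + 1 ≤ s.idx aLev q)) s
    (by decide) (by decide) (by decide) (by decide) (by rw [hb.sq]; exact hD)
    ⟨hinv, Or.inr ⟨rfl, rfl, by simp⟩⟩ (fun i t v h => h)
    (by
      rintro i hi t hr hf ⟨h1, h2⟩
      have hbt : Base n E t := hb.frame (by decide) (by decide) hf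
      have f1 : t.reg rD = s.reg rD := hf.reg (by decide) (by decide)
      have f2 : t.reg rQ = s.reg rQ := hf.reg (by decide) (by decide)
      have f3 : t.idx aGood = s.idx aGood := hf.idx (by decide)
      have f4 : t.idx aAgent = s.idx aAgent := hf.idx (by decide)
      have hadj : unitAdj E t = unitAdj E s := by
        funext d q; simp only [unitAdj, f3, f4]
      have hspec := bid_spec hbt (by rwa [f2]) (by rw [f1, hr]; exact hi)
        (by rw [f1, f2, hadj]; exact h1)
      rw [f1, f2, hadj, hr] at hspec
      simp only [Store.idx_putReg]
      refine ⟨hspec.1, ?_⟩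
      have hmono : ∑ q ∈ Finset.range (s.reg rQ), t.idx aLev q ≤
          ∑ q ∈ Finset.range (s.reg rQ), (bid.den t).idx aLev q := by
        rcases hspec.2 with ⟨h, -⟩ | ⟨-, h, -⟩
        · exact h.le
        · rw [h]
      rcases h2 with h2 | ⟨h2, h3, h4⟩
      · exact Or.inl ⟨h2.1.trans_le hmono, h2.2⟩
      · rcases hspec.2 with h | ⟨h5, h6, h7⟩
        · rw [AuctionOver, f1, f2, hadj, h2, h3] at h; exact Or.inl h
        · refine Or.inr ⟨by rw [h5, h2], by rw [h6, h3], fun d hd => ?_⟩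
          rcases Nat.lt_succ_iff_lt_or_eq.1 hd with h' | rfl
          · exact h4 d h'
          · rw [h2, h3] at h7; exact h7)
  exact key

theorem clearSlots_spec (hb : Base n E s) :
    (∀ q < n * n, (clearSlots.den s).idx aHold q = s.reg rD) ∧
      ∀ q < n * n, (clearSlots.den s).idx aLev q = 0 := by
  have key := for_induction (r := rSlot) (e := rSq)
    (P := .block [.storeIdx aHold rSlot rD, .storeIdx aLev rSlot rZ])
    (fun i t => (∀ q < i, t.idx aHold q = s.reg rD) ∧ ∀ q < i, t.idx aLev q = 0) s
    (by decide) (by decide) (by simp) (by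
      rintro i hi t hr hf ⟨h1, h2⟩
      have hbt : Base n E t := hb.frame (by decide) (by decide) hf
      have f1 : t.reg rD = s.reg rD := hf.reg (by decide) (by decide)
      simp only [den_block_cons, den_block_single, den, Store.idx_putReg, Store.reg_putIdx, hr, f1,
        hbt.zero, Store.idx_putIdx_self, Store.idx_putIdx_ne, ne_eq, Nat.reduceEqDiff,
        not_false_iff]
      constructor <;> intro q hq <;> rw [Function.update_apply] <;> split_ifs with h
      · rfl
      · exact h1 q (by omega)
      · rfl
      · exact h2 q (by omega))
  rw [hb.sq] at key
  exact key

/-- The levels sum to at most `n² (n² + 1)`, the number of rounds, and each round before the end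
raises the sum by at least one. If the sum reaches this bound, then all slots are at the top level,
and the auction is over in this case too. -/
theorem rounds_spec (hb : Base n E s) (hQ : s.reg rQ ≤ n * n) (hD : s.reg rD ≤ n * n)
    (hinv : AuctionInv (s.reg rD) (s.reg rQ) (n * n + 1) (unitAdj E s) (s.idx aHold) (s.idx aLev)) :
    AuctionInv (s.reg rD) (s.reg rQ) (n * n + 1) (unitAdj E s)
        (((Program.for rRound rBig round).den s).idx aHold)
        (((Program.for rRound rBig round).den s).idx aLev) ∧
      AuctionOver n E ((Program.for rRound rBig round).den s) := by
  have key := for_induction (r := rRound) (e := rBig) (P := round)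
    (fun i t => AuctionInv (s.reg rD) (s.reg rQ) (n * n + 1) (unitAdj E s) (t.idx aHold)
        (t.idx aLev) ∧ (AuctionOver n E t ∨ i ≤ ∑ q ∈ Finset.range (s.reg rQ), t.idx aLev q)) s
    (by decide) (by decide) ⟨hinv, Or.inr (by simp)⟩ (by
      rintro i hi t hr hf ⟨h1, h2⟩
      have hbt : Base n E t := hb.frame (by decide) (by decide) hf
      have f1 : t.reg rD = s.reg rD := hf.reg (by decide) (by decide)
      have f2 : t.reg rQ = s.reg rQ := hf.reg (by decide) (by decide)
      have f3 : t.idx aGood = s.idx aGood := hf.idx (by decide)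
      have f4 : t.idx aAgent = s.idx aAgent := hf.idx (by decide)
      have g1 : (round.den t).reg rD = t.reg rD := round.den_reg (by decide) t
      have g2 : (round.den t).reg rQ = t.reg rQ := round.den_reg (by decide) t
      have g3 : (round.den t).idx aGood = t.idx aGood := round.den_idx (by decide) t
      have g4 : (round.den t).idx aAgent = t.idx aAgent := round.den_idx (by decide) t
      have hadj : unitAdj E t = unitAdj E s := by
        funext d q; simp only [unitAdj, f3, f4]
      have hspec := round_spec hbt (by rwa [f2]) (by rwa [f1]) (by rw [f1, f2, hadj]; exact h1)
      rw [f1, f2, hadj] at hspec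
      refine ⟨hspec.1, ?_⟩
      rcases hspec.2 with ⟨h3, h4⟩ | ⟨h3, h4, h5⟩
      · right
        have := h2.resolve_left h4
        simp only [Store.idx_putReg]
        omega
      · left
        simpa only [AuctionOver, Store.reg_putReg, Nat.reduceEqDiff, if_false, Store.idx_putReg,
          unitAdj, g1, g2, g3, g4, h3, h4] using h5)
  refine ⟨key.1, ?_⟩
  rcases key.2 with h | hle
  · exact h
  rw [hb.big] at hle
  set t := (Program.for rRound rBig round).den s
  have f2 : t.reg rQ = s.reg rQ := den_reg _ (by decide) s
  have hmax := fun q (hq : q ∈ Finset.range (s.reg rQ)) => key.1.lev_max q (Finset.mem_range.1 hq)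
  have hsum : ∑ q ∈ Finset.range (s.reg rQ), t.idx aLev q =
      ∑ q ∈ Finset.range (s.reg rQ), (n * n + 1) := by
    refine le_antisymm (Finset.sum_le_sum hmax) (le_trans ?_ hle)
    simp only [Finset.sum_const, Finset.card_range, smul_eq_mul]
    exact Nat.mul_le_mul_right _ hQ
  intro d _ _ q hq _
  rw [f2] at hq
  exact ((Finset.sum_eq_sum_iff_of_le hmax).1 hsum q (Finset.mem_range.2 hq)).ge

/-- All values below `g` are levels of slots. -/
def LevelsBelow (Q : ℕ) (lev : ℕ → ℕ) (g : ℕ) : Prop := ∀ v < g, ∃ q < Q, lev q = v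

theorem gapPass_spec (hb : Base n E s) (hQ : s.reg rQ ≤ n * n)
    (hg : LevelsBelow (s.reg rQ) (s.idx aLev) (s.reg rGap)) :
    LevelsBelow (s.reg rQ) (s.idx aLev) ((gapPass.den s).reg rGap) ∧
      ((gapPass.den s).reg rGap = s.reg rGap ∧ (∀ q < s.reg rQ, s.idx aLev q ≠ s.reg rGap) ∨
        s.reg rGap < (gapPass.den s).reg rGap ∧ ∃ q < s.reg rQ, s.idx aLev q = s.reg rGap) := by
  refine for_when_induction (r := rSlot) (e := rSq) (m := rQ)
    (P := .block [.loadIdx rX aLev rSlot, .when (.regEq rX rGap) (.incReg rGap)])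
    (fun i t => LevelsBelow (s.reg rQ) (s.idx aLev) (t.reg rGap) ∧
      (t.reg rGap = s.reg rGap ∧ (∀ q < i, s.idx aLev q ≠ s.reg rGap) ∨
        s.reg rGap < t.reg rGap ∧ ∃ q < s.reg rQ, s.idx aLev q = s.reg rGap)) s
    (by decide) (by decide) (by decide) (by decide) (by rw [hb.sq]; exact hQ)
    ⟨hg, Or.inl ⟨rfl, by simp⟩⟩ (fun i t v h => h) ?_
  rintro i hi t hr hf ⟨h1, h2⟩
  have f1 : t.idx aLev = s.idx aLev := hf.idx (by decide)
  simp only [den_block_cons, den_block_single, den, den_when, Test.Holds, Store.reg_putReg,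
    Nat.reduceEqDiff, if_true, if_false, hr, f1]
  by_cases h : s.idx aLev i = t.reg rGap
  · simp only [h, if_true, Store.reg_putReg, Nat.reduceEqDiff, if_false]
    refine ⟨fun v hv => ?_, Or.inr ?_⟩
    · rcases Nat.lt_succ_iff_lt_or_eq.1 hv with h' | rfl
      · exact h1 v h'
      · exact ⟨i, hi, h⟩
    · rcases h2 with ⟨h3, -⟩ | ⟨h3, h4⟩
      · exact ⟨by omega, i, hi, by omega⟩
      · exact ⟨by omega, h4⟩
  · simp only [h, Store.reg_putReg, Nat.reduceEqDiff, if_false]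
    refine ⟨h1, h2.imp_left fun ⟨h3, h4⟩ => ⟨h3, fun q hq => ?_⟩⟩
    rcases Nat.lt_succ_iff_lt_or_eq.1 hq with h' | rfl
    · exact h4 q h'
    · rwa [← h3]

/-- A pass that does not confirm the gap raises it. The gap is at most the number of slots by
`le_of_occupied`, so if there are slots, then the gap is confirmed before `n² (n² + 1)` passes have
gone by. -/
theorem findGap_spec (hb : Base n E s) (hQ : s.reg rQ ≤ n * n) :
    LevelsBelow (s.reg rQ) (s.idx aLev) ((findGap.den s).reg rGap) ∧
      ∀ q < s.reg rQ, s.idx aLev q ≠ (findGap.den s).reg rGap := by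
  have key := for_induction (r := rUnit) (e := rBig) (P := gapPass)
    (fun i t => LevelsBelow (s.reg rQ) (s.idx aLev) (t.reg rGap) ∧
      ((∀ q < s.reg rQ, s.idx aLev q ≠ t.reg rGap) ∨ i ≤ t.reg rGap)) (s.putReg rGap 0)
    (by decide) (by decide) ⟨fun v hv => by simp at hv, Or.inr (by simp)⟩ (by
      rintro i hi t hr hf ⟨h1, h2⟩
      have hbt : Base n E t := (hb.putReg (by decide) 0).frame (by decide) (by decide) hf
      have f1 : t.idx aLev = s.idx aLev := hf.idx (by decide)
      have f2 : t.reg rQ = s.reg rQ := (hf.reg (by decide) (by decide)).trans (by simp)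
      have hspec := gapPass_spec hbt (by rwa [f2]) (by rwa [f1, f2])
      rw [f1, f2] at hspec
      simp only [Store.reg_putReg, Nat.reduceEqDiff, if_false]
      refine ⟨hspec.1, ?_⟩
      rcases hspec.2 with ⟨h3, h4⟩ | ⟨h3, q, hq, h4⟩
      · left; rwa [h3]
      · right
        have := h2.resolve_left fun h => h q hq h4
        omega)
  have hbig : (s.putReg rGap 0).reg rBig = n * n * (n * n + 1) := by simpa using hb.big
  rw [hbig] at key
  refine ⟨key.1, ?_⟩
  rcases key.2 with h | h
  · exact h
  · intro q hq
    have h1 := le_of_occupied key.1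
    have : n * n * 1 < n * n * (n * n + 1) := Nat.mul_lt_mul_of_pos_left (by omega) (by omega)
    have h2 : n * n * (n * n + 1) ≤ s.reg rQ := h.trans h1
    omega

/-- The result of the matching routine. -/
structure Matched (n : ℕ) (E : ℕ → ℕ → Prop) (K M : ℕ) (act pres : ℕ → ℕ) (t : Store) : Prop where
  units : IsCopies n K act (t.reg rD) (t.idx aGood)
  slots : IsCopies n M pres (t.reg rQ) (t.idx aAgent)
  cut : MatchingCut (t.reg rD) (t.reg rQ) (unitAdj E t) (t.idx aHold) (t.idx aLev) (t.reg rGap)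

theorem matching_spec (hb : Base n E s) (hK : s.reg rK ≤ n) (hM : s.reg rM ≤ n) :
    Matched n E (s.reg rK) (s.reg rM) (s.idx aAct) (s.idx aPres) (matching.den s) := by
  have hden : matching.den s = findGap.den ((Program.for rRound rBig round).den (clearSlots.den
    ((copies aPres aAgent rM rQ).den ((copies aAct aGood rK rD).den s)))) := rfl
  have c1 := copies_spec (src := aAct) (dst := aGood) hb hK (by decide) (by decide)
    (by decide : rK ≠ rD) (by decide)
  have hb1 : Base n E ((copies aAct aGood rK rD).den s) := hb.den (by decide)
  have m1 : ((copies aAct aGood rK rD).den s).reg rM = s.reg rM := den_reg _ (by decide) s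
  have p1 : ((copies aAct aGood rK rD).den s).idx aPres = s.idx aPres := den_idx _ (by decide) s
  rw [hden]
  generalize (copies aAct aGood rK rD).den s = s1 at *
  have c2 := copies_spec (src := aPres) (dst := aAgent) hb1 (by rwa [m1]) (by decide) (by decide)
    (by decide : rM ≠ rQ) (by decide)
  rw [m1, p1] at c2
  have hb2 : Base n E ((copies aPres aAgent rM rQ).den s1) := hb1.den (by decide)
  have d2 : ((copies aPres aAgent rM rQ).den s1).reg rD = s1.reg rD := den_reg _ (by decide) s1
  have g2 : ((copies aPres aAgent rM rQ).den s1).idx aGood = s1.idx aGood := den_idx _ (by decide) s1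
  rw [← d2, ← g2] at c1
  clear d2 g2
  generalize (copies aPres aAgent rM rQ).den s1 = s2 at *
  have hD := c1.le hK
  have hQ := c2.le hM
  obtain ⟨k1, k2⟩ := clearSlots_spec hb2
  have hb3 : Base n E (clearSlots.den s2) := hb2.den (by decide)
  have d3 : (clearSlots.den s2).reg rD = s2.reg rD := den_reg _ (by decide) _
  have q3 : (clearSlots.den s2).reg rQ = s2.reg rQ := den_reg _ (by decide) _
  have g3 : (clearSlots.den s2).idx aGood = s2.idx aGood := den_idx _ (by decide) _
  have a3 : (clearSlots.den s2).idx aAgent = s2.idx aAgent := den_idx _ (by decide) _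
  rw [← d3, ← g3] at c1
  rw [← q3, ← a3] at c2
  rw [← d3] at hD k1
  rw [← q3] at hQ
  clear d3 q3 g3 a3
  generalize clearSlots.den s2 = s3 at *
  have hinv : AuctionInv (s3.reg rD) (s3.reg rQ) (n * n + 1) (unitAdj E s3) (s3.idx aHold)
      (s3.idx aLev) := by
    have e1 : ∀ q < s3.reg rQ, ¬ s3.idx aHold q < s3.reg rD := fun q hq => by
      rw [k1 q (by omega)]; exact lt_irrefl _
    have e2 : ∀ q < s3.reg rQ, s3.idx aLev q = 0 := fun q hq => k2 q (by omega)
    exact ⟨fun q hq h => absurd h (e1 q hq), fun q hq _ _ h => absurd h (e1 q hq),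
      fun q hq h => absurd h (e1 q hq), fun q hq => by simp [e2 q hq, e1 q hq],
      fun q hq => by simp [e2 q hq]⟩
  obtain ⟨r1, r2⟩ := rounds_spec hb3 hQ hD hinv
  have hb4 : Base n E ((Program.for rRound rBig round).den s3) := hb3.den (by decide)
  have d4 : ((Program.for rRound rBig round).den s3).reg rD = s3.reg rD := den_reg _ (by decide) _
  have q4 : ((Program.for rRound rBig round).den s3).reg rQ = s3.reg rQ := den_reg _ (by decide) _
  have g4 : ((Program.for rRound rBig round).den s3).idx aGood = s3.idx aGood :=
    den_idx _ (by decide) _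
  have a4 : ((Program.for rRound rBig round).den s3).idx aAgent = s3.idx aAgent :=
    den_idx _ (by decide) _
  have hadj : unitAdj E s3 = unitAdj E ((Program.for rRound rBig round).den s3) := by
    funext d q; simp only [unitAdj, g4, a4]
  rw [← d4, ← q4, hadj] at r1
  rw [← d4, ← g4] at c1
  rw [← q4, ← a4] at c2
  rw [← q4] at hQ
  clear d4 q4 g4 a4 hadj
  generalize (Program.for rRound rBig round).den s3 = s4 at *
  obtain ⟨v1, v2⟩ := findGap_spec hb4 hQ
  have d5 : (findGap.den s4).reg rD = s4.reg rD := den_reg _ (by decide) _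
  have q5 : (findGap.den s4).reg rQ = s4.reg rQ := den_reg _ (by decide) _
  have i5 : (findGap.den s4).idx = s4.idx := by
    funext a
    exact den_idx _ (by simp [findGap, gapPass, block, writesIdx, Program.for, Program.when]) _
  refine ⟨by rwa [d5, i5], by rwa [q5, i5], ?_⟩
  have hadj : unitAdj E (findGap.den s4) = unitAdj E s4 := by
    funext d q; simp only [unitAdj, i5]
  rw [d5, q5, hadj, i5]
  -- There are at most `n²` slots and the top level is `n² + 1`, so the gap lies below the top
  -- level.
  refine r1.matchingCut r2 ?_ v2 v1
  have := le_of_occupied v1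
  omega

end Program

/-! ### Counting, the cut, and the neighbours of a candidate -/

namespace Program
open Classical

theorem countHeld_spec (hb : Base n E s) (hQ : s.reg rQ ≤ n * n) :
    (countHeld.den s).reg rCount =
      ((Finset.range (s.reg rQ)).filter fun q => s.idx aHold q < s.reg rD).card := by
  have key := for_when_induction (r := rSlot) (e := rSq) (m := rQ)
    (P := .block [.loadIdx rX aHold rSlot, .when (.regLt rX rD) (.incReg rCount)])
    (fun i t => t.reg rCount =
      ((Finset.range i).filter fun q => s.idx aHold q < s.reg rD).card) (s.putReg rCount 0)
    (by decide) (by decide) (by decide) (by decide) (by simpa [hb.sq] using hQ) (by simp)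
    (fun i t v h => h) (by
      intro i hi t hr hf h
      have f1 : t.idx aHold = s.idx aHold := hf.idx (by decide)
      have f2 : t.reg rD = s.reg rD := (hf.reg (by decide) (by decide)).trans (by simp)
      simp only [den_block_cons, den_block_single, den, den_when, Test.Holds, Store.reg_putReg,
        Nat.reduceEqDiff, if_true, if_false, hr, f1, f2]
      rw [Finset.range_add_one, Finset.filter_insert]
      by_cases h0 : s.idx aHold i < s.reg rD
      · simp [h0, h]
      · simp [h0, h])
  have e : (s.putReg rCount 0).reg rQ = s.reg rQ := by simp
  rw [e] at key
  exact key

theorem cut_spec (hb : Base n E s) (hQ : s.reg rQ ≤ n * n) : ∀ j < n,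
    (0 < (cut.den s).idx aTight j ↔ 0 < s.idx aAct j ∧
      ∀ q < s.reg rQ, E (s.idx aAgent q) j → s.reg rGap < s.idx aLev q) := by
  set inner : Program := .block [.loadIdx rX aAgent rSlot, .when (edge rX rJ)
      (.block [.loadIdx rX aLev rSlot, .ite (.regLt rGap rX) .skip (.storeIdx aTight rJ rZ)])]
    with hinner
  have hin : ∀ t : Store, Base n E t → t.reg rQ ≤ n * n → ∀ j,
      ((forSlots inner).den t).idx aTight j = if j = t.reg rJ ∧
        ∃ q < t.reg rQ, E (t.idx aAgent q) (t.reg rJ) ∧ ¬ t.reg rGap < t.idx aLev q then 0 else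
          t.idx aTight j := by
    intro t hbt hQt
    refine for_when_induction (r := rSlot) (e := rSq) (m := rQ) (P := inner)
      (fun i t' => ∀ j, t'.idx aTight j = if j = t.reg rJ ∧
        ∃ q < i, E (t.idx aAgent q) (t.reg rJ) ∧ ¬ t.reg rGap < t.idx aLev q then 0 else
          t.idx aTight j) t (by rw [hinner]; decide) (by decide) (by rw [hinner]; decide)
      (by decide) (by simpa [hbt.sq] using hQt) (by simp) (fun i t v h => h) ?_
    intro i hi t' hr hf h
    have hb' : Base n E t' := hbt.frame (by decide) (by rw [hinner]; decide) hf
    have f1 : t'.idx aAgent = t.idx aAgent := hf.idx (by rw [hinner]; decide)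
    have f2 : t'.idx aLev = t.idx aLev := hf.idx (by rw [hinner]; decide)
    have f3 : t'.reg rJ = t.reg rJ := hf.reg (by decide) (by rw [hinner]; decide)
    have f4 : t'.reg rGap = t.reg rGap := hf.reg (by decide) (by rw [hinner]; decide)
    have he := hb'.edge (t.idx aAgent i) (t.reg rJ)
    intro j
    have hex : (∃ q < i + 1, E (t.idx aAgent q) (t.reg rJ) ∧ ¬ t.reg rGap < t.idx aLev q) ↔
        (∃ q < i, E (t.idx aAgent q) (t.reg rJ) ∧ ¬ t.reg rGap < t.idx aLev q) ∨
        E (t.idx aAgent i) (t.reg rJ) ∧ ¬ t.reg rGap < t.idx aLev i := by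
      simp only [Nat.lt_succ_iff_lt_or_eq, or_and_right, exists_or, exists_eq_left]
    simp only [hex, hinner, den_block_cons, den_block_single, den, den_when, Test.Holds, edge, Store.get,
      Store.reg_putReg, Nat.reduceEqDiff, if_true, if_false, hr, f1, f2, f3, f4, hb'.zero,
      Store.num_putReg, Store.idx_putReg, he]
    by_cases h1 : E (t.idx aAgent i) (t.reg rJ)
    · by_cases h2 : t.reg rGap < t.idx aLev i
      · simp [h1, h2, h j]
      · by_cases hj : j = t.reg rJ
        · simp [h1, h2, hj]
        · simp [h1, h2, hj, h j]
    · simp [h1, h j]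
  have key := for_induction (r := rJ) (e := rN) (P := .block [.loadIdx rX aAct rJ,
      .storeIdx aTight rJ rX, forSlots inner])
    (fun i t => ∀ j < i, (0 < t.idx aTight j ↔ 0 < s.idx aAct j ∧
      ∀ q < s.reg rQ, E (s.idx aAgent q) j → s.reg rGap < s.idx aLev q)) s
    (by rw [hinner]; decide) (by decide) (by simp) (by
      intro i hi t hr hf h j hj
      have hbt : Base n E t := hb.frame (by decide) (by rw [hinner]; decide) hf
      have f1 : t.idx aAgent = s.idx aAgent := hf.idx (by rw [hinner]; decide)
      have f2 : t.idx aLev = s.idx aLev := hf.idx (by rw [hinner]; decide)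
      have f3 : t.reg rQ = s.reg rQ := hf.reg (by decide) (by rw [hinner]; decide)
      have f4 : t.reg rGap = s.reg rGap := hf.reg (by decide) (by rw [hinner]; decide)
      have f5 : t.idx aAct = s.idx aAct := hf.idx (by rw [hinner]; decide)
      simp only [den_block_cons, den_block_single, den, Store.idx_putReg, Store.reg_putReg,
        Nat.reduceEqDiff, if_true, if_false, hr, f5]
      have hs := hin ((t.putReg rX (s.idx aAct i)).putIdx aTight i (s.idx aAct i))
        (by
          have := hbt.putReg (r := rX) (by decide) (s.idx aAct i)
          exact ⟨this.dim, this.sq, this.big, this.zero, this.top, this.one, this.edge⟩)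
        (by simpa [f3] using hQ) j
      simp only [Store.idx_putReg, Store.reg_putReg, Store.reg_putIdx,
        Nat.reduceEqDiff, if_false, hr, Store.idx_putIdx_self, f1, f2, f3, f4,
        Store.idx_putIdx_ne, ne_eq, not_false_iff] at hs
      rw [hs]
      by_cases hji : j = i
      · subst hji
        rw [Function.update_self]
        split_ifs with hc
        · obtain ⟨-, q, hq, h1, h2⟩ := hc
          simp only [lt_irrefl, false_iff]
          exact fun h' => h2 (h'.2 q hq h1)
        · push Not at hc
          exact ⟨fun h0 => ⟨h0, fun q hq h1 => hc rfl q hq h1⟩, fun h0 => h0.1⟩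
      · rw [if_neg fun h' => hji h'.1, Function.update_of_ne hji]
        exact h j (by omega))
  rw [hb.dim] at key
  exact key

/-- Agent `i` is present and interested in a good of the tight set. -/
def IsNbr (n : ℕ) (E : ℕ → ℕ → Prop) (pres tight : ℕ → ℕ) (i : ℕ) : Prop :=
  0 < pres i ∧ ∃ j < n, 0 < tight j ∧ E i j

theorem testNbr_spec (hb : Base n E s) :
    0 < (testNbr.den s).reg rFlag ↔ IsNbr n E (s.idx aPres) (s.idx aTight) (s.reg rI) := by
  set inner : Program := .block [.loadIdx rX aTight rJ, .when (.regLt rZ rX)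
      (.when (edge rI rJ) (.setReg rFlag 1))] with hinner
  have hin : ∀ t : Store, Base n E t → t.reg rFlag = 0 →
      (0 < ((Program.for rJ rN inner).den t).reg rFlag ↔
        ∃ j < n, 0 < t.idx aTight j ∧ E (t.reg rI) j) := by
    intro t hbt h0
    have := for_induction (r := rJ) (e := rN) (P := inner)
      (fun i t' => 0 < t'.reg rFlag ↔ ∃ j < i, 0 < t.idx aTight j ∧ E (t.reg rI) j) t
      (by rw [hinner]; decide) (by decide) (by simp [h0]) (by
        intro i hi t' hr hf h
        have hb' : Base n E t' := hbt.frame (by decide) (by rw [hinner]; decide) hf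
        have f1 : t'.idx aTight = t.idx aTight := hf.idx (by rw [hinner]; decide)
        have f2 : t'.reg rI = t.reg rI := hf.reg (by decide) (by rw [hinner]; decide)
        have he := hb'.edge (t.reg rI) i
        have hex : (∃ j < i + 1, 0 < t.idx aTight j ∧ E (t.reg rI) j) ↔
            (∃ j < i, 0 < t.idx aTight j ∧ E (t.reg rI) j) ∨
              0 < t.idx aTight i ∧ E (t.reg rI) i := by
          simp only [Nat.lt_succ_iff_lt_or_eq, or_and_right, exists_or, exists_eq_left]
        rw [hex]
        simp only [hinner, den_block_cons, den_block_single, den, den_when, Test.Holds, edge,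
          Store.get, Store.reg_putReg, Nat.reduceEqDiff, if_true, if_false, hr, f1, f2, hb'.zero,
          Store.num_putReg, he]
        by_cases h1 : 0 < t.idx aTight i <;> by_cases h2 : E (t.reg rI) i <;> simp [h1, h2, h])
    rwa [hbt.dim] at this
  simp only [testNbr, den_block_cons, den_block_single, den, den_when, Test.Holds, Store.reg_putReg,
    Nat.reduceEqDiff, if_true, if_false, hb.zero, Store.idx_putReg]
  by_cases h1 : 0 < s.idx aPres (s.reg rI)
  · have := hin ((s.putReg rFlag 0).putReg rX (s.idx aPres (s.reg rI)))
      ((hb.putReg (by decide) _).putReg (by decide) _) (by simp)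
    simp only [Store.reg_putReg, Nat.reduceEqDiff, if_false, Store.idx_putReg] at this
    rw [if_pos h1, this, IsNbr]
    exact ⟨fun h => ⟨h1, h⟩, fun h => h.2⟩
  · rw [if_neg h1]
    simp [IsNbr, h1]

theorem countGoods_spec (hb : Base n E s) :
    (countGoods.den s).reg rM = ((Finset.range n).filter fun j => 0 < s.idx aTight j).card ∧
      (countGoods.den s).num 7 0 0 =
        ((Finset.range n).filter fun j => 0 < s.idx aTight j).card := by
  have h0 : Base n E ((s.putReg rM 0).put cM 0) := by
    have := hb.putReg (r := rM) (by decide) 0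
    exact ⟨this.dim, this.sq, this.big, this.zero, this.top, this.one, this.edge⟩
  have key := for_induction (r := rJ) (e := rN) (P := .block [.loadIdx rX aTight rJ,
      .when (.regLt rZ rX) (.block [.incReg rM, .arith .add cM cM cOne])])
    (fun i t => t.reg rM = ((Finset.range i).filter fun j => 0 < s.idx aTight j).card ∧
      t.num 7 0 0 = ((Finset.range i).filter fun j => 0 < s.idx aTight j).card)
    ((s.putReg rM 0).put cM 0) (by decide) (by decide) (by simp [Store.num_put, hb.zero]) (by
      rintro i hi t hr hf ⟨h1, h2⟩
      have hbt : Base n E t := h0.frame (by decide) (by decide) hf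
      have f1 : t.idx aTight = s.idx aTight := hf.idx (by decide)
      simp only [den_block_cons, den_block_single, den, den_when, Test.Holds, Store.reg_putReg,
        Nat.reduceEqDiff, if_true, if_false, hr, f1, hbt.zero, Store.num_putReg]
      rw [Finset.range_add_one, Finset.filter_insert]
      by_cases hT : 0 < s.idx aTight i
      · simp [hT, h1, h2, Store.num_put, Store.get, hbt.zero, ArithOp.eval, hbt.one]
      · simp only [hT, if_false, Store.num_putReg, Store.reg_putReg, Nat.reduceEqDiff]
        exact ⟨h1, h2⟩)
  have e : ((s.putReg rM 0).put cM 0).reg rN = n := h0.dim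
  rw [e] at key
  have hden : countGoods.den s = (Program.for rJ rN (.block [.loadIdx rX aTight rJ,
      .when (.regLt rZ rX) (.block [.incReg rM, .arith .add cM cM cOne])])).den
      ((s.putReg rM 0).put cM 0) := by
    simp [countGoods, den_block_cons, den_block_single, den]
  rw [hden]
  exact key

theorem countAgents_spec (hb : Base n E s) :
    (countAgents.den s).reg rK =
        ((Finset.range n).filter (IsNbr n E (s.idx aPres) (s.idx aTight))).card ∧
      (countAgents.den s).num 6 0 0 =
        ((Finset.range n).filter (IsNbr n E (s.idx aPres) (s.idx aTight))).card := by
  have h0 : Base n E ((s.putReg rK 0).put cK 0) := by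
    have := hb.putReg (r := rK) (by decide) 0
    exact ⟨this.dim, this.sq, this.big, this.zero, this.top, this.one, this.edge⟩
  have key := for_induction (r := rI) (e := rN) (P := .block [testNbr,
      .when (.regLt rZ rFlag) (.block [.incReg rK, .arith .add cK cK cOne])])
    (fun i t => t.reg rK =
        ((Finset.range i).filter (IsNbr n E (s.idx aPres) (s.idx aTight))).card ∧
      t.num 6 0 0 = ((Finset.range i).filter (IsNbr n E (s.idx aPres) (s.idx aTight))).card)
    ((s.putReg rK 0).put cK 0) (by decide) (by decide) (by simp [Store.num_put, hb.zero]) (by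
      rintro i hi t hr hf ⟨h1, h2⟩
      have hbt : Base n E t := h0.frame (by decide) (by decide) hf
      have f1 : t.idx aTight = s.idx aTight := hf.idx (by decide)
      have f2 : t.idx aPres = s.idx aPres := hf.idx (by decide)
      have ht := testNbr_spec hbt
      rw [f1, f2, hr] at ht
      have hb' : Base n E (testNbr.den t) := hbt.den (by decide)
      have g1 : (testNbr.den t).reg rK = t.reg rK := den_reg _ (by decide) _
      have g2 : (testNbr.den t).num 6 = t.num 6 := den_num _ (by decide) _
      simp only [den_block_cons, den_block_single, den, den_when, Test.Holds, hb'.zero, ht]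
      rw [Finset.range_add_one, Finset.filter_insert]
      by_cases hT : IsNbr n E (s.idx aPres) (s.idx aTight) i
      · simp [hT, h1, h2, g1, g2, Store.num_put, Store.get, hb'.zero, ArithOp.eval, hb'.one]
      · simp only [hT, if_false, Store.num_putReg, Store.reg_putReg, Nat.reduceEqDiff, g1, g2]
        exact ⟨h1, h2⟩)
  have e : ((s.putReg rK 0).put cK 0).reg rN = n := h0.dim
  rw [e] at key
  have hden : countAgents.den s = (Program.for rI rN (.block [testNbr,
      .when (.regLt rZ rFlag) (.block [.incReg rK, .arith .add cK cK cOne])])).den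
      ((s.putReg rK 0).put cK 0) := by
    simp [countAgents, den_block_cons, den_block_single, den]
  rw [hden]
  exact key

end Program

/-! ### Selling, prices, leftover goods, and the initial store -/

namespace Program
open Classical

theorem removeAgents_spec (hb : Base n E s) :
    (∀ i < n, (removeAgents.den s).idx aPres i =
      if IsNbr n E (s.idx aPres) (s.idx aTight) i then 0 else s.idx aPres i) ∧
    ∀ i < n, (removeAgents.den s).num 8 i 0 =
      if IsNbr n E (s.idx aPres) (s.idx aTight) i then
        (s.num 6 0 0 - s.num 7 0 0) / s.num 6 0 0 else s.num 8 i 0 := by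
  set s₁ := s.put cDiff (s.num 6 0 0 - s.num 7 0 0) with hs₁
  have h0 : Base n E s₁ := ⟨hb.dim, hb.sq, hb.big, hb.zero, hb.top, hb.one, hb.edge⟩
  have key := for_induction (r := rI) (e := rN) (P := .block [testNbr, .when (.regLt rZ rFlag)
    (.block [.storeIdx aPres rI rZ, .arith .div ⟨8, rI, rZ⟩ cDiff cK])])
    (fun i t => (∀ k, t.idx aPres k =
        if k < i ∧ IsNbr n E (s.idx aPres) (s.idx aTight) k then 0 else s.idx aPres k) ∧
      ∀ k, t.num 8 k 0 = if k < i ∧ IsNbr n E (s.idx aPres) (s.idx aTight) k then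
        (s.num 6 0 0 - s.num 7 0 0) / s.num 6 0 0 else s.num 8 k 0)
    s₁ (by decide) (by decide) (by simp [hs₁]) (by
      rintro i hi t hr hf ⟨h1, h2⟩
      have hbt : Base n E t := h0.frame (by decide) (by decide) hf
      have f1 : t.idx aTight = s.idx aTight := hf.idx (by decide)
      have f2 : t.num 6 = s.num 6 := (hf.num (by decide)).trans (by simp [hs₁])
      have f3 : t.num 11 0 0 = s.num 6 0 0 - s.num 7 0 0 := by
        rw [hf.num (by decide)]; simp [hs₁, Store.num_put, hb.zero]
      -- Only agents before `i` have been removed so far, so the test still sees the original entry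
      -- of `i`.
      have ht : 0 < (testNbr.den t).reg rFlag ↔ IsNbr n E (s.idx aPres) (s.idx aTight) i := by
        rw [testNbr_spec hbt, f1, hr, IsNbr, IsNbr, h1 i, if_neg (by simp)]
      have hb' : Base n E (testNbr.den t) := hbt.den (by decide)
      have g1 : (testNbr.den t).idx aPres = t.idx aPres := den_idx _ (by decide) _
      have g2 : (testNbr.den t).num = t.num := by
        funext a
        exact den_num _ (by simp [testNbr, block, writesNum, Program.for, Program.when]) _
      have g3 : (testNbr.den t).reg rI = i := (den_reg _ (by decide) _).trans hr
      have hk : ∀ k, k < i + 1 ↔ k < i ∨ k = i := fun k => Nat.lt_succ_iff_lt_or_eq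
      simp only [den_block_cons, den_block_single, den, den_when, Test.Holds, hb'.zero, ht]
      by_cases hT : IsNbr n E (s.idx aPres) (s.idx aTight) i
      · simp only [hT, if_true, Store.idx_putReg, Store.num_putReg, Store.idx_put,
          Store.idx_putIdx_self, g1, g3, hb'.zero, Store.num_put, Store.reg_putIdx, Store.get,
          Store.num_putIdx, g2, f2, f3, ArithOp.eval, true_and, and_true]
        refine ⟨fun k => ?_, fun k => ?_⟩
        · rw [Function.update_apply, h1 k]
          by_cases hki : k = i
          · subst hki; simp [hT]
          · simp [hki, hk]
        · rw [h2 k]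
          by_cases hki : k = i
          · subst hki; simp [hT]
          · simp [hki, hk]
      · simp only [hT, if_false, Store.idx_putReg, Store.num_putReg, g1, g2]
        refine ⟨fun k => ?_, fun k => ?_⟩
        · rw [h1 k]
          by_cases hki : k = i
          · subst hki; simp [hT]
          · simp [hki, hk]
        · rw [h2 k]
          by_cases hki : k = i
          · subst hki; simp [hT]
          · simp [hki, hk])
  have e : s₁.reg rN = n := h0.dim
  rw [e] at key
  have hden : removeAgents.den s = (Program.for rI rN (.block [testNbr, .when (.regLt rZ rFlag)
    (.block [.storeIdx aPres rI rZ, .arith .div ⟨8, rI, rZ⟩ cDiff cK])])).den s₁ := by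
    simp [removeAgents, den_block_cons, den_block_single, den, Store.get, ArithOp.eval, hb.zero, hs₁]
  rw [hden]
  exact ⟨fun i hi => by simpa [hi] using key.1 i, fun i hi => by simpa [hi] using key.2 i⟩

/-- The number of slots of agent `i` that are occupied by units of good `j`. -/
def share (s : Store) (i j : ℕ) : ℕ :=
  ((Finset.range (s.reg rQ)).filter fun q => s.idx aAgent q = i ∧ s.idx aHold q < s.reg rD ∧
    s.idx aGood (s.idx aHold q) = j).card

theorem countShare_spec (hb : Base n E s) (hQ : s.reg rQ ≤ n * n) :
    (countShare.den s).num 9 0 0 = share s (s.reg rI) (s.reg rJ) := by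
  have h0 : Base n E (s.put cCount 0) := ⟨hb.dim, hb.sq, hb.big, hb.zero, hb.top, hb.one, hb.edge⟩
  have key := for_when_induction (r := rSlot) (e := rSq) (m := rQ)
    (P := .block [.loadIdx rX aAgent rSlot, .when (.regEq rX rI)
    (.block [.loadIdx rX aHold rSlot, .when (.regLt rX rD)
      (.block [.loadIdx rX aGood rX, .when (.regEq rX rJ) (.arith .add cCount cCount cOne)])])])
    (fun i t => t.num 9 0 0 = ((Finset.range i).filter fun q => s.idx aAgent q = s.reg rI ∧
      s.idx aHold q < s.reg rD ∧ s.idx aGood (s.idx aHold q) = s.reg rJ).card) (s.put cCount 0)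
    (by decide) (by decide) (by decide) (by decide) (by simpa [hb.sq] using hQ)
    (by simp [Store.num_put, hb.zero]) (fun i t v h => h) (by
      intro i hi t hr hf h
      have hbt : Base n E t := h0.frame (by decide) (by decide) hf
      have f1 : t.idx aHold = s.idx aHold := hf.idx (by decide)
      have f2 : t.reg rD = s.reg rD := hf.reg (by decide) (by decide)
      have f3 : t.idx aAgent = s.idx aAgent := hf.idx (by decide)
      have f4 : t.idx aGood = s.idx aGood := hf.idx (by decide)
      have f5 : t.reg rI = s.reg rI := hf.reg (by decide) (by decide)
      have f6 : t.reg rJ = s.reg rJ := hf.reg (by decide) (by decide)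
      simp only [den_block_cons, den_block_single, den, den_when, Test.Holds, Store.reg_putReg,
        Nat.reduceEqDiff, if_true, if_false, hr, f1, f2, f3, f4, f5, f6, Store.idx_putReg,
        Store.num_putReg]
      rw [Finset.range_add_one, Finset.filter_insert]
      by_cases h1 : s.idx aAgent i = s.reg rI
      · by_cases h2 : s.idx aHold i < s.reg rD
        · by_cases h3 : s.idx aGood (s.idx aHold i) = s.reg rJ
          · simp [h1, h2, h3, h, Store.num_put, Store.get, hbt.zero, hbt.one, ArithOp.eval]
          · simp [h1, h2, h3, h]
        · simp [h1, h2, h]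
      · simp [h1, h])
  have e : (s.put cCount 0).reg rQ = s.reg rQ := by simp
  rw [e] at key
  have hden : countShare.den s = (forSlots (.block [.loadIdx rX aAgent rSlot, .when (.regEq rX rI)
    (.block [.loadIdx rX aHold rSlot, .when (.regLt rX rD)
      (.block [.loadIdx rX aGood rX, .when (.regEq rX rJ) (.arith .add cCount cCount cOne)])])])).den
      (s.put cCount 0) := by
    simp [countShare, den_block_cons, den_block_single, den]
  rw [hden, share]
  exact key

theorem sellRow_spec (hb : Base n E s) (hQ : s.reg rQ ≤ n * n) (i j : ℕ) :
    ((Program.for rI rN (.block [countShare, .arith .div ⟨3, rI, rJ⟩ cCount cK])).den s).num 3 i j =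
      if i < n ∧ j = s.reg rJ then share s i j / s.num 6 0 0 else s.num 3 i j := by
  have key := for_induction (r := rI) (e := rN)
    (P := .block [countShare, .arith .div ⟨3, rI, rJ⟩ cCount cK])
    (fun k t => t.num 3 i j =
      if i < k ∧ j = s.reg rJ then share s i j / s.num 6 0 0 else s.num 3 i j) s
    (by decide) (by decide) (by simp) (by
      intro k hk t hr hf h
      have hbt : Base n E t := hb.frame (by decide) (by decide) hf
      have f1 : t.idx = s.idx := by
        funext a
        exact hf.idx (by simp [countShare, block, writesIdx, Program.for, Program.when])
      have f2 : t.reg rD = s.reg rD := hf.reg (by decide) (by decide)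
      have f3 : t.reg rQ = s.reg rQ := hf.reg (by decide) (by decide)
      have f4 : t.reg rJ = s.reg rJ := hf.reg (by decide) (by decide)
      have f5 : t.num 6 = s.num 6 := hf.num (by decide)
      have hsh : ∀ i j, share t i j = share s i j := fun i j => by simp only [share, f1, f2, f3]
      have hc := countShare_spec hbt (by rwa [f3])
      rw [hsh, hr, f4] at hc
      have hb' : Base n E (countShare.den t) := hbt.den (by decide)
      have g1 : (countShare.den t).reg rI = k := (den_reg _ (by decide) _).trans hr
      have g2 : (countShare.den t).reg rJ = s.reg rJ := (den_reg _ (by decide) _).trans f4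
      have g3 : (countShare.den t).num 3 = t.num 3 := den_num _ (by decide) _
      have g4 : (countShare.den t).num 6 = s.num 6 := (den_num _ (by decide) _).trans f5
      simp only [den_block_cons, den_block_single, den, Store.num_putReg, Store.num_put, Store.get,
        hb'.zero, g1, g2, g3, g4, hc, ArithOp.eval, true_and, h]
      have hki : i < k + 1 ↔ i < k ∨ i = k := Nat.lt_succ_iff_lt_or_eq
      by_cases h1 : i = k
      · subst h1
        by_cases h2 : j = s.reg rJ
        · simp [h2]
        · simp [h2]
      · simp [h1, hki])
  rwa [hb.dim] at key

theorem sellGoods_spec (hb : Base n E s) (hQ : s.reg rQ ≤ n * n) :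
    (∀ j < n, (sellGoods.den s).idx aAct j = if 0 < s.idx aTight j then 0 else s.idx aAct j) ∧
    ∀ i < n, ∀ j < n, (sellGoods.den s).num 3 i j =
      if 0 < s.idx aTight j then share s i j / s.num 6 0 0 else s.num 3 i j := by
  have key := for_induction (r := rJ) (e := rN) (P := .block [.loadIdx rX aTight rJ,
    .when (.regLt rZ rX) (.block [.storeIdx aAct rJ rZ,
      .for rI rN (.block [countShare, .arith .div ⟨3, rI, rJ⟩ cCount cK])])])
    (fun k t => (∀ j, t.idx aAct j = if j < k ∧ 0 < s.idx aTight j then 0 else s.idx aAct j) ∧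
      ∀ i < n, ∀ j, t.num 3 i j =
        if j < k ∧ 0 < s.idx aTight j then share s i j / s.num 6 0 0 else s.num 3 i j) s
    (by decide) (by decide) (by simp) (by
      rintro k hk t hr hf ⟨h1, h2⟩
      have hbt : Base n E t := hb.frame (by decide) (by decide) hf
      have f1 : t.idx aTight = s.idx aTight := hf.idx (by decide)
      have f2 : t.reg rD = s.reg rD := hf.reg (by decide) (by decide)
      have f3 : t.reg rQ = s.reg rQ := hf.reg (by decide) (by decide)
      have f4 : t.idx aHold = s.idx aHold := hf.idx (by decide)
      have f5 : t.num 6 = s.num 6 := hf.num (by decide)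
      have f6 : t.idx aAgent = s.idx aAgent := hf.idx (by decide)
      have f7 : t.idx aGood = s.idx aGood := hf.idx (by decide)
      have hkj : ∀ j, j < k + 1 ↔ j < k ∨ j = k := fun j => Nat.lt_succ_iff_lt_or_eq
      simp only [den_block_cons, den_block_single, den, den_when, Test.Holds, Store.reg_putReg,
        Nat.reduceEqDiff, if_true, if_false, hr, f1, hbt.zero, Store.idx_putReg, Store.num_putReg]
      by_cases hT : 0 < s.idx aTight k
      · rw [if_pos hT]
        set t₁ := (t.putReg rX (s.idx aTight k)).putIdx aAct k 0 with ht₁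
        have hb₁ : Base n E t₁ := by
          have := hbt.putReg (r := rX) (by decide) (s.idx aTight k)
          exact ⟨this.dim, this.sq, this.big, this.zero, this.top, this.one, this.edge⟩
        have hsh : ∀ i j, share t₁ i j = share s i j := fun i j => by
          simp [share, ht₁, f2, f3, f4, f6, f7]
        have hrow := sellRow_spec hb₁ (by simpa [ht₁, f3] using hQ)
        refine ⟨fun j => ?_, fun i hi j => ?_⟩
        · rw [den_idx _ (by decide), ht₁, Store.idx_putIdx_self, Function.update_apply,
            Store.idx_putReg, h1 j]
          by_cases hjk : j = k
          · subst hjk; simp [hT]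
          · simp [hjk, hkj]
        · have hj1 : t₁.reg rJ = k := by simp [ht₁, hr]
          rw [hrow i j, hsh, hj1]
          simp only [hi, true_and, ht₁, Store.num_putIdx, Store.num_putReg, f5, h2 i hi j]
          by_cases hjk : j = k
          · subst hjk; simp [hT]
          · simp [hjk, hkj]
      · rw [if_neg hT]
        simp only [Store.idx_putReg, Store.num_putReg]
        refine ⟨fun j => ?_, fun i hi j => ?_⟩
        · rw [h1 j]
          by_cases hjk : j = k
          · subst hjk; simp [hT]
          · simp [hjk, hkj]
        · rw [h2 i hi j]
          by_cases hjk : j = k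
          · subst hjk; simp [hT]
          · simp [hjk, hkj])
  rw [hb.dim] at key
  exact ⟨fun j hj => by simpa [hj, sellGoods] using key.1 j,
    fun i hi j hj => by simpa [hj, sellGoods] using key.2 i hi j⟩

theorem setPrices_spec (hb : Base n E s) : ∀ j < n, (setPrices.den s).num 4 j 0 =
    if 0 < s.idx aTight j then s.num 6 0 0 / s.num 7 0 0 else s.num 4 j 0 := by
  have key := for_induction (r := rJ) (e := rN) (P := .block [.loadIdx rX aTight rJ,
    .when (.regLt rZ rX) (.arith .div ⟨4, rJ, rZ⟩ cK cM)])
    (fun k t => ∀ j, t.num 4 j 0 =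
      if j < k ∧ 0 < s.idx aTight j then s.num 6 0 0 / s.num 7 0 0 else s.num 4 j 0) s
    (by decide) (by decide) (by simp) (by
      intro k hk t hr hf h j
      have hbt : Base n E t := hb.frame (by decide) (by decide) hf
      have f1 : t.idx aTight = s.idx aTight := hf.idx (by decide)
      have f2 : t.num 6 = s.num 6 := hf.num (by decide)
      have f3 : t.num 7 = s.num 7 := hf.num (by decide)
      have hkj : j < k + 1 ↔ j < k ∨ j = k := Nat.lt_succ_iff_lt_or_eq
      simp only [den_block_cons, den_block_single, den, den_when, Test.Holds, Store.reg_putReg,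
        Nat.reduceEqDiff, if_true, if_false, hr, f1, hbt.zero, Store.num_putReg]
      by_cases hT : 0 < s.idx aTight k
      · rw [if_pos hT]
        simp only [Store.num_put, Store.reg_putReg, Nat.reduceEqDiff, if_false, hr, hbt.zero,
          Store.get, Store.num_putReg, f2, f3, ArithOp.eval, true_and, and_true, h j]
        by_cases hjk : j = k
        · subst hjk; simp [hT]
        · simp [hjk, hkj]
      · rw [if_neg hT]
        simp only [Store.num_putReg, h j]
        by_cases hjk : j = k
        · subst hjk; simp [hT]
        · simp [hjk, hkj])
  rw [hb.dim] at key
  exact fun j hj => by simpa [hj, setPrices] using key j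

theorem copyActive_spec (hb : Base n E s) : ∀ j < n,
    (copyActive.den s).idx aTight j = s.idx aAct j := by
  have key := for_induction (r := rJ) (e := rN)
    (P := .block [.loadIdx rX aAct rJ, .storeIdx aTight rJ rX])
    (fun k t => ∀ j < k, t.idx aTight j = s.idx aAct j) s
    (by decide) (by decide) (by simp) (by
      intro k hk t hr hf h j hj
      have f1 : t.idx aAct = s.idx aAct := hf.idx (by decide)
      simp only [den_block_cons, den_block_single, den, Store.reg_putReg, Nat.reduceEqDiff, if_true,
        if_false, hr, f1, Store.idx_putReg, Store.idx_putIdx_self]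
      rw [Function.update_apply]
      split_ifs with hjk
      · rw [hjk]
      · exact h j (by omega))
  rwa [hb.dim] at key

theorem testLeft_spec (hb : Base n E s) (h12 : s.num 12 0 0 = 0) :
    0 < (testLeft.den s).reg rFlag ↔ ∀ i < n, s.num 3 i (s.reg rJ) = 0 := by
  have key := for_induction (r := rI) (e := rN)
    (P := .ite (.numEq ⟨3, rI, rJ⟩ cZero) .skip (.setReg rFlag 0))
    (fun k t => 0 < t.reg rFlag ↔ ∀ i < k, s.num 3 i (s.reg rJ) = 0) (s.putReg rFlag 1)
    (by decide) (by decide) (by simp) (by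
      intro k hk t hr hf h
      have hbt : Base n E t := (hb.putReg (by decide) 1).frame (by decide) (by decide) hf
      have f1 : t.num 3 = s.num 3 := hf.num (by decide)
      have f2 : t.num 12 = s.num 12 := hf.num (by decide)
      have f3 : t.reg rJ = s.reg rJ := (hf.reg (by decide) (by decide)).trans (by simp)
      have hall : (∀ i < k + 1, s.num 3 i (s.reg rJ) = 0) ↔
          (∀ i < k, s.num 3 i (s.reg rJ) = 0) ∧ s.num 3 k (s.reg rJ) = 0 := by
        simp only [Nat.lt_succ_iff_lt_or_eq, or_imp, forall_and, forall_eq]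
      rw [hall]
      simp only [den, Test.Holds, Store.get, hr, f1, f2, f3, hbt.zero, h12]
      by_cases h0 : s.num 3 k (s.reg rJ) = 0 <;> simp [h0, h])
  have e : (s.putReg rFlag 1).reg rN = n := by simpa using hb.dim
  rw [e] at key
  exact key

theorem countLeft_spec (hb : Base n E s) (h12 : s.num 12 0 0 = 0) :
    (∀ j < n, (0 < (countLeft.den s).idx aLeft j ↔ ∀ i < n, s.num 3 i j = 0)) ∧
      (countLeft.den s).num 10 0 0 =
        ((Finset.range n).filter fun j => ∀ i < n, s.num 3 i j = 0).card := by
  have h0 : Base n E (s.put cLeft 0) := ⟨hb.dim, hb.sq, hb.big, hb.zero, hb.top, hb.one, hb.edge⟩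
  have key := for_induction (r := rJ) (e := rN) (P := .block [testLeft, .storeIdx aLeft rJ rFlag,
    .when (.regLt rZ rFlag) (.arith .add cLeft cLeft cOne)])
    (fun k t => (∀ j < k, (0 < t.idx aLeft j ↔ ∀ i < n, s.num 3 i j = 0)) ∧
      t.num 10 0 0 = ((Finset.range k).filter fun j => ∀ i < n, s.num 3 i j = 0).card)
    (s.put cLeft 0) (by decide) (by decide) (by simp [Store.num_put, hb.zero]) (by
      rintro k hk t hr hf ⟨h1, h2⟩
      have hbt : Base n E t := h0.frame (by decide) (by decide) hf
      have f1 : t.num 3 = s.num 3 := (hf.num (by decide)).trans (by simp)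
      have f2 : t.num 12 = s.num 12 := (hf.num (by decide)).trans (by simp)
      have ht := testLeft_spec hbt (by rw [f2, h12])
      rw [f1, hr] at ht
      have hb' : Base n E (testLeft.den t) := hbt.den (by decide)
      have g1 : (testLeft.den t).reg rJ = k := (den_reg _ (by decide) _).trans hr
      have g2 : (testLeft.den t).idx aLeft = t.idx aLeft := den_idx _ (by decide) _
      have g3 : (testLeft.den t).num 10 = t.num 10 := den_num _ (by decide) _
      simp only [den_block_cons, den_block_single, den, den_when, Test.Holds, Store.reg_putIdx,
        hb'.zero, g1, ht, Store.idx_putReg, Store.num_putReg]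
      refine ⟨fun j hj => ?_, ?_⟩
      · have : ((if ∀ i < n, s.num 3 i k = 0 then
            ((testLeft.den t).putIdx aLeft k ((testLeft.den t).reg rFlag)).put cLeft
              (ArithOp.add.eval (((testLeft.den t).putIdx aLeft k
                ((testLeft.den t).reg rFlag)).get cLeft)
                (((testLeft.den t).putIdx aLeft k ((testLeft.den t).reg rFlag)).get cOne))
            else (testLeft.den t).putIdx aLeft k ((testLeft.den t).reg rFlag)).idx aLeft j) =
            Function.update (t.idx aLeft) k ((testLeft.den t).reg rFlag) j := by
          split_ifs <;> simp [g2]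
        rw [this, Function.update_apply]
        split_ifs with hjk
        · rw [ht, hjk]
        · exact h1 j (by omega)
      · rw [Finset.range_add_one, Finset.filter_insert]
        by_cases hT : ∀ i < n, s.num 3 i k = 0
        · rw [if_pos hT, if_pos hT]
          simp [Store.num_put, Store.get, hb'.zero, hb'.one, ArithOp.eval, g3, h2]
        · rw [if_neg hT, if_neg hT]
          simp [g3, h2])
  have e : (s.put cLeft 0).reg rN = n := h0.dim
  rw [e] at key
  have hden : countLeft.den s = (Program.for rJ rN (.block [testLeft, .storeIdx aLeft rJ rFlag,
      .when (.regLt rZ rFlag) (.arith .add cLeft cLeft cOne)])).den (s.put cLeft 0) := by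
    simp [countLeft, den_block_cons, den_block_single, den]
  rw [hden]
  exact key

theorem shareColumn_spec (hb : Base n E s) (i j : ℕ) :
    ((Program.for rI rN (.arith .div ⟨3, rI, rJ⟩ ⟨8, rI, rZ⟩ cLeft)).den s).num 3 i j =
      if i < n ∧ j = s.reg rJ then s.num 8 i 0 / s.num 10 0 0 else s.num 3 i j := by
  have key := for_induction (r := rI) (e := rN)
    (P := .arith .div ⟨3, rI, rJ⟩ ⟨8, rI, rZ⟩ cLeft)
    (fun k t => t.num 3 i j =
      if i < k ∧ j = s.reg rJ then s.num 8 i 0 / s.num 10 0 0 else s.num 3 i j) s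
    (by decide) (by decide) (by simp) (by
      intro k hk t hr hf h
      have hbt : Base n E t := hb.frame (by decide) (by decide) hf
      have f1 : t.num 8 = s.num 8 := hf.num (by decide)
      have f2 : t.num 10 = s.num 10 := hf.num (by decide)
      have f4 : t.reg rJ = s.reg rJ := hf.reg (by decide) (by decide)
      simp only [den, Store.num_putReg, Store.num_put, Store.get, hbt.zero, hr, f1, f2, f4,
        ArithOp.eval, true_and, h]
      have hki : i < k + 1 ↔ i < k ∨ i = k := Nat.lt_succ_iff_lt_or_eq
      by_cases h1 : i = k
      · subst h1
        by_cases h2 : j = s.reg rJ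
        · simp [h2]
        · simp [h2]
      · simp [h1, hki])
  rwa [hb.dim] at key

theorem shareLeft_spec (hb : Base n E s) : ∀ i < n, ∀ j < n, (shareLeft.den s).num 3 i j =
    if 0 < s.idx aLeft j then s.num 8 i 0 / s.num 10 0 0 else s.num 3 i j := by
  have key := for_induction (r := rJ) (e := rN) (P := .block [.loadIdx rX aLeft rJ,
    .when (.regLt rZ rX) (.for rI rN (.arith .div ⟨3, rI, rJ⟩ ⟨8, rI, rZ⟩ cLeft))])
    (fun k t => ∀ i < n, ∀ j, t.num 3 i j =
      if j < k ∧ 0 < s.idx aLeft j then s.num 8 i 0 / s.num 10 0 0 else s.num 3 i j) s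
    (by decide) (by decide) (by simp) (by
      intro k hk t hr hf h i hi j
      have hbt : Base n E t := hb.frame (by decide) (by decide) hf
      have f1 : t.idx aLeft = s.idx aLeft := hf.idx (by decide)
      have f2 : t.num 8 = s.num 8 := hf.num (by decide)
      have f3 : t.num 10 = s.num 10 := hf.num (by decide)
      have hkj : j < k + 1 ↔ j < k ∨ j = k := Nat.lt_succ_iff_lt_or_eq
      simp only [den_block_cons, den_block_single, den, den_when, Test.Holds, Store.reg_putReg,
        Nat.reduceEqDiff, if_true, if_false, hr, f1, hbt.zero, Store.num_putReg]
      by_cases hT : 0 < s.idx aLeft k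
      · rw [if_pos hT, shareColumn_spec (hbt.putReg (by decide) _)]
        simp only [hi, true_and, Store.reg_putReg, Nat.reduceEqDiff, if_false, hr, Store.num_putReg,
          f2, f3, h i hi j]
        by_cases hjk : j = k
        · subst hjk; simp [hT]
        · simp [hjk, hkj]
      · rw [if_neg hT]
        simp only [Store.num_putReg, h i hi j]
        by_cases hjk : j = k
        · subst hjk; simp [hT]
        · simp [hjk, hkj])
  rw [hb.dim] at key
  exact fun i hi j hj => by simpa [hj, shareLeft] using key i hi j

theorem squares_spec (h : s.reg rSq = 0) :
    (squares.den s).reg rSq = s.reg rN * s.reg rN := by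
  have hin : ∀ t : Store, ((Program.for rJ rN (.incReg rSq)).den t).reg rSq =
      t.reg rSq + t.reg rN := fun t =>
    for_induction (r := rJ) (e := rN) (P := .incReg rSq)
      (fun k t' => t'.reg rSq = t.reg rSq + k) t (by decide) (by decide) (by simp) (by
        intro k hk t' hr hf h
        simp only [den, Store.reg_putReg, Nat.reduceEqDiff, if_true, if_false, h]
        omega)
  refine for_induction (r := rI) (e := rN) (P := .for rJ rN (.incReg rSq))
    (fun k t => t.reg rSq = k * s.reg rN) s (by decide) (by decide) (by simp [h]) ?_
  intro k hk t hr hf h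
  have f1 : t.reg rN = s.reg rN := hf.reg (by decide) (by decide)
  simp only [Store.reg_putReg, Nat.reduceEqDiff, if_false, hin, h, f1]
  ring

theorem bounds_spec (h : s.reg rBig = 0) :
    (bounds.den s).reg rBig = s.reg rSq * (s.reg rSq + 1) := by
  have hin : ∀ t : Store, ((Program.for rJ rSq (.incReg rBig)).den t).reg rBig =
      t.reg rBig + t.reg rSq := fun t =>
    for_induction (r := rJ) (e := rSq) (P := .incReg rBig)
      (fun k t' => t'.reg rBig = t.reg rBig + k) t (by decide) (by decide) (by simp) (by
        intro k hk t' hr hf h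
        simp only [den, Store.reg_putReg, Nat.reduceEqDiff, if_true, if_false, h]
        omega)
  refine for_induction (r := rI) (e := rSq)
    (P := .block [.for rJ rSq (.incReg rBig), .incReg rBig])
    (fun k t => t.reg rBig = k * (s.reg rSq + 1)) s (by decide) (by decide) (by simp [h]) ?_
  intro k hk t hr hf h
  have f1 : t.reg rSq = s.reg rSq := hf.reg (by decide) (by decide)
  simp only [den_block_cons, den_block_single, den, Store.reg_putReg, Nat.reduceEqDiff, if_true,
    if_false, hin, h, f1]
  ring

/-- The state in which the main part of the program begins. -/
structure Ready (n : ℕ) (E : ℕ → ℕ → Prop) (t : Store) : Prop where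
  base : Base n E t
  act : ∀ j < n, 0 < t.idx aAct j
  pres : ∀ i < n, 0 < t.idx aPres i
  missing : ∀ i < n, t.num 8 i 0 = 1
  regK : t.reg rK = 1
  regM : t.reg rM = 1
  numK : t.num 6 0 0 = 1
  numM : t.num 7 0 0 = 1

theorem setup_spec (h0 : s.reg rN = n) (h1 : s.reg rSq = n * n)
    (h2 : s.reg rBig = n * n * (n * n + 1)) (h3 : s.reg rZ = 0)
    (he : ∀ i j, s.num 0 i j = s.num 2 i 0 ↔ E i j) : Ready n E (setup.den s) := by
  set P : Program := .block [.storeIdx aAct rI rX, .storeIdx aPres rI rX, .setNum ⟨8, rI, rZ⟩ 1]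
    with hP
  set s₁ := (s.put cOne (1 : ℤ)).putReg rX 1 with hs₁
  have key := for_induction (r := rI) (e := rN) (P := P)
    (fun k t => (∀ j < k, 0 < t.idx aAct j) ∧ (∀ i < k, 0 < t.idx aPres i) ∧
      ∀ i < k, t.num 8 i 0 = 1) s₁ (by rw [hP]; decide) (by decide) (by simp) (by
      rintro k hk t hr hf ⟨a1, a2, a3⟩
      have f1 : t.reg rX = 1 := (hf.reg (by decide) (by rw [hP]; decide)).trans (by simp [hs₁])
      have f2 : t.reg rZ = 0 := (hf.reg (by decide) (by rw [hP]; decide)).trans (by simp [hs₁, h3])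
      simp only [hP, den_block_cons, den_block_single, den, Store.idx_putReg, Store.num_putReg,
        Store.idx_put, Store.idx_putIdx_self, Store.idx_putIdx_ne, ne_eq, zero_ne_one, one_ne_zero,
        not_false_iff, hr, f1, f2, Store.reg_putIdx, Store.num_put, Store.num_putIdx]
      refine ⟨fun j hj => ?_, fun j hj => ?_, fun j hj => ?_⟩
      · rw [Function.update_apply]
        split_ifs
        · exact one_pos
        · exact a1 j (by omega)
      · rw [Function.update_apply]
        split_ifs
        · exact one_pos
        · exact a2 j (by omega)
      · split_ifs with hjk
        · simp
        · exact a3 j (by simp at hjk; omega))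
  have hn : s₁.reg rN = n := by simp [hs₁, h0]
  rw [hn] at key
  have hden : setup.den s = (Program.block [.copyReg rL rSq, .incReg rL,
      .setReg rK 1, .setReg rM 1, .setNum cK 1, .setNum cM 1]).den
      ((Program.for rI rN P).den s₁) := rfl
  have hr : ∀ x, x ≠ rI → ((Program.for rI rN P).den s₁).reg x = s₁.reg x := fun x hx =>
    den_reg _ (by simp [hP, Program.for, block, writesReg, Ne.symm hx]) _
  have hm : ∀ x, x ≠ 8 → ((Program.for rI rN P).den s₁).num x = s₁.num x := fun x hx =>
    den_num _ (by simp [hP, Program.for, block, writesNum, Ne.symm hx]) _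
  rw [hden]
  generalize (Program.for rI rN P).den s₁ = t at *
  have z : t.reg rZ = 0 := by simp [hr, hs₁, h3]
  refine ⟨⟨?_, ?_, ?_, ?_, ?_, ?_, ?_⟩, ?_, ?_, ?_, ?_, ?_, ?_, ?_⟩ <;>
    simp only [den_block_cons, den_block_single, den, Store.idx_putReg, Store.num_putReg,
      Store.idx_put, Store.reg_put, Store.reg_putReg, Store.num_put, Nat.reduceEqDiff, if_true,
      if_false, z, false_and]
  · simp [hr, hs₁, h0]
  · simp [hr, hs₁, h1]
  · simp [hr, hs₁, h2]
  · simp [hr, hs₁, h1]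
  · simp [hm, hs₁, h3, Store.num_put]
  · intro i j
    simpa [hm, hs₁] using he i j
  · exact key.1
  · exact key.2.1
  · intro i hi; simp [key.2.2 i hi]
  · simp
  · simp

end Program

/-! ## From stores to sets of agents and goods -/

/-- The set of indices with a positive entry. -/
def posSet (n : ℕ) (f : ℕ → ℕ) : Finset (Fin n) := Finset.univ.filter fun j => 0 < f j

@[simp] theorem mem_posSet {f : ℕ → ℕ} {j : Fin n} : j ∈ posSet n f ↔ 0 < f j := by
  simp [posSet]

theorem card_filter_range_eq {p : ℕ → Prop} [DecidablePred p] {X : Finset (Fin n)}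
    (h : ∀ j : Fin n, j ∈ X ↔ p j) : ((Finset.range n).filter p).card = X.card := by
  rw [← Finset.card_map Fin.valEmbedding]
  congr 1
  ext j
  simp only [Finset.mem_filter, Finset.mem_range, Finset.mem_map, Fin.valEmbedding_apply]
  constructor
  · rintro ⟨h1, h2⟩; exact ⟨⟨j, h1⟩, (h _).2 h2, rfl⟩
  · rintro ⟨k, hk, rfl⟩; exact ⟨k.2, (h k).1 hk⟩

theorem IsCopies.card_filter_fin {k c : ℕ} {src f : ℕ → ℕ} (h : IsCopies n k src c f)
    {X : Finset (Fin n)} (hX : X ⊆ posSet n src) :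
    ((Finset.range c).filter fun d => ∃ j ∈ X, f d = j).card = X.card * k := by
  have := h.card_filter (X.map Fin.valEmbedding) (fun j hj => by
    obtain ⟨i, hi, rfl⟩ := Finset.mem_map.1 hj
    exact ⟨i.2, mem_posSet.1 (hX hi)⟩)
  rw [Finset.card_map] at this
  rw [← this]
  congr 1
  ext d
  simp only [Finset.mem_filter, Finset.mem_map, Fin.valEmbedding_apply, eq_comm]

theorem IsCopies.card_fiber {k c : ℕ} {src f : ℕ → ℕ} (h : IsCopies n k src c f) {j : Fin n}
    (hj : j ∈ posSet n src) : ((Finset.range c).filter fun d => f d = j).card = k := by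
  rw [h j, if_pos ⟨j.2, mem_posSet.1 hj⟩]

theorem IsCopies.exists_fin {k c : ℕ} {src f : ℕ → ℕ} (h : IsCopies n k src c f) {d : ℕ}
    (hd : d < c) : ∃ j ∈ posSet n src, f d = j :=
  ⟨⟨f d, (h.mem hd).1⟩, by simpa using (h.mem hd).2, rfl⟩

section Matched
open Program

variable {v : Fin n → Fin n → ℝ} {K M : ℕ} {act pres : ℕ → ℕ} {t : Store}

/-- The set of active goods all of whose neighbouring slots lie above the gap. -/
def IsCutSet (n : ℕ) (E : ℕ → ℕ → Prop) (act : ℕ → ℕ) (t : Store) (T : Finset (Fin n)) : Prop :=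
  ∀ j : Fin n, j ∈ T ↔
    0 < act j ∧ ∀ q < t.reg rQ, E (t.idx aAgent q) j → t.reg rGap < t.idx aLev q

/-- A slot of a neighbour of the cut lies above the gap. Hence it is occupied, by a unit all of
whose neighbouring slots lie above the gap, and the good of that unit belongs to the cut. -/
theorem Program.Matched.held_of_nbr (h : Matched n E K M act pres t)
    (hE : ∀ i j : Fin n, E i j ↔ v i j = 1) {T : Finset (Fin n)} (hT : IsCutSet n E act t T)
    {q : ℕ} (hq : q < t.reg rQ) (hi : ∃ i ∈ nbrIn v (posSet n pres) T, t.idx aAgent q = i) :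
    t.idx aHold q < t.reg rD ∧ ∃ j ∈ T, t.idx aGood (t.idx aHold q) = j := by
  obtain ⟨i, hi, hqi⟩ := hi
  obtain ⟨-, j, hj, hij⟩ := Finset.mem_filter.1 hi
  have hhigh := ((hT j).1 hj).2 q hq (by rw [hqi]; exact (hE i j).2 hij)
  obtain ⟨h1, h2⟩ := h.cut.held_of_high q hq hhigh
  obtain ⟨j', hj', he⟩ := h.units.exists_fin h1
  exact ⟨h1, j', (hT j').2 ⟨mem_posSet.1 hj', fun q' hq' ha => h2 q' hq' (by rwa [unitAdj, he])⟩, he⟩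

theorem Program.Matched.free_mem_cut (h : Matched n E K M act pres t) {T : Finset (Fin n)}
    (hT : IsCutSet n E act t T) {d : ℕ} (hd : d < t.reg rD)
    (hf : IsFree (t.reg rQ) (t.idx aHold) d) : ∃ j ∈ T, t.idx aGood d = j := by
  obtain ⟨j, hj, he⟩ := h.units.exists_fin hd
  exact ⟨j, (hT j).2 ⟨mem_posSet.1 hj, fun q hq ha =>
    h.cut.high_of_free d hd hf q hq (by rwa [unitAdj, he])⟩, he⟩

/-- If a unit is free, then the cut violates Hall's condition. -/
theorem Program.Matched.card_lt_of_free (h : Matched n E K M act pres t)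
    (hE : ∀ i j : Fin n, E i j ↔ v i j = 1) {T : Finset (Fin n)} (hT : IsCutSet n E act t T)
    {d : ℕ} (hd : d < t.reg rD) (hf : IsFree (t.reg rQ) (t.idx aHold) d) :
    (nbrIn v (posSet n pres) T).card * M < T.card * K := by
  have hTG : T ⊆ posSet n act := fun j hj => mem_posSet.2 ((hT j).1 hj).1
  rw [← h.slots.card_filter_fin (Finset.filter_subset _ _), ← h.units.card_filter_fin hTG]
  have hmem : d ∈ (Finset.range (t.reg rD)).filter fun d => ∃ j ∈ T, t.idx aGood d = j := by
    simpa [hd] using h.free_mem_cut hT hd hf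
  -- The slots of the neighbours of `T` hold distinct units of goods in `T`, and none of them holds
  -- `d`, which is itself a unit of a good in `T`.
  refine lt_of_le_of_lt ?_ (Finset.card_erase_lt_of_mem hmem)
  refine Finset.card_le_card_of_injOn (t.idx aHold) (fun q hq => ?_) (fun q hq q' hq' he => ?_)
  · obtain ⟨hq, hi⟩ := Finset.mem_filter.1 hq
    have := h.held_of_nbr hE hT (Finset.mem_range.1 hq) hi
    refine Finset.mem_erase.2 ⟨hf q (Finset.mem_range.1 hq), Finset.mem_filter.2 ⟨?_, this.2⟩⟩
    exact Finset.mem_range.2 this.1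
  · obtain ⟨hq, hi⟩ := Finset.mem_filter.1 hq
    obtain ⟨hq', -⟩ := Finset.mem_filter.1 hq'
    exact h.cut.inj q (Finset.mem_range.1 hq) q' (Finset.mem_range.1 hq')
      (h.held_of_nbr hE hT (Finset.mem_range.1 hq) hi).1 he

/-- Every unit occupies a slot. -/
def Saturated (t : Store) : Prop := ∀ d < t.reg rD, ∃ q < t.reg rQ, t.idx aHold q = d

/-- Occupied slots hold distinct units, so comparing their number with the number of units decides
whether a unit is free. The program tests exactly this inequality. -/
theorem Program.Matched.saturated_or (h : Matched n E K M act pres t) :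
    (Saturated t ∧ ¬ ((Finset.range (t.reg rQ)).filter fun q => t.idx aHold q < t.reg rD).card <
        t.reg rD) ∨
      (∃ d < t.reg rD, IsFree (t.reg rQ) (t.idx aHold) d) ∧
        ((Finset.range (t.reg rQ)).filter fun q => t.idx aHold q < t.reg rD).card < t.reg rD := by
  set H := (Finset.range (t.reg rQ)).filter fun q => t.idx aHold q < t.reg rD
  have hinj : Set.InjOn (t.idx aHold) (H : Set ℕ) := fun q hq q' hq' he => by
    obtain ⟨hq, hi⟩ := Finset.mem_filter.1 hq
    obtain ⟨hq', -⟩ := Finset.mem_filter.1 hq'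
    exact h.cut.inj q (Finset.mem_range.1 hq) q' (Finset.mem_range.1 hq') hi he
  have hsub : H.image (t.idx aHold) ⊆ Finset.range (t.reg rD) := fun d hd => by
    obtain ⟨q, hq, rfl⟩ := Finset.mem_image.1 hd
    exact Finset.mem_range.2 (Finset.mem_filter.1 hq).2
  have hcard := Finset.card_image_of_injOn hinj
  by_cases hs : Saturated t
  · left
    refine ⟨hs, fun hlt => ?_⟩
    have : Finset.range (t.reg rD) ⊆ H.image (t.idx aHold) := fun d hd => by
      obtain ⟨q, hq, rfl⟩ := hs d (Finset.mem_range.1 hd)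
      exact Finset.mem_image.2 ⟨q, Finset.mem_filter.2 ⟨Finset.mem_range.2 hq,
        Finset.mem_range.1 hd⟩, rfl⟩
    have := Finset.card_le_card this
    rw [hcard, Finset.card_range] at this
    omega
  · right
    unfold Saturated at hs
    push Not at hs
    obtain ⟨d, hd, hf⟩ := hs
    refine ⟨⟨d, hd, hf⟩, ?_⟩
    have hne : d ∉ H.image (t.idx aHold) := fun hm => by
      obtain ⟨q, hq, he⟩ := Finset.mem_image.1 hm
      exact hf q (Finset.mem_range.1 (Finset.mem_filter.1 hq).1) he
    have : H.image (t.idx aHold) ⊂ Finset.range (t.reg rD) :=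
      (Finset.ssubset_iff_of_subset hsub).2 ⟨d, Finset.mem_range.2 hd, hne⟩
    have := Finset.card_lt_card this
    rwa [hcard, Finset.card_range] at this

/-- The agent of an occupied slot is interested in the good that occupies it. -/
theorem Program.Matched.edge_of_held (h : Matched n E K M act pres t)
    (hE : ∀ i j : Fin n, E i j ↔ v i j = 1) {q : ℕ} (hq : q < t.reg rQ)
    (hd : t.idx aHold q < t.reg rD) {i j : Fin n} (hi : t.idx aAgent q = i)
    (hj : t.idx aGood (t.idx aHold q) = j) :
    i ∈ posSet n pres ∧ j ∈ posSet n act ∧ v i j = 1 := by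
  have h1 := (h.slots.mem hq).2
  have h2 := (h.units.mem hd).2
  have h3 := h.cut.adj_hold q hq hd
  rw [hi] at h1
  rw [hj] at h2
  rw [unitAdj, hi, hj] at h3
  exact ⟨mem_posSet.2 h1, mem_posSet.2 h2, (hE i j).1 h3⟩

/-- The easy half of Hall's theorem: the units of `T` occupy distinct slots of neighbours of `T`. -/
theorem Program.Matched.card_le_of_saturated (h : Matched n E K M act pres t)
    (hE : ∀ i j : Fin n, E i j ↔ v i j = 1) (hs : Saturated t) {T : Finset (Fin n)}
    (hT : T ⊆ posSet n act) : T.card * K ≤ (nbrIn v (posSet n pres) T).card * M := by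
  rw [← h.slots.card_filter_fin (Finset.filter_subset _ _), ← h.units.card_filter_fin hT]
  choose! f hf hf' using hs
  refine Finset.card_le_card_of_injOn f (fun d hd => ?_) (fun d hd d' hd' he => ?_)
  · obtain ⟨hd, j, hj, hdj⟩ := Finset.mem_filter.1 hd
    have hd := Finset.mem_range.1 hd
    obtain ⟨i, -, hi⟩ := h.slots.exists_fin (hf d hd)
    have := h.edge_of_held hE (hf d hd) (by rwa [hf' d hd]) hi (by rw [hf' d hd]; exact hdj)
    exact Finset.mem_filter.2 ⟨Finset.mem_range.2 (hf d hd), i,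
      Finset.mem_filter.2 ⟨this.1, j, hj, this.2.2⟩, hi⟩
  · have hd := Finset.mem_range.1 (Finset.mem_filter.1 hd).1
    have hd' := Finset.mem_range.1 (Finset.mem_filter.1 hd').1
    rw [← hf' d hd, ← hf' d' hd', he]

theorem share_pos {i j : Fin n} : 0 < share t i j ↔ ∃ q < t.reg rQ, t.idx aAgent q = i ∧
    t.idx aHold q < t.reg rD ∧ t.idx aGood (t.idx aHold q) = j := by
  rw [share, Finset.card_pos]
  constructor
  · rintro ⟨q, hq⟩
    obtain ⟨h1, h2⟩ := Finset.mem_filter.1 hq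
    exact ⟨q, Finset.mem_range.1 h1, h2⟩
  · rintro ⟨q, h1, h2⟩
    exact ⟨q, Finset.mem_filter.2 ⟨Finset.mem_range.2 h1, h2⟩⟩

/-- In a saturated matching the `K` units of `j` correspond to the slots that they occupy, which are
then sorted by agents. -/
theorem Program.Matched.sum_share_good (h : Matched n E K M act pres t) (hs : Saturated t)
    {j : Fin n} (hj : j ∈ posSet n act) : ∑ i : Fin n, share t i j = K := by
  rw [← h.units.card_fiber hj]
  choose! f hf hf' using hs
  have h1 : ((Finset.range (t.reg rD)).filter fun d => t.idx aGood d = j).card =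
      ((Finset.range (t.reg rQ)).filter fun q => t.idx aHold q < t.reg rD ∧
        t.idx aGood (t.idx aHold q) = j).card := by
    refine Finset.card_bij' (fun d _ => f d) (fun q _ => t.idx aHold q) ?_ ?_ ?_ ?_
    · intro d hd
      obtain ⟨hd, hdj⟩ := Finset.mem_filter.1 hd
      have hd := Finset.mem_range.1 hd
      exact Finset.mem_filter.2 ⟨Finset.mem_range.2 (hf d hd), by rwa [hf' d hd],
        by rwa [hf' d hd]⟩
    · intro q hq
      obtain ⟨hq, hqd, hqj⟩ := Finset.mem_filter.1 hq
      exact Finset.mem_filter.2 ⟨Finset.mem_range.2 hqd, hqj⟩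
    · intro d hd
      exact hf' d (Finset.mem_range.1 (Finset.mem_filter.1 hd).1)
    · intro q hq
      obtain ⟨hq, hqd, hqj⟩ := Finset.mem_filter.1 hq
      exact (h.cut.inj q (Finset.mem_range.1 hq) _ (hf _ hqd) hqd (hf' _ hqd).symm).symm
  rw [h1, Finset.card_eq_sum_card_fiberwise (f := t.idx aAgent) (t := Finset.range n) (fun q hq => by
    have := (h.slots.mem (Finset.mem_range.1 (Finset.mem_filter.1 hq).1)).1
    simpa using this), ← Fin.sum_univ_eq_sum_range
      (fun i => (((Finset.range (t.reg rQ)).filter fun q => t.idx aHold q < t.reg rD ∧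
        t.idx aGood (t.idx aHold q) = j).filter fun q => t.idx aAgent q = i).card)]
  refine Finset.sum_congr rfl fun i _ => ?_
  rw [share, Finset.filter_filter]
  congr 1
  ext q
  simp only [Finset.mem_filter]
  tauto

/-- If Hall's condition is tight for `T`, then the slots of its neighbours are occupied by it. -/
theorem Program.Matched.sum_share_agent (h : Matched n E K M act pres t)
    (hE : ∀ i j : Fin n, E i j ↔ v i j = 1) (hs : Saturated t) {T : Finset (Fin n)}
    (hT : T ⊆ posSet n act) (htight : T.card * K = (nbrIn v (posSet n pres) T).card * M)
    {i : Fin n} (hi : i ∈ nbrIn v (posSet n pres) T) : ∑ j ∈ T, share t i j = M := by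
  choose! f hf hf' using hs
  -- The map from units to slots is injective, and by tightness there are as many units of `T` as
  -- slots of its neighbours, so it is onto.
  have himg : ((Finset.range (t.reg rD)).filter fun d => ∃ j ∈ T, t.idx aGood d = j).image f =
      (Finset.range (t.reg rQ)).filter fun q =>
        ∃ i ∈ nbrIn v (posSet n pres) T, t.idx aAgent q = i := by
    refine Finset.eq_of_subset_of_card_le (fun q hq => ?_) ?_
    · obtain ⟨d, hd, rfl⟩ := Finset.mem_image.1 hq
      obtain ⟨hd, j, hj, hdj⟩ := Finset.mem_filter.1 hd
      have hd := Finset.mem_range.1 hd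
      obtain ⟨i, -, hi⟩ := h.slots.exists_fin (hf d hd)
      have := h.edge_of_held hE (hf d hd) (by rwa [hf' d hd]) hi (by rw [hf' d hd]; exact hdj)
      exact Finset.mem_filter.2 ⟨Finset.mem_range.2 (hf d hd), i,
        Finset.mem_filter.2 ⟨this.1, j, hj, this.2.2⟩, hi⟩
    · rw [Finset.card_image_of_injOn, h.units.card_filter_fin hT,
        h.slots.card_filter_fin (Finset.filter_subset _ _), htight]
      intro d hd d' hd' he
      have hd := Finset.mem_range.1 (Finset.mem_filter.1 hd).1
      have hd' := Finset.mem_range.1 (Finset.mem_filter.1 hd').1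
      rw [← hf' d hd, ← hf' d' hd', he]
  have hfull : ∀ q < t.reg rQ, t.idx aAgent q = i → t.idx aHold q < t.reg rD ∧
      ∃ j ∈ T, t.idx aGood (t.idx aHold q) = j := by
    intro q hq hqi
    have : q ∈ (Finset.range (t.reg rQ)).filter fun q =>
        ∃ i ∈ nbrIn v (posSet n pres) T, t.idx aAgent q = i :=
      Finset.mem_filter.2 ⟨Finset.mem_range.2 hq, i, hi, hqi⟩
    rw [← himg] at this
    obtain ⟨d, hd, rfl⟩ := Finset.mem_image.1 this
    obtain ⟨hd, hdj⟩ := Finset.mem_filter.1 hd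
    have hd := Finset.mem_range.1 hd
    rw [hf' d hd]
    exact ⟨hd, hdj⟩
  rw [← h.slots.card_fiber (Finset.mem_filter.1 hi).1]
  rw [Finset.card_eq_sum_card_fiberwise (f := fun q => t.idx aGood (t.idx aHold q))
    (t := T.map Fin.valEmbedding) (fun q hq => by
      obtain ⟨hq, hqi⟩ := Finset.mem_filter.1 hq
      obtain ⟨-, j, hj, he⟩ := hfull q (Finset.mem_range.1 hq) hqi
      exact Finset.mem_coe.2 (Finset.mem_map.2 ⟨j, hj, he.symm⟩)), Finset.sum_map]
  refine Finset.sum_congr rfl fun j _ => ?_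
  rw [share, Finset.filter_filter]
  congr 1
  ext q
  simp only [Finset.mem_filter, Fin.valEmbedding_apply]
  constructor
  · rintro ⟨h1, h2, h3, h4⟩; exact ⟨h1, h2, h4⟩
  · rintro ⟨h1, h2, h4⟩
    exact ⟨h1, h2, (hfull q (Finset.mem_range.1 h1) h2).1, h4⟩

end Matched

/-! ## The first stage: a maximum matching and a minimum vertex cover -/

section FirstStage
open Program

variable {v : Fin n → Fin n → ℝ} {act pres : ℕ → ℕ} {t : Store}

/-- Weak duality: each edge of the matching is charged to a vertex that covers it, and no vertex is
charged twice. -/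
theorem IsMatching.card_le_cover {M : Finset (Fin n × Fin n)} (h : IsMatching v M)
    {G A : Finset (Fin n)} (hc : IsVertexCover v G A) : M.card ≤ G.card + A.card := by
  classical
  have h1 : (M.filter fun e => e.1 ∈ A).card ≤ A.card :=
    Finset.card_le_card_of_injOn Prod.fst (fun e he => (Finset.mem_filter.1 he).2)
      fun e he f hf hef => h.2 e (Finset.mem_filter.1 he).1 f (Finset.mem_filter.1 hf).1 (Or.inl hef)
  have h2 : (M.filter fun e => ¬ e.1 ∈ A).card ≤ G.card :=
    Finset.card_le_card_of_injOn Prod.snd (fun e he => by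
      obtain ⟨he, hA⟩ := Finset.mem_filter.1 he
      exact (hc _ _ (h.1 e he)).resolve_left hA)
      fun e he f hf hef => h.2 e (Finset.mem_filter.1 he).1 f (Finset.mem_filter.1 hf).1 (Or.inr hef)
  have h3 := Finset.card_filter_add_card_filter_not (s := M) (fun e => e.1 ∈ A)
  omega

theorem IsPerfectMatching.card_ge {M : Finset (Fin n × Fin n)} (h : IsPerfectMatching v M) :
    n ≤ M.card := by
  rw [← h.1.card_image_fst]
  have : M.image Prod.fst = Finset.univ := Finset.eq_univ_of_forall fun i => by
    obtain ⟨j, hj⟩ := h.2.1 i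
    exact Finset.mem_image.2 ⟨_, hj, rfl⟩
  rw [this]
  simp

/-- The pairs that are matched when there is one slot per agent and one unit per good. -/
def matchedPairs (n : ℕ) (t : Store) : Finset (Fin n × Fin n) :=
  Finset.univ.filter fun e => 0 < share t e.1 e.2

theorem mem_matchedPairs {i j : Fin n} : (i, j) ∈ matchedPairs n t ↔ ∃ q < t.reg rQ,
    t.idx aAgent q = i ∧ t.idx aHold q < t.reg rD ∧ t.idx aGood (t.idx aHold q) = j := by
  simp only [matchedPairs, Finset.mem_filter, Finset.mem_univ, true_and]
  exact share_pos

theorem Program.Matched.share_eq (h : Matched n E 1 1 act pres t) (hpres : posSet n pres = Finset.univ)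
    (i j : Fin n) : (share t i j : ℝ) = if (i, j) ∈ matchedPairs n t then 1 else 0 := by
  have hle : share t i j ≤ 1 := by
    rw [← h.slots.card_fiber (by rw [hpres]; exact Finset.mem_univ i)]
    refine Finset.card_le_card fun q hq => ?_
    obtain ⟨h1, h2, -⟩ := Finset.mem_filter.1 hq
    exact Finset.mem_filter.2 ⟨h1, h2⟩
  by_cases hm : (i, j) ∈ matchedPairs n t
  · rw [if_pos hm]
    have : 0 < share t i j := by simpa [matchedPairs] using hm
    have : share t i j = 1 := by omega
    rw [this]; simp
  · rw [if_neg hm]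
    have : ¬ 0 < share t i j := by simpa [matchedPairs] using hm
    have : share t i j = 0 := by omega
    rw [this]; simp

theorem Program.Matched.isMatching (h : Matched n E 1 1 act pres t)
    (hE : ∀ i j : Fin n, E i j ↔ v i j = 1) (hact : posSet n act = Finset.univ)
    (hpres : posSet n pres = Finset.univ) : IsMatching v (matchedPairs n t) := by
  refine ⟨?_, ?_⟩
  · rintro ⟨i, j⟩ he
    obtain ⟨q, hq, hi, hd, hj⟩ := mem_matchedPairs.1 he
    exact (h.edge_of_held hE hq hd hi hj).2.2
  · rintro ⟨i, j⟩ he ⟨i', j'⟩ he' hor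
    obtain ⟨q, hq, hi, hd, hj⟩ := mem_matchedPairs.1 he
    obtain ⟨q', hq', hi', hd', hj'⟩ := mem_matchedPairs.1 he'
    have hqq : q = q' := by
      rcases hor with hor | hor
      · have hor : i = i' := hor
        subst hor
        have := (h.slots.card_fiber (j := i) (by rw [hpres]; exact Finset.mem_univ i)).le
        exact Finset.card_le_one.1 this q (by simp [hq, hi]) q' (by simp [hq', hi'])
      · have hor : j = j' := hor
        subst hor
        have := (h.units.card_fiber (j := j) (by rw [hact]; exact Finset.mem_univ j)).le
        have := Finset.card_le_one.1 this (t.idx aHold q) (by simp [hd, hj]) (t.idx aHold q')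
          (by simp [hd', hj'])
        exact h.cut.inj q hq q' hq' hd this
    subst hqq
    have e1 : i = i' := Fin.ext (hi.symm.trans hi')
    have e2 : j = j' := Fin.ext (hj.symm.trans hj')
    rw [e1, e2]

/-- The outcome of the first stage. -/
theorem Program.Matched.firstStage (h : Matched n E 1 1 act pres t)
    (hE : ∀ i j : Fin n, E i j ↔ v i j = 1) (hact : posSet n act = Finset.univ)
    (hpres : posSet n pres = Finset.univ) {T : Finset (Fin n)} (hT : IsCutSet n E act t T) :
    (T = Finset.univ ∧ IsPerfectMatching v (matchedPairs n t)) ∨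
    (¬ ∃ M', IsPerfectMatching v M') ∧ IsMinVertexCover v Tᶜ (nbrIn v Finset.univ T) ∧
      IsMaxMatchingIn v (nbrIn v Finset.univ T) Tᶜᶜ
        ((matchedPairs n t).filter fun e => e.2 ∈ T) := by
  classical
  have hM := h.isMatching hE hact hpres
  have hslot : ∀ i : Fin n, ∃ q < t.reg rQ, t.idx aAgent q = i := by
    intro i
    have := h.slots.card_fiber (j := i) (by rw [hpres]; exact Finset.mem_univ i)
    obtain ⟨q, hq⟩ := Finset.card_pos.1 (by rw [this]; exact one_pos)
    obtain ⟨h1, h2⟩ := Finset.mem_filter.1 hq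
    exact ⟨q, Finset.mem_range.1 h1, h2⟩
  have hunit : ∀ j : Fin n, ∃ d < t.reg rD, t.idx aGood d = j := by
    intro j
    have := h.units.card_fiber (j := j) (by rw [hact]; exact Finset.mem_univ j)
    obtain ⟨q, hq⟩ := Finset.card_pos.1 (by rw [this]; exact one_pos)
    obtain ⟨h1, h2⟩ := Finset.mem_filter.1 hq
    exact ⟨q, Finset.mem_range.1 h1, h2⟩
  have hpair : ∀ {d q}, d < t.reg rD → q < t.reg rQ → t.idx aHold q = d → ∀ {j : Fin n},
      t.idx aGood d = j → ∃ i : Fin n, (i, j) ∈ matchedPairs n t := by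
    intro d q hd hq he j hj
    obtain ⟨i, -, hi⟩ := h.slots.exists_fin hq
    exact ⟨i, mem_matchedPairs.2 ⟨q, hq, hi, by rwa [he], by rwa [he]⟩⟩
  rcases h.saturated_or with ⟨hs, -⟩ | ⟨⟨d₀, hd₀, hf₀⟩, -⟩
  · left
    have hcard : n ≤ (matchedPairs n t).card := by
      have : (matchedPairs n t).image Prod.snd = Finset.univ :=
        Finset.eq_univ_of_forall fun j => by
          obtain ⟨d, hd, hj⟩ := hunit j
          obtain ⟨q, hq, he⟩ := hs d hd
          obtain ⟨i, hi⟩ := hpair hd hq he hj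
          exact Finset.mem_image.2 ⟨_, hi, rfl⟩
      rw [← hM.card_image_snd, this]
      simp
    have hp := hM.isPerfectMatching hcard
    refine ⟨Finset.eq_univ_of_forall fun j => ?_, hp⟩
    refine (hT j).2 ⟨by simpa using hact.ge (Finset.mem_univ j), fun q hq _ => ?_⟩
    -- A perfect matching fills all slots, so all of them lie above the gap and the cut contains
    -- every good.
    refine h.cut.all_high (fun q hq => ?_) q hq
    obtain ⟨i, hi, hqi⟩ := h.slots.exists_fin hq
    obtain ⟨j', hj'⟩ := hp.2.1 i
    obtain ⟨q', hq', hi', hd', -⟩ := mem_matchedPairs.1 hj'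
    have := (h.slots.card_fiber hi).le
    have := Finset.card_le_one.1 this q (by simp [hq, hqi]) q' (by simp [hq', hi'])
    rwa [this]
  · right
    set A₂ := nbrIn v Finset.univ T with hA₂
    have hcov : IsVertexCover v Tᶜ A₂ := fun i j hij => by
      by_cases hj : j ∈ T
      · exact Or.inl (Finset.mem_filter.2 ⟨Finset.mem_univ _, j, hj, hij⟩)
      · exact Or.inr (by simpa using hj)
    -- Every agent of `A₂` is matched to a good of `T`, by `held_of_nbr`.
    have h1 : A₂.card ≤ ((matchedPairs n t).filter fun e => e.2 ∈ T).card := by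
      refine (Finset.card_le_card (t := ((matchedPairs n t).filter fun e => e.2 ∈ T).image Prod.fst)
        fun i hi => ?_).trans Finset.card_image_le
      obtain ⟨q, hq, hqi⟩ := hslot i
      obtain ⟨hd, j, hj, he⟩ := h.held_of_nbr hE hT hq ⟨i, by rwa [hpres], hqi⟩
      exact Finset.mem_image.2 ⟨(i, j), Finset.mem_filter.2
        ⟨mem_matchedPairs.2 ⟨q, hq, hqi, hd, he⟩, hj⟩, rfl⟩
    -- A free unit belongs to `T`, so every good outside `T` is matched. Together with `h1`, the
    -- matching is at least as large as the cover, so the cover is minimum by weak duality.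
    have h2 : Tᶜ.card ≤ ((matchedPairs n t).filter fun e => ¬ e.2 ∈ T).card := by
      refine (Finset.card_le_card
        (t := ((matchedPairs n t).filter fun e => ¬ e.2 ∈ T).image Prod.snd)
        fun j hj => ?_).trans Finset.card_image_le
      have hj : j ∉ T := by simpa using hj
      obtain ⟨d, hd, hdj⟩ := hunit j
      have : ¬ IsFree (t.reg rQ) (t.idx aHold) d := fun hf => by
        obtain ⟨j', hj', he⟩ := h.free_mem_cut hT hd hf
        have : j = j' := Fin.ext (hdj.symm.trans he)
        exact hj (this ▸ hj')
      unfold IsFree at this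
      push Not at this
      obtain ⟨q, hq, he⟩ := this
      obtain ⟨i, hi⟩ := hpair hd hq he hdj
      exact Finset.mem_image.2 ⟨(i, j), Finset.mem_filter.2 ⟨hi, hj⟩, rfl⟩
    have h3 := Finset.card_filter_add_card_filter_not (s := matchedPairs n t) (fun e => e.2 ∈ T)
    -- With a free unit `|A₂| < |T|`, so the cover has fewer than `n` vertices and no matching is
    -- perfect.
    have h4 := h.card_lt_of_free hE hT hd₀ hf₀
    rw [hpres, ← hA₂, mul_one, mul_one] at h4
    have h5 := Finset.card_add_card_compl T
    rw [Fintype.card_fin] at h5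
    refine ⟨?_, ⟨hcov, fun G' A' hc' => ?_⟩, ⟨⟨⟨fun e he => hM.1 e (Finset.mem_filter.1 he).1,
      fun e he f hf => hM.2 e (Finset.mem_filter.1 he).1 f (Finset.mem_filter.1 hf).1⟩, ?_⟩, ?_⟩⟩
    · rintro ⟨M', hM'⟩
      have := hM'.1.card_le_cover hcov
      have := hM'.card_ge
      omega
    · have := hM.card_le_cover hc'
      omega
    · rintro ⟨i, j⟩ he
      obtain ⟨he, hj⟩ := Finset.mem_filter.1 he
      exact ⟨Finset.mem_filter.2 ⟨Finset.mem_univ _, j, hj, hM.1 _ he⟩, by simpa using hj⟩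
    · intro M' hM'
      refine le_trans ?_ h1
      rw [← hM'.1.card_image_fst]
      refine Finset.card_le_card fun i hi => ?_
      obtain ⟨e, he, rfl⟩ := Finset.mem_image.1 hi
      exact (hM'.2 e he).1

end FirstStage

/-! ## The search for a tight set -/

section Newton
open Program Classical

variable {v : Fin n → Fin n → ℝ}

/-- `T` has the least ratio of neighbours to goods among the sets of goods in `G`. -/
def IsLeastRatio (v : Fin n → Fin n → ℝ) (A G T : Finset (Fin n)) : Prop :=
  ∀ T' ⊆ G, T'.card * (nbrIn v A T).card ≤ (nbrIn v A T').card * T.card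

/-- The number of fractions that are smaller than the ratio of `T`. -/
def ratioRank (v : Fin n → Fin n → ℝ) (A T : Finset (Fin n)) : ℕ :=
  ((Finset.range (n + 1) ×ˢ Finset.Icc 1 n).filter fun e : ℕ × ℕ =>
    e.1 * T.card < (nbrIn v A T).card * e.2).card

theorem ratioRank_le (A T : Finset (Fin n)) : ratioRank v A T ≤ (n + 1) * n := by
  refine (Finset.card_filter_le _ _).trans ?_
  simp

/-- Every fraction below the ratio of `T'` is below that of `T`, and the ratio of `T'` itself is
counted for `T` only. This rank makes the search end after polynomially many improvements. -/
theorem ratioRank_lt {A T T' : Finset (Fin n)}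
    (h : (nbrIn v A T').card * T.card < T'.card * (nbrIn v A T).card) :
    ratioRank v A T' < ratioRank v A T := by
  have hT' : 0 < T'.card := Nat.pos_of_ne_zero fun h0 => by simp [h0] at h
  have hle : ∀ X : Finset (Fin n), X.card ≤ n := fun X => by
    simpa using Finset.card_le_univ X
  refine Finset.card_lt_card ((Finset.ssubset_iff_of_subset fun e he => ?_).2
    ⟨((nbrIn v A T').card, T'.card), ?_, ?_⟩)
  · obtain ⟨h1, h2⟩ := Finset.mem_filter.1 he
    refine Finset.mem_filter.2 ⟨h1, ?_⟩
    have he2 : 0 < e.2 := (Finset.mem_Icc.1 (Finset.mem_product.1 h1).2).1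
    refine lt_of_mul_lt_mul_right (a := T'.card) ?_ (Nat.zero_le _)
    calc e.1 * T.card * T'.card = (e.1 * T'.card) * T.card := by ring
      _ ≤ ((nbrIn v A T').card * e.2) * T.card := Nat.mul_le_mul_right _ h2.le
      _ = ((nbrIn v A T').card * T.card) * e.2 := by ring
      _ < (T'.card * (nbrIn v A T).card) * e.2 := Nat.mul_lt_mul_of_pos_right h he2
      _ = (nbrIn v A T).card * e.2 * T'.card := by ring
  · refine Finset.mem_filter.2 ⟨Finset.mem_product.2 ⟨?_, ?_⟩, ?_⟩
    · exact Finset.mem_range.2 (Nat.lt_succ_of_le (hle _))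
    · exact Finset.mem_Icc.2 ⟨hT', hle _⟩
    · simpa [mul_comm T'.card] using h
  · simp

theorem countNbr_eq (hE : ∀ i j : Fin n, E i j ↔ v i j = 1) (pres tight : ℕ → ℕ) :
    ((Finset.range n).filter (IsNbr n E pres tight)).card =
      (nbrIn v (posSet n pres) (posSet n tight)).card := by
  refine card_filter_range_eq fun i => ?_
  simp only [Finset.mem_filter, mem_posSet, IsNbr]
  refine and_congr_right fun _ => ⟨?_, ?_⟩
  · rintro ⟨j, hj, hij⟩; exact ⟨j, j.2, hj, (hE i j).2 hij⟩
  · rintro ⟨j, hjn, hj, hij⟩; exact ⟨⟨j, hjn⟩, hj, (hE i ⟨j, hjn⟩).1 hij⟩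

/-- The state after counting and matching for the current candidate. -/
structure Counted (n : ℕ) (E : ℕ → ℕ → Prop) (v : Fin n → Fin n → ℝ) (s t : Store) : Prop where
  base : Base n E t
  matched : Matched n E (nbrIn v (posSet n (s.idx aPres)) (posSet n (s.idx aTight))).card
    (posSet n (s.idx aTight)).card (s.idx aAct) (s.idx aPres) t
  numK : t.num 6 0 0 = (nbrIn v (posSet n (s.idx aPres)) (posSet n (s.idx aTight))).card
  numM : t.num 7 0 0 = (posSet n (s.idx aTight)).card

theorem counted_spec (hE : ∀ i j : Fin n, E i j ↔ v i j = 1) (hb : Base n E s) :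
    Counted n E v s (matching.den (countAgents.den (countGoods.den s))) := by
  have hle : ∀ X : Finset (Fin n), X.card ≤ n := fun X => by
    simpa using Finset.card_le_univ X
  obtain ⟨a1, a2⟩ := countGoods_spec hb
  rw [card_filter_range_eq (X := posSet n (s.idx aTight)) fun j => mem_posSet] at a1 a2
  have hb1 : Base n E (countGoods.den s) := hb.den (by decide)
  have i1 : (countGoods.den s).idx = s.idx := by
    funext a
    exact den_idx _ (by simp [countGoods, block, writesIdx, Program.for, Program.when]) _
  generalize countGoods.den s = s1 at *
  obtain ⟨b1, b2⟩ := countAgents_spec hb1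
  rw [countNbr_eq hE, i1] at b1 b2
  have hb2 : Base n E (countAgents.den s1) := hb1.den (by decide)
  have i2 : (countAgents.den s1).idx = s1.idx := by
    funext a
    exact den_idx _ (by simp [countAgents, testNbr, block, writesIdx, Program.for, Program.when]) _
  have m2 : (countAgents.den s1).reg rM = s1.reg rM := den_reg _ (by decide) _
  have m3 : (countAgents.den s1).num 7 = s1.num 7 := den_num _ (by decide) _
  rw [← m2] at a1
  rw [← m3] at a2
  generalize countAgents.den s1 = s2 at *
  have hm := matching_spec hb2 (by rw [b1]; exact hle _) (by rw [a1]; exact hle _)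
  rw [a1, b1, i2, i1] at hm
  refine ⟨hb2.den (by decide), hm, ?_, ?_⟩
  · rw [den_num _ (by decide), b2]
  · rw [den_num _ (by decide), a2]

theorem Program.Matched.slots_le {K M : ℕ} {act pres : ℕ → ℕ} {t : Store}
    (h : Matched n E K M act pres t) (hM : M ≤ n) : t.reg rQ ≤ n * n :=
  h.slots.le hM

/-- One step of the search keeps a set of least ratio and otherwise lowers the ratio. -/
theorem improve_spec (hE : ∀ i j : Fin n, E i j ↔ v i j = 1) (hb : Base n E s)
    (hsub : posSet n (s.idx aTight) ⊆ posSet n (s.idx aAct)) :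
    posSet n ((improve.den s).idx aTight) ⊆ posSet n (s.idx aAct) ∧
    ((posSet n (s.idx aTight)).Nonempty → (posSet n ((improve.den s).idx aTight)).Nonempty) ∧
    (posSet n ((improve.den s).idx aTight) = posSet n (s.idx aTight) ∧
        IsLeastRatio v (posSet n (s.idx aPres)) (posSet n (s.idx aAct)) (posSet n (s.idx aTight)) ∨
      ¬ IsLeastRatio v (posSet n (s.idx aPres)) (posSet n (s.idx aAct)) (posSet n (s.idx aTight)) ∧
        ratioRank v (posSet n (s.idx aPres)) (posSet n ((improve.den s).idx aTight)) <
          ratioRank v (posSet n (s.idx aPres)) (posSet n (s.idx aTight))) := by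
  have hle : ∀ X : Finset (Fin n), X.card ≤ n := fun X => by
    simpa using Finset.card_le_univ X
  have hc := counted_spec hE hb
  have hden : improve.den s = (Program.when (.regLt rCount rD) cut).den (countHeld.den
    (matching.den (countAgents.den (countGoods.den s)))) := rfl
  have k1 : (matching.den (countAgents.den (countGoods.den s))).idx aTight = s.idx aTight := by
    rw [den_idx _ (by decide), den_idx _ (by decide), den_idx _ (by decide)]
  have k2 : (matching.den (countAgents.den (countGoods.den s))).idx aAct = s.idx aAct := by
    rw [den_idx _ (by decide), den_idx _ (by decide), den_idx _ (by decide)]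
  rw [hden]
  generalize matching.den (countAgents.den (countGoods.den s)) = t at *
  have hQ := hc.matched.slots_le (hle _)
  have hcount := countHeld_spec hc.base hQ
  have hb' : Base n E (countHeld.den t) := hc.base.den (by decide)
  have g1 : (countHeld.den t).idx = t.idx := by
    funext a
    exact den_idx _ (by simp [countHeld, block, writesIdx, Program.for, Program.when]) _
  have g2 : (countHeld.den t).reg rQ = t.reg rQ := den_reg _ (by decide) _
  have g3 : (countHeld.den t).reg rD = t.reg rD := den_reg _ (by decide) _
  have g4 : (countHeld.den t).reg rGap = t.reg rGap := den_reg _ (by decide) _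
  have hcut := cut_spec hb' (by rwa [g2])
  rw [g1, g2, g4, k2] at hcut
  simp only [den_when, Test.Holds, hcount, g3]
  rcases hc.matched.saturated_or with ⟨hs, hn⟩ | ⟨⟨d, hd, hf⟩, hlt⟩
  · rw [if_neg hn, g1, k1]
    refine ⟨hsub, id, Or.inl ⟨rfl, fun T' hT' => ?_⟩⟩
    -- With `|N(T)|` units per good and `|T|` slots per agent, Hall's condition says that the ratio
    -- of `T` is least.
    exact hc.matched.card_le_of_saturated hE hs hT'
  · rw [if_pos hlt]
    set T' := posSet n ((cut.den (countHeld.den t)).idx aTight) with hT'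
    have hTcut : IsCutSet n E (s.idx aAct) t T' := fun j => by
      rw [hT', mem_posSet, hcut j j.2]
    have hT'sub : T' ⊆ posSet n (s.idx aAct) := fun j hj => mem_posSet.2 ((hTcut j).1 hj).1
    -- The cut violates Hall's condition, that is, its ratio is smaller than that of the candidate.
    -- Strictness also shows that it is nonempty.
    have hlt := hc.matched.card_lt_of_free hE hTcut hd hf
    refine ⟨hT'sub, fun _ => ?_, Or.inr ⟨fun hleast => ?_, ratioRank_lt hlt⟩⟩
    · rw [Finset.nonempty_iff_ne_empty]
      intro h0
      rw [h0] at hlt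
      simp at hlt
    · have := hleast T' hT'sub
      omega

/-- A step from a candidate that is not optimal lowers its rank, which is at most `(n + 1) * n` at
the start, so `n² (n² + 1)` steps suffice. -/
theorem search_spec (hE : ∀ i j : Fin n, E i j ↔ v i j = 1) (hb : Base n E s)
    (heq : posSet n (s.idx aTight) = posSet n (s.idx aAct)) :
    let t := (Program.for rNewton rBig improve).den s
    posSet n (t.idx aTight) ⊆ posSet n (s.idx aAct) ∧
    ((posSet n (s.idx aAct)).Nonempty → (posSet n (t.idx aTight)).Nonempty) ∧
    IsLeastRatio v (posSet n (s.idx aPres)) (posSet n (s.idx aAct)) (posSet n (t.idx aTight)) := by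
  intro t
  have key := for_induction (r := rNewton) (e := rBig) (P := improve)
    (fun k t => posSet n (t.idx aTight) ⊆ posSet n (s.idx aAct) ∧
      ((posSet n (s.idx aAct)).Nonempty → (posSet n (t.idx aTight)).Nonempty) ∧
      (IsLeastRatio v (posSet n (s.idx aPres)) (posSet n (s.idx aAct)) (posSet n (t.idx aTight)) ∨
        k + ratioRank v (posSet n (s.idx aPres)) (posSet n (t.idx aTight)) ≤ (n + 1) * n)) s
    (by decide) (by decide) (by
      simp only [Store.idx_putReg, heq]
      exact ⟨subset_rfl, id, Or.inr (by simpa using ratioRank_le _ _)⟩) (by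
      rintro k hk t hr hf ⟨h1, h2, h3⟩
      have hbt : Base n E t := hb.frame (by decide) (by decide) hf
      have f1 : t.idx aAct = s.idx aAct := hf.idx (by decide)
      have f2 : t.idx aPres = s.idx aPres := hf.idx (by decide)
      have hspec := improve_spec hE hbt (by rwa [f1])
      rw [f1, f2] at hspec
      obtain ⟨a1, a2, a3⟩ := hspec
      simp only [Store.idx_putReg]
      refine ⟨a1, fun hne => a2 (h2 hne), ?_⟩
      rcases a3 with ⟨a3, a4⟩ | ⟨a3, a4⟩
      · left; rwa [a3]
      · right
        have := h3.resolve_left a3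
        omega)
  refine ⟨key.1, key.2.1, key.2.2.elim id fun hle => ?_⟩
  by_contra hnot
  rw [hb.big] at hle
  unfold IsLeastRatio at hnot
  push Not at hnot
  obtain ⟨T', -, hT'⟩ := hnot
  -- A set of smaller ratio would make the rank positive, but after all the steps the invariant
  -- leaves no room for a positive rank.
  have hrank := ratioRank_lt hT'
  have hn : 0 < n := by
    by_contra h0
    have h0 : n = 0 := by omega
    subst h0
    have : T'.card = 0 := by simp [Finset.eq_empty_of_isEmpty T']
    simp [this] at hT'
  have : (n + 1) * n ≤ n * n * (n * n + 1) := by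
    have h1 : n ≤ n * n := Nat.le_mul_self n
    calc (n + 1) * n ≤ (n * n + 1) * (n * n) := Nat.mul_le_mul (by omega) h1
      _ = n * n * (n * n + 1) := by ring
  have hle : n * n * (n * n + 1) + ratioRank v (posSet n (s.idx aPres)) (posSet n (t.idx aTight)) ≤
    (n + 1) * n := hle
  omega

end Newton

/-! ## The simulation of the simplified DPSV algorithm -/

section Simulation
open Program Classical

variable {v : Fin n → Fin n → ℝ}

/-- The store `t` arises from `s` by freezing the set `S` of goods at price `K / M`, and selling it
according to the matching in the store `w`. -/
structure Froze (n : ℕ) (E : ℕ → ℕ → Prop) (v : Fin n → Fin n → ℝ) (K M : ℕ) (S : Finset (Fin n))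
    (s w t : Store) : Prop where
  base : Base n E t
  matched : Matched n E K M (s.idx aAct) (s.idx aPres) w
  act : posSet n (t.idx aAct) = posSet n (s.idx aAct) \ S
  pres : posSet n (t.idx aPres) = posSet n (s.idx aPres) \ nbrIn v (posSet n (s.idx aPres)) S
  alloc : ∀ i j : Fin n, t.num 3 i j = if j ∈ S then (share w i j : ℝ) / K else s.num 3 i j
  missing : ∀ i : Fin n, t.num 8 i 0 =
    if i ∈ nbrIn v (posSet n (s.idx aPres)) S then ((K : ℝ) - M) / K else s.num 8 i 0
  zero : t.num 12 = s.num 12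

theorem isNbr_iff (hE : ∀ i j : Fin n, E i j ↔ v i j = 1) (pres tight : ℕ → ℕ) (i : Fin n) :
    IsNbr n E pres tight i ↔ i ∈ nbrIn v (posSet n pres) (posSet n tight) := by
  simp only [Finset.mem_filter, mem_posSet, IsNbr]
  refine and_congr_right fun _ => ⟨?_, ?_⟩
  · rintro ⟨j, hjn, hj, hij⟩; exact ⟨⟨j, hjn⟩, hj, (hE i ⟨j, hjn⟩).1 hij⟩
  · rintro ⟨j, hj, hij⟩; exact ⟨j, j.2, hj, (hE i j).2 hij⟩

theorem sell_spec (hE : ∀ i j : Fin n, E i j ↔ v i j = 1) {K M : ℕ} {w : Store}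
    (hb : Base n E w) (hm : Matched n E K M (w.idx aAct) (w.idx aPres) w) (hM : M ≤ n)
    (h6 : w.num 6 0 0 = K) (h7 : w.num 7 0 0 = M) :
    Froze n E v K M (posSet n (w.idx aTight)) w w (sellGoods.den (removeAgents.den w)) := by
  obtain ⟨a1, a2⟩ := removeAgents_spec hb
  have hb1 : Base n E (removeAgents.den w) := hb.den (by decide)
  have r1 : (removeAgents.den w).reg rQ = w.reg rQ := den_reg _ (by decide) _
  have r2 : (removeAgents.den w).reg rD = w.reg rD := den_reg _ (by decide) _
  have i0 : (removeAgents.den w).idx aAct = w.idx aAct := den_idx _ (by decide) _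
  have i2 : (removeAgents.den w).idx aTight = w.idx aTight := den_idx _ (by decide) _
  have i3 : (removeAgents.den w).idx aGood = w.idx aGood := den_idx _ (by decide) _
  have i4 : (removeAgents.den w).idx aAgent = w.idx aAgent := den_idx _ (by decide) _
  have i5 : (removeAgents.den w).idx aHold = w.idx aHold := den_idx _ (by decide) _
  have n6 : (removeAgents.den w).num 6 = w.num 6 := den_num _ (by decide) _
  have n3 : (removeAgents.den w).num 3 = w.num 3 := den_num _ (by decide) _
  have hsh : ∀ i j, share (removeAgents.den w) i j = share w i j := fun i j => by
    simp only [share, r1, r2, i3, i4, i5]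
  have n12 : (sellGoods.den (removeAgents.den w)).num 12 = w.num 12 := by
    rw [den_num _ (by decide), den_num _ (by decide)]
  generalize removeAgents.den w = w1 at *
  obtain ⟨b1, b2⟩ := sellGoods_spec hb1 (by rw [r1]; exact hm.slots_le hM)
  simp only [i2, i0, hsh, n6, n3, h6] at b1 b2
  have c1 : (sellGoods.den w1).idx aPres = w1.idx aPres := den_idx _ (by decide) _
  have c2 : (sellGoods.den w1).num 8 = w1.num 8 := den_num _ (by decide) _
  refine ⟨hb1.den (by decide), hm, ?_, ?_, fun i j => ?_, fun i => ?_, n12⟩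
  · ext j
    rw [mem_posSet, b1 j j.2, Finset.mem_sdiff, mem_posSet, mem_posSet]
    split_ifs with h <;> simp [h]
  · ext i
    rw [mem_posSet, c1, a1 i i.2, Finset.mem_sdiff, ← isNbr_iff hE, mem_posSet]
    split_ifs with h <;> simp [h]
  · rw [b2 i i.2 j j.2]
    simp only [mem_posSet]
  · rw [c2, a2 i i.2, h6, h7]
    simp only [isNbr_iff hE]

theorem freezeTight_spec (hE : ∀ i j : Fin n, E i j ↔ v i j = 1) (hb : Base n E s) :
    ∃ S w, S ⊆ posSet n (s.idx aAct) ∧ ((posSet n (s.idx aAct)).Nonempty → S.Nonempty) ∧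
      IsLeastRatio v (posSet n (s.idx aPres)) (posSet n (s.idx aAct)) S ∧
      Froze n E v (nbrIn v (posSet n (s.idx aPres)) S).card S.card S s w (freezeTight.den s) ∧
      ∀ j : Fin n, (freezeTight.den s).num 4 j 0 = if j ∈ S then
        ((nbrIn v (posSet n (s.idx aPres)) S).card : ℝ) / S.card else s.num 4 j 0 := by
  have hden : freezeTight.den s = setPrices.den (sellGoods.den (removeAgents.den (matching.den
    (countAgents.den (countGoods.den ((Program.for rNewton rBig improve).den
      (copyActive.den s))))))) := rfl
  have h1 := copyActive_spec hb
  have hb1 : Base n E (copyActive.den s) := hb.den (by decide)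
  have p1 : (copyActive.den s).idx aAct = s.idx aAct := den_idx _ (by decide) _
  have p2 : (copyActive.den s).idx aPres = s.idx aPres := den_idx _ (by decide) _
  have p3 : (copyActive.den s).num = s.num := by
    funext a
    exact den_num _ (by simp [copyActive, block, writesNum, Program.for]) _
  rw [hden]
  generalize copyActive.den s = s1 at *
  have h2 := search_spec hE hb1 (by
    ext j
    rw [mem_posSet, mem_posSet, h1 j j.2, p1])
  have hb2 : Base n E ((Program.for rNewton rBig improve).den s1) := hb1.den (by decide +kernel)
  have q1 : ((Program.for rNewton rBig improve).den s1).idx aAct = s1.idx aAct :=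
    den_idx _ (by decide +kernel) _
  have q2 : ((Program.for rNewton rBig improve).den s1).idx aPres = s1.idx aPres :=
    den_idx _ (by decide +kernel) _
  have q3 : ((Program.for rNewton rBig improve).den s1).num 3 = s1.num 3 :=
    den_num _ (by decide +kernel) _
  have q4 : ((Program.for rNewton rBig improve).den s1).num 4 = s1.num 4 :=
    den_num _ (by decide +kernel) _
  have q8 : ((Program.for rNewton rBig improve).den s1).num 8 = s1.num 8 :=
    den_num _ (by decide +kernel) _
  have q12 : ((Program.for rNewton rBig improve).den s1).num 12 = s1.num 12 :=
    den_num _ (by decide +kernel) _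
  simp only at h2
  generalize (Program.for rNewton rBig improve).den s1 = s2 at *
  rw [p1] at h2 q1
  rw [p2] at h2 q2
  rw [p3] at q3 q4 q8 q12
  have h3 := counted_spec hE hb2
  have k0 : (matching.den (countAgents.den (countGoods.den s2))).idx aAct = s.idx aAct := by
    rw [den_idx _ (by decide), den_idx _ (by decide), den_idx _ (by decide), q1]
  have k1 : (matching.den (countAgents.den (countGoods.den s2))).idx aPres = s.idx aPres := by
    rw [den_idx _ (by decide), den_idx _ (by decide), den_idx _ (by decide), q2]
  have k2 : (matching.den (countAgents.den (countGoods.den s2))).idx aTight = s2.idx aTight := by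
    rw [den_idx _ (by decide), den_idx _ (by decide), den_idx _ (by decide)]
  have k3 : (matching.den (countAgents.den (countGoods.den s2))).num 3 = s.num 3 := by
    rw [den_num _ (by decide), den_num _ (by decide), den_num _ (by decide), q3]
  have k4 : (matching.den (countAgents.den (countGoods.den s2))).num 4 = s.num 4 := by
    rw [den_num _ (by decide), den_num _ (by decide), den_num _ (by decide), q4]
  have k8 : (matching.den (countAgents.den (countGoods.den s2))).num 8 = s.num 8 := by
    rw [den_num _ (by decide), den_num _ (by decide), den_num _ (by decide), q8]
  have k12 : (matching.den (countAgents.den (countGoods.den s2))).num 12 = s.num 12 := by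
    rw [den_num _ (by decide), den_num _ (by decide), den_num _ (by decide), q12]
  generalize matching.den (countAgents.den (countGoods.den s2)) = w at *
  obtain ⟨hb3, hm, h6, h7⟩ := h3
  rw [q1, q2] at hm
  rw [q2] at h6
  have h4 := sell_spec hE hb3 (by rw [k0, k1]; exact hm)
    (by simpa using Finset.card_le_univ (posSet n (s2.idx aTight))) h6 h7
  have t2 : (sellGoods.den (removeAgents.den w)).idx aTight = w.idx aTight := by
    rw [den_idx _ (by decide), den_idx _ (by decide)]
  have t4 : (sellGoods.den (removeAgents.den w)).num 4 = w.num 4 := by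
    rw [den_num _ (by decide), den_num _ (by decide)]
  have t6 : (sellGoods.den (removeAgents.den w)).num 6 = w.num 6 := by
    rw [den_num _ (by decide), den_num _ (by decide)]
  have t7 : (sellGoods.den (removeAgents.den w)).num 7 = w.num 7 := by
    rw [den_num _ (by decide), den_num _ (by decide)]
  generalize sellGoods.den (removeAgents.den w) = z at *
  have h5 := setPrices_spec h4.base
  refine ⟨posSet n (s2.idx aTight), w, h2.1, h2.2.1, h2.2.2, ⟨h4.base.den (by decide), hm, ?_, ?_,
    fun i j => ?_, fun i => ?_, ?_⟩, fun j => ?_⟩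
  · rw [den_idx _ (by decide), h4.act, k0, k2]
  · rw [den_idx _ (by decide), h4.pres, k1, k2]
  · rw [den_num _ (by decide), h4.alloc, k2, k3]
  · rw [den_num _ (by decide), h4.missing, k1, k2, k8]
  · rw [den_num _ (by decide), h4.zero, k12]
  · rw [h5 j j.2, t2, k2, t6, t7, h6, h7, t4, k4]
    simp only [mem_posSet]

/-- The store `t` represents the state `ps` of the simplified DPSV algorithm; the columns outside
`G₁` of the allocation are `x₀`. -/
structure Represents (E : ℕ → ℕ → Prop) (A₂ G₁ : Finset (Fin n)) (x₀ : Fin n → Fin n → ℝ)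
    (ps : PriceState n) (t : Store) : Prop where
  base : Base n E t
  zero : t.num 12 0 0 = 0
  active : posSet n (t.idx aAct) = ps.active
  agents : posSet n (t.idx aPres) = ps.agents
  alloc : ∀ i j : Fin n, t.num 3 i j = if j ∈ G₁ then ps.alloc i j else x₀ i j
  -- The rising common price of the active goods is not stored; a price is written only when its
  -- good is frozen.
  price : ∀ j : Fin n, j ∉ ps.active → t.num 4 j 0 = ps.price j
  missing : ∀ i : Fin n, t.num 8 i 0 = if i ∈ A₂ then 0 else 1 - ∑ j, ps.alloc i j

variable {A₂ G₁ : Finset (Fin n)} {x₀ : Fin n → Fin n → ℝ} {ps : PriceState n} {t : Store}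

/-- The outer loop always runs `n` times, so the rounds after the last freezing must have no effect.
-/
theorem Represents.freezeTight_of_empty (hE : ∀ i j : Fin n, E i j ↔ v i j = 1)
    (h : Represents E A₂ G₁ x₀ ps t) (ha : ps.active = ∅) :
    Represents E A₂ G₁ x₀ ps (freezeTight.den t) := by
  obtain ⟨S, w, hS, -, -, hf, hp⟩ := freezeTight_spec hE h.base
  rw [h.active, ha, Finset.subset_empty] at hS
  subst hS
  have hnbr : nbrIn v (posSet n (t.idx aPres)) ∅ = ∅ := by simp [nbrIn]
  rw [hnbr] at hf
  refine ⟨hf.base, by rw [hf.zero, h.zero], ?_, ?_, fun i j => ?_, fun j hj => ?_, fun i => ?_⟩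
  · rw [hf.act, h.active, ha, Finset.sdiff_empty]
  · rw [hf.pres, h.agents]
    simp [nbrIn]
  · rw [hf.alloc, if_neg (by simp), h.alloc]
  · rw [hp, if_neg (by simp), h.price j hj]
  · rw [hf.missing, if_neg (by simp [nbrIn]), h.missing]

/-- At the price `K / M`, with `K = |N(S)|` and `M = |S|`, the set `S` of least ratio is tight and
no other set is too expensive. The saturated matching certifies the latter and, in units of size `1
/ K`, is the sale. -/
theorem Represents.freezeTight_of_nonempty (hE : ∀ i j : Fin n, E i j ↔ v i j = 1)
    (hs : ps.Sound v A₂ᶜ G₁) (h : Represents E A₂ G₁ x₀ ps t) (ha : ps.active.Nonempty) :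
    ∃ δ S y, ps.GoesTight v δ S ∧ ps.Clears v δ S y ∧
      Represents E A₂ G₁ x₀ (ps.freeze v δ S y) (freezeTight.den t) := by
  obtain ⟨S, w, hS, hne, hleast, hf, hp⟩ := freezeTight_spec hE h.base
  rw [h.active] at hS hne hleast
  rw [h.agents] at hleast hf hp
  replace hne := hne ha
  obtain ⟨c, hc1, hc⟩ := hs.active_price
  have hsum : ∀ T ⊆ ps.active, ∀ δ : ℝ, ∑ j ∈ T, ps.raised δ j = T.card * (c + δ) := by
    intro T hT δ
    rw [Finset.sum_congr rfl (g := fun _ => c + δ) fun j hj => by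
      rw [PriceState.raised_of_mem (hT hj), hc j (hT hj)], Finset.sum_const,
      nsmul_eq_mul]
  have hM : 0 < (S.card : ℝ) := by exact_mod_cast hne.card_pos
  have hfeas : S.card * c ≤ ((nbrIn v ps.agents S).card : ℝ) := by
    have := hs.feasible S hS
    rwa [Finset.sum_congr rfl (g := fun _ => c) fun j hj => hc j (hS hj), Finset.sum_const,
      nsmul_eq_mul] at this
  have hK : 0 < ((nbrIn v ps.agents S).card : ℝ) := lt_of_lt_of_le (by positivity) hfeas
  set K := (nbrIn v ps.agents S).card with hKdef
  -- The common price rises from `c` to the least ratio; feasibility of `S` at the price `c` makes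
  -- the raise nonnegative.
  set δ : ℝ := K / S.card - c with hδ
  have hcδ : c + δ = K / S.card := by rw [hδ]; ring
  have hact : S ⊆ posSet n (t.idx aAct) := by rwa [h.active]
  -- A free unit would give a cut of smaller ratio than `S`.
  have hsat : Saturated w := by
    rcases hf.matched.saturated_or with ⟨hsat, -⟩ | ⟨⟨d, hd, hfree⟩, -⟩
    · exact hsat
    · exfalso
      set T : Finset (Fin n) := Finset.univ.filter fun j => 0 < t.idx aAct j ∧
        ∀ q < w.reg rQ, E (w.idx aAgent q) j → w.reg rGap < w.idx aLev q with hT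
      have hcut : IsCutSet n E (t.idx aAct) w T := fun j => by simp [hT]
      have h1 := hf.matched.card_lt_of_free hE hcut hd hfree
      rw [h.agents] at h1
      have h2 := hleast T (fun j hj => by
        rw [← h.active]
        exact mem_posSet.2 ((hcut j).1 hj).1)
      rw [← hKdef] at h2
      omega
  have hedge : ∀ i j : Fin n, j ∈ S → share w i j ≠ 0 → i ∈ nbrIn v ps.agents S ∧ v i j = 1 := by
    intro i j hj h0
    obtain ⟨q, hq, hi, hd, hg⟩ := share_pos.1 (Nat.pos_of_ne_zero h0)
    obtain ⟨e1, -, e3⟩ := hf.matched.edge_of_held hE hq hd hi hg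
    rw [h.agents] at e1
    exact ⟨Finset.mem_filter.2 ⟨e1, j, hj, e3⟩, e3⟩
  -- For `S` itself Hall's condition is the equality `M * K = K * M`, so all slots of its neighbours
  -- are filled with its goods.
  have hagent : ∀ i ∈ nbrIn v ps.agents S, ∑ j ∈ S, (share w i j : ℝ) = S.card := by
    intro i hi
    have := hf.matched.sum_share_agent hE hsat hact (by
      rw [h.agents, ← hKdef, mul_comm]) (i := i) (by rwa [h.agents])
    exact_mod_cast this
  set y : Fin n → Fin n → ℝ := fun i j => if j ∈ S then (share w i j : ℝ) / K else 0 with hy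
  have hsupp : ∀ i j, y i j ≠ 0 → i ∈ nbrIn v ps.agents S ∧ j ∈ S ∧ v i j = 1 := by
    intro i j h0
    simp only [hy, ne_eq, ite_eq_right_iff, Classical.not_imp, div_eq_zero_iff, not_or,
      Nat.cast_eq_zero] at h0
    exact ⟨(hedge i j h0.1 h0.2.1).1, h0.1, (hedge i j h0.1 h0.2.1).2⟩
  have hysum : ∀ i ∈ nbrIn v ps.agents S, ∑ j, y i j = S.card / K := by
    intro i hi
    rw [hy, Finset.sum_ite_mem, Finset.univ_inter, ← Finset.sum_div, hagent i hi]
  have hynone : ∀ i ∉ nbrIn v ps.agents S, ∑ j, y i j = 0 := fun i hi =>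
    Finset.sum_eq_zero fun j _ => by_contra fun h0 => hi (hsupp i j h0).1
  have hzero : ∀ i j, i ∈ ps.agents ∨ j ∈ ps.active → ps.alloc i j = 0 := fun i j hij => by
    by_contra h0
    obtain ⟨⟨-, h1⟩, ⟨-, h2⟩, -⟩ := hs.alloc_support i j h0
    exact hij.elim h1 h2
  have htight : ps.GoesTight v δ S := by
    refine ⟨?_, hne, hS, fun T hT => ?_, ?_⟩
    · rw [hδ, sub_nonneg, le_div_iff₀ hM, mul_comm]; exact hfeas
    · have h1 := hf.matched.card_le_of_saturated hE hsat (T := T) (by rwa [h.active])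
      rw [h.agents] at h1
      rw [hsum T hT, hcδ, ← mul_div_assoc, div_le_iff₀ hM]
      exact_mod_cast h1
    · rw [hsum S hS, hcδ, mul_div_cancel₀ _ hM.ne']
      rfl
  have hclear : ps.Clears v δ S y := by
    refine ⟨fun i j => ?_, hsupp, fun j hj => ?_, fun i hi => ?_⟩
    · simp only [hy]; positivity
    · have := hf.matched.sum_share_good hsat (hact hj)
      simp only [hy, if_pos hj]
      rw [← Finset.sum_div, div_eq_one_iff_eq hK.ne']
      exact_mod_cast this
    -- A buyer gets size `M / K` at price `K / M`, for one dollar.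
    · rw [Finset.sum_congr rfl (g := fun j => (K / S.card : ℝ) * y i j) fun j _ => by
        by_cases hj : j ∈ S
        · rw [PriceState.raised_of_mem (hS hj), hc j (hS hj), hcδ]
        · simp [hy, hj], ← Finset.mul_sum, hysum i hi]
      field_simp
  refine ⟨δ, S, y, htight, hclear, hf.base, by rw [hf.zero, h.zero], ?_, ?_, fun i j => ?_,
    fun j hj => ?_, fun i => ?_⟩
  · rw [hf.act, h.active]; rfl
  · rw [hf.pres, h.agents]; rfl
  · rw [hf.alloc, h.alloc]
    simp only [PriceState.freeze, hy]
    by_cases hj : j ∈ S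
    · rw [if_pos hj, if_pos (hs.active_subset (hS hj)), if_pos hj, hzero i j (Or.inr (hS hj)),
        zero_add]
    · rw [if_neg hj, if_neg hj, add_zero]
  · rw [hp]
    change _ = ps.raised δ j
    by_cases hjS : j ∈ S
    · rw [if_pos hjS, PriceState.raised_of_mem (hS hjS), hc j (hS hjS), hcδ]
    · have : j ∉ ps.active := fun hja => hj (Finset.mem_sdiff.2 ⟨hja, hjS⟩)
      rw [if_neg hjS, PriceState.raised_of_notMem this, h.price j this]
  · rw [hf.missing, h.agents, h.missing]
    simp only [PriceState.freeze, Finset.sum_add_distrib]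
    by_cases hi : i ∈ nbrIn v ps.agents S
    · have hia := (Finset.mem_filter.1 hi).1
      rw [if_pos hi, if_neg (by simpa using hs.agents_subset hia), hysum i hi,
        Finset.sum_eq_zero fun j _ => hzero i j (Or.inl hia)]
      field_simp
      ring
    · rw [if_neg hi, hynone i hi, add_zero]

/-- Each round with an active good freezes at least one, so none is active after `n` rounds. -/
theorem Represents.freezeAll (hE : ∀ i j : Fin n, E i j ↔ v i j = 1)
    (hall : ∀ T ⊆ G₁, T.card ≤ (nbrIn v A₂ᶜ T).card)
    (h : Represents E A₂ G₁ x₀ (PriceState.init A₂ᶜ G₁) s) :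
    ∃ ps, DPSVReaches v A₂ᶜ G₁ ps ∧ ps.active = ∅ ∧
      Represents E A₂ G₁ x₀ ps ((Program.for rOuter rN freezeTight).den s) := by
  have hput : ∀ {ps t} k, Represents E A₂ G₁ x₀ ps t →
      Represents E A₂ G₁ x₀ ps (t.putReg rOuter k) := fun k h =>
    ⟨h.base.putReg (by decide) k, h.zero, h.active, h.agents, h.alloc, h.price, h.missing⟩
  have key := for_induction (r := rOuter) (e := rN) (P := freezeTight)
    (fun k t => ∃ ps, DPSVReaches v A₂ᶜ G₁ ps ∧ (ps.active = ∅ ∨ ps.active.card + k ≤ n) ∧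
      Represents E A₂ G₁ x₀ ps t) s (by decide +kernel) (by decide +kernel)
    ⟨_, DPSVReaches.init, Or.inr (by simpa [PriceState.init] using Finset.card_le_univ G₁), hput 0 h⟩ (by
      rintro k hk t hr - ⟨ps, hps, hcard, ht⟩
      rcases ps.active.eq_empty_or_nonempty with he | hne
      · exact ⟨ps, hps, Or.inl he, hput _ (ht.freezeTight_of_empty hE he)⟩
      · obtain ⟨δ, S, y, h1, h2, h3⟩ := ht.freezeTight_of_nonempty hE (hps.sound hall) hne
        refine ⟨_, DPSVReaches.freeze ps δ S y hps h1 h2, Or.inr ?_, hput _ h3⟩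
        have hlt : (ps.active \ S).card < ps.active.card :=
          Finset.card_lt_card (Finset.sdiff_ssubset h1.2.2.1 h1.2.1)
        have := hcard.resolve_left hne.ne_empty
        change (ps.active \ S).card + (k + 1) ≤ n
        omega)
  obtain ⟨ps, h1, h2, h3⟩ := key
  refine ⟨ps, h1, h2.elim id fun hc => ?_, h3⟩
  rw [h.base.dim] at hc
  exact Finset.card_eq_zero.1 (by omega)

end Simulation

/-! ## Correctness of the program -/

section Solve
open Program Classical

variable {v : Fin n → Fin n → ℝ}

/-- The first stage of the program finds a perfect matching or a minimum vertex cover and a maximum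
matching of the agents in it. -/
theorem firstStage_spec (hE : ∀ i j : Fin n, E i j ↔ v i j = 1) (hn : 0 < n) (hr : Ready n E s)
    (h3 : ∀ i j, s.num 3 i j = 0) (h4 : ∀ j, s.num 4 j 0 = 0) (h12 : s.num 12 0 0 = 0) :
    ∃ T M, ((T = Finset.univ ∧ IsPerfectMatching v M) ∨
      (¬ ∃ M', IsPerfectMatching v M') ∧ IsMinVertexCover v Tᶜ (nbrIn v Finset.univ T) ∧
        IsMaxMatchingIn v (nbrIn v Finset.univ T) Tᶜᶜ M) ∧
      Represents E (nbrIn v Finset.univ T) Tᶜ (fun i j => if (i, j) ∈ M then 1 else 0)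
        (PriceState.init (nbrIn v Finset.univ T)ᶜ Tᶜ)
        (sellGoods.den (removeAgents.den (cut.den (matching.den s)))) := by
  have hm := matching_spec hr.base (by rw [hr.regK]; exact hn) (by rw [hr.regM]; exact hn)
  rw [hr.regK, hr.regM] at hm
  have hact : posSet n (s.idx aAct) = Finset.univ :=
    Finset.eq_univ_of_forall fun j => mem_posSet.2 (hr.act j j.2)
  have hpres : posSet n (s.idx aPres) = Finset.univ :=
    Finset.eq_univ_of_forall fun j => mem_posSet.2 (hr.pres j j.2)
  have hb1 : Base n E (matching.den s) := hr.base.den (by decide)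
  have i0 : (matching.den s).idx aAct = s.idx aAct := den_idx _ (by decide) _
  have i1 : (matching.den s).idx aPres = s.idx aPres := den_idx _ (by decide) _
  have n0 : (matching.den s).num = s.num := by
    funext a
    exact den_num _ (by simp [matching, copies, clearSlots, Program.round, bid, findSlot,
      examineSlot, takeSlot, findGap, gapPass, block, writesNum, Program.for, Program.when]) _
  generalize matching.den s = w at *
  have hcut := cut_spec hb1 (hm.slots_le hn)
  have hb2 : Base n E (cut.den w) := hb1.den (by decide)
  have j0 : (cut.den w).idx aAct = w.idx aAct := den_idx _ (by decide) _
  have j1 : (cut.den w).idx aPres = w.idx aPres := den_idx _ (by decide) _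
  have j3 : (cut.den w).idx aGood = w.idx aGood := den_idx _ (by decide) _
  have j4 : (cut.den w).idx aAgent = w.idx aAgent := den_idx _ (by decide) _
  have j5 : (cut.den w).idx aHold = w.idx aHold := den_idx _ (by decide) _
  have j6 : (cut.den w).idx aLev = w.idx aLev := den_idx _ (by decide) _
  have r1 : (cut.den w).reg rD = w.reg rD := den_reg _ (by decide) _
  have r2 : (cut.den w).reg rQ = w.reg rQ := den_reg _ (by decide) _
  have r3 : (cut.den w).reg rGap = w.reg rGap := den_reg _ (by decide) _
  have m0 : (cut.den w).num = w.num := by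
    funext a
    exact den_num _ (by simp [cut, block, writesNum, Program.for, Program.when]) _
  have p4 : (sellGoods.den (removeAgents.den (cut.den w))).num 4 = (cut.den w).num 4 := by
    rw [den_num _ (by decide), den_num _ (by decide)]
  have hm' : Matched n E 1 1 (s.idx aAct) (s.idx aPres) (cut.den w) := by
    obtain ⟨a1, a2, a3⟩ := hm
    have hadj : unitAdj E (cut.den w) = unitAdj E w := by
      funext d q
      simp only [unitAdj, j3, j4]
    exact ⟨by rwa [r1, j3], by rwa [r2, j4], by rwa [r1, r2, r3, j5, j6, hadj]⟩
  set T := posSet n ((cut.den w).idx aTight) with hT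
  have hTcut : IsCutSet n E (s.idx aAct) (cut.den w) T := fun j => by
    rw [hT, mem_posSet, hcut j j.2, i0, r2, r3, j4, j6]
  have hstage := hm'.firstStage hE hact hpres hTcut
  -- With `K = M = 1` the shares are the indicator of the matching, and the size missing to an agent
  -- of `A₂` is `(1 - 1) / 1 = 0`.
  have hsell := sell_spec hE hb2 (K := 1) (M := 1) (by rwa [j0, i0, j1, i1]) hn
    (by rw [m0, n0, hr.numK]; simp) (by rw [m0, n0, hr.numM]; simp)
  rw [← hT] at hsell
  generalize cut.den w = z at *
  refine ⟨T, (matchedPairs n z).filter fun e => e.2 ∈ T, ?_, hsell.base, ?_, ?_, ?_,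
    fun i j => ?_, fun j hj => ?_, fun i => ?_⟩
  · refine hstage.imp (fun h => ⟨h.1, ?_⟩) id
    rw [Finset.filter_true_of_mem fun e _ => by rw [h.1]; exact Finset.mem_univ _]
    exact h.2
  · rw [hsell.zero, m0, n0, h12]
  · rw [hsell.act, j0, i0, hact]
    ext j
    simp [PriceState.init]
  · rw [hsell.pres, j1, i1, hpres]
    ext j
    simp [PriceState.init]
  · rw [hsell.alloc, m0, n0, h3, Nat.cast_one, div_one, hm'.share_eq hpres]
    by_cases hj : j ∈ T
    · simp [hj]
    · simp [hj, PriceState.init]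
  · have hj : j ∈ T := by simpa [PriceState.init] using hj
    rw [p4, m0, n0, h4]
    simp [PriceState.init, hj]
  · rw [hsell.missing, j1, i1, hpres, m0, n0, hr.missing i i.2]
    simp [PriceState.init]

variable {A₂ G₁ : Finset (Fin n)} {M : Finset (Fin n × Fin n)} {ps : PriceState n}

/-- The program recognizes the goods left over by their zero columns: a good of `G₁` is fully sold,
and a matched good outside `G₁` has an entry one. -/
theorem Represents.fill (hs : ps.Sound v A₂ᶜ G₁) (ha : ps.active = ∅)
    (h : Represents E A₂ G₁ (fun i j => if (i, j) ∈ M then 1 else 0) ps s) (i j : Fin n) :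
    (shareLeft.den (countLeft.den s)).num 3 i j =
      if j ∈ G₁ then ps.alloc i j else if j ∈ M.image Prod.snd then
        if (i, j) ∈ M then 1 else 0 else
        (if i ∈ A₂ then 0 else 1 - ∑ j, ps.alloc i j) / ((G₁ᶜ \ M.image Prod.snd).card : ℝ) := by
  obtain ⟨a1, a2⟩ := countLeft_spec h.base h.zero
  have hleft : ∀ j : Fin n, j ∈ G₁ᶜ \ M.image Prod.snd ↔ ∀ i < n, s.num 3 i j = 0 := by
    intro j
    have hall : (∀ i < n, s.num 3 i j = 0) ↔ ∀ i : Fin n, s.num 3 i j = 0 :=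
      ⟨fun h i => h i i.2, fun h i hi => h ⟨i, hi⟩⟩
    rw [hall]
    simp only [h.alloc]
    by_cases hj : j ∈ G₁
    · simp only [hj, if_true, Finset.mem_sdiff, Finset.mem_compl, not_true_eq_false, false_and,
        false_iff]
      intro h0
      have := hs.sold j hj (by simp [ha])
      simp [h0] at this
    · simp [hj]
  rw [card_filter_range_eq hleft] at a2
  have hb1 : Base n E (countLeft.den s) := h.base.den (by decide)
  have n3 : (countLeft.den s).num 3 = s.num 3 := den_num _ (by decide) _
  have n8 : (countLeft.den s).num 8 = s.num 8 := den_num _ (by decide) _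
  rw [shareLeft_spec hb1 i i.2 j j.2, a2, n3, n8, h.alloc, h.missing]
  simp only [a1 j j.2, ← hleft, Finset.mem_sdiff, Finset.mem_compl]
  by_cases hj : j ∈ G₁
  · simp [hj]
  · by_cases hjM : j ∈ M.image Prod.snd
    · simp only [hj, hjM, not_true_eq_false, and_false, if_false, if_true]
    · simp only [hj, hjM, not_false_eq_true, and_self, if_false, if_true]

/-- From the stated input, the main part of the program computes an output of Algorithm 1. -/
theorem body_spec (hE : ∀ i j : Fin n, E i j ↔ v i j = 1) (h0 : s.reg rN = n)
    (h1 : s.reg rSq = n * n) (h2 : s.reg rBig = n * n * (n * n + 1)) (hz : s.reg rZ = 0)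
    (he : ∀ i j, s.num 0 i j = s.num 2 i 0 ↔ E i j) (h3 : ∀ i j, s.num 3 i j = 0)
    (h4 : ∀ j, s.num 4 j 0 = 0) (h12 : s.num 12 0 0 = 0) :
    Algorithm1 v ((body.den s).allocation n) ((body.den s).prices n) := by
  -- The first matching needs `K = M = 1 ≤ n`, so the empty market is treated apart; there the empty
  -- matching is perfect.
  rcases Nat.eq_zero_or_pos n with rfl | hn
  · have hM : IsPerfectMatching v ∅ := ⟨⟨by simp, by simp⟩, fun i => i.elim0, fun j => j.elim0⟩
    convert Algorithm1.perfect ∅ hM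
  · have hden : body.den s = shareLeft.den (countLeft.den ((Program.for rOuter rN freezeTight).den
      (sellGoods.den (removeAgents.den (cut.den (matching.den (setup.den s))))))) := rfl
    have hr := setup_spec h0 h1 h2 hz he
    have n3 : (setup.den s).num 3 = s.num 3 := den_num _ (by decide) _
    have n4 : (setup.den s).num 4 = s.num 4 := den_num _ (by decide) _
    have n12 : (setup.den s).num 12 = s.num 12 := den_num _ (by decide) _
    obtain ⟨T, M, hTM, hrep⟩ := firstStage_spec hE hn hr (by simpa [n3] using h3)
      (by simpa [n4] using h4) (by rw [n12, h12])
    obtain ⟨ps, hps, ha, hrep'⟩ := hrep.freezeAll hE (by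
      intro T' hT'
      -- For a perfect matching `G₁` is empty, and Hall's condition is trivial.
      rcases hTM with ⟨rfl, -⟩ | ⟨-, hc, -⟩
      · simp at hT'
        simp [hT']
      · exact hc.card_le_nbrIn hT')
    have hs := hps.sound (by
      intro T' hT'
      rcases hTM with ⟨rfl, -⟩ | ⟨-, hc, -⟩
      · simp at hT'
        simp [hT']
      · exact hc.card_le_nbrIn hT')
    rw [hden]
    generalize (Program.for rOuter rN freezeTight).den
      (sellGoods.den (removeAgents.den (cut.den (matching.den (setup.den s))))) = z at *
    have hx := hrep'.fill hs ha
    have hp : ∀ j : Fin n, (shareLeft.den (countLeft.den z)).num 4 j 0 = ps.price j := fun j => by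
      rw [den_num _ (by decide), den_num _ (by decide), hrep'.price j (by simp [ha])]
    have hprices : (shareLeft.den (countLeft.den z)).prices n = ps.price := funext hp
    rcases hTM with ⟨rfl, hM⟩ | ⟨hno, hc, hM⟩
    -- All goods are matched, so nothing is left over and filling up leaves the matching as it is.
    · have e1 : (shareLeft.den (countLeft.den z)).allocation n =
          fun i j => if (i, j) ∈ M then 1 else 0 := by
        funext i j
        obtain ⟨i', hi'⟩ := hM.2.2 j
        have hj : j ∈ M.image Prod.snd := Finset.mem_image.2 ⟨_, hi', rfl⟩
        rw [Store.allocation, hx i j, if_neg (by simp), if_pos hj]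
      have e2 : ps.price = fun _ => 0 := funext fun j => hs.price_outside j (by simp)
      rw [hprices, e1, e2]
      exact Algorithm1.perfect M hM
    · rw [hprices]
      refine Algorithm1.imperfect _ _ M ps _ hno hc hM hps ha
        (isFilledUp_of_uniform hno hc hM hs ha (fun i hi j => ?_) (fun i hi j hj => ?_)
          fun i hi j hj => ?_)
      · rw [Store.allocation, hx i j]
        by_cases hj : j ∈ Tᶜ
        · have h5 : (i, j) ∉ M := fun hm => by
            have := (hM.1.2 _ hm).2
            simp at this hj
            exact hj this
          rw [if_pos hj, if_neg h5]
          by_contra h6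
          exact (Finset.mem_compl.1 (hs.alloc_support i j h6).1.1) hi
        -- Nothing is missing in the bundles of `A₂`, so filling up gives these agents zero of each
        -- good left over.
        · rw [if_neg hj, if_pos hi, zero_div]
          by_cases hjM : j ∈ M.image Prod.snd
          · rw [if_pos hjM]
          · rw [if_neg hjM, if_neg fun hm => hjM (Finset.mem_image.2 ⟨_, hm, rfl⟩)]
      · rw [Store.allocation, hx i j, if_pos hj]
      · rw [Store.allocation, hx i j, if_neg hj, if_neg hi,
          if_neg fun hm => hi (hM.1.2 (i, j) hm).1]

/-- The upper bounds of the loops of the program. -/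
def loopLimits (r : ℕ) : Polynomial ℕ :=
  if r = rN then .X else if r = rSq then .X * .X else .X * .X * (.X * .X + 1)

/-- A polynomial bound on the number of steps of the program. -/
def solveTime : Polynomial ℕ :=
  squares.cost loopLimits + bounds.cost loopLimits + body.cost loopLimits + 2

theorem solve_run {u : Fin n → Fin n → ℝ} {a b : Fin n → ℝ} :
    ∃ t, solve.run (inputStore u a b) (solveTime.eval n) = ⟨[], t⟩ ∧
      Algorithm1 (toUnit u b) (t.allocation n) (t.prices n) := by
  set s₀ := inputStore u a b with hs₀
  have q0 : s₀.reg rN = n := rfl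
  set s₁ := squares.den s₀ with hs₁
  set s₂ := bounds.den s₁ with hs₂
  have a0 : s₁.reg rN = n := (den_reg _ (by decide) _).trans q0
  have a1 : s₁.reg rSq = n * n := by rw [hs₁, squares_spec rfl, q0]
  have a2 : s₁.reg rBig = 0 := (den_reg _ (by decide) _).trans rfl
  have a3 : s₁.reg rZ = 0 := (den_reg _ (by decide) _).trans rfl
  have b0 : s₂.reg rN = n := (den_reg _ (by decide) _).trans a0
  have b1 : s₂.reg rSq = n * n := (den_reg _ (by decide) _).trans a1
  have b2 : s₂.reg rBig = n * n * (n * n + 1) := by rw [hs₂, bounds_spec a2, a1]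
  have b3 : s₂.reg rZ = 0 := (den_reg _ (by decide) _).trans a3
  have hnum : s₂.num = s₀.num := by
    funext m
    rw [hs₂, den_num _ (by simp [bounds, block, writesNum, Program.for]), hs₁,
      den_num _ (by simp [squares, writesNum, Program.for])]
  have hE : ∀ i j : Fin n, s₀.num 0 i j = s₀.num 2 i 0 ↔ toUnit u b i j = 1 := by
    intro i j
    have e1 : s₀.num 0 i j = u i j := by simp [hs₀, inputStore]
    have e2 : s₀.num 2 i 0 = b i := by simp [hs₀, inputStore]
    rw [e1, e2, toUnit]
    split_ifs with h <;> simp [h]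
  have hbody := body_spec (E := fun i j => s₀.num 0 i j = s₀.num 2 i 0) hE b0 b1 b2 b3
    (fun i j => by rw [hnum]) (fun i j => by rw [hnum]; simp [hs₀, inputStore])
    (fun j => by rw [hnum]; simp [hs₀, inputStore]) (by rw [hnum]; simp [hs₀, inputStore])
  obtain ⟨t₀, l₀, e₀⟩ := run_den (lim := loopLimits) (n := n) squares squares_loopsBounded s₀
    (fun e he => by
      have : e = 0 := by omega
      subst this
      simp [loopLimits, q0])
  obtain ⟨t₁, l₁, e₁⟩ := run_den (lim := loopLimits) (n := n) bounds bounds_loopsBounded s₁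
    (fun e he => by
      interval_cases e
      · simp [loopLimits, a0]
      · simp [loopLimits, a1])
  obtain ⟨t₂, l₂, e₂⟩ := run_den (lim := loopLimits) (n := n) body body_loopsBounded s₂
    (fun e he => by
      interval_cases e
      · simp [loopLimits, b0]
      · simp [loopLimits, b1]
      · simp [loopLimits, b2])
  -- Each of the two sequencings takes one further step to unfold; the constant in `solveTime` pays
  -- for them.
  have hrun : solve.run s₀ (t₂ + (t₁ + 1 + (t₀ + 1))) = ⟨[], body.den s₂⟩ := by
    have hsolve : solve = .seq squares (.seq bounds body) := rfl
    have c₀ : Config.step^[t₀ + 1] ⟨[solve], s₀⟩ = ⟨[.seq bounds body], s₁⟩ := by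
      rw [Function.iterate_succ_apply, hsolve]
      exact e₀ _
    have c₁ : Config.step^[t₁ + 1] ⟨[.seq bounds body], s₁⟩ = ⟨[body], s₂⟩ := by
      rw [Function.iterate_succ_apply]
      exact e₁ _
    rw [Program.run, Function.iterate_add_apply, Function.iterate_add_apply _ (t₁ + 1), c₀, c₁, e₂]
  refine ⟨body.den s₂, ?_, hbody⟩
  rw [Program.run_halted (t := t₂ + (t₁ + 1 + (t₀ + 1))) (by rw [hrun]), hrun]
  simp only [solveTime, Polynomial.eval_add, Polynomial.eval_ofNat]
  omega

theorem solve_stronglyPolynomial : StronglyPolynomial solve := by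
  refine stronglyPolynomial_of_respects solve_respects 3 (fun m => ?_) solveTime
    fun n u a b _ => ?_
  · unfold levels
    split_ifs <;> simp
  · obtain ⟨t, ht, -⟩ := solve_run (u := u) (a := a) (b := b)
    rw [ht]

theorem isUnit01_toUnit (u : Fin n → Fin n → ℝ) (b : Fin n → ℝ) : IsUnit01 (toUnit u b) := by
  intro i j
  unfold toUnit
  split_ifs <;> simp

end Solve

end HZ

end

theorem mainTheorem1 :
    -- a strongly polynomial program for the bivalued case, which implements Algorithm 1
    (∃ P : HZ.Program, HZ.StronglyPolynomial P ∧
      ∀ (n : ℕ) (u : Fin n → Fin n → ℝ) (a b : Fin n → ℝ), HZ.Bivalued u a b →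
        ∃ (x : Fin n → Fin n → ℝ) (p : Fin n → ℝ),
          P.Outputs u a b x p ∧ HZ.IsEquilibrium u x p ∧ HZ.MinPriceZero p ∧
            HZ.Algorithm1 (HZ.toUnit u b) x p) ∧
    -- Algorithm 1 finds an equilibrium in the unit case, however its choices are made
    (∀ (n : ℕ) (u : Fin n → Fin n → ℝ), HZ.IsUnit01 u →
      HZ.Algorithm1NeverStuck u ∧
        ∀ (x : Fin n → Fin n → ℝ) (p : Fin n → ℝ), HZ.Algorithm1 u x p →
          HZ.IsEquilibrium u x p ∧ HZ.MinPriceZero p) ∧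
    -- equivalent utilities have the same equilibria
    (∀ (n : ℕ) (u : Fin n → Fin n → ℝ) (i : Fin n) (v : Fin n → ℝ),
      HZ.EquivalentUtility (u i) v →
        ∀ (x : Fin n → Fin n → ℝ) (p : Fin n → ℝ),
          HZ.IsEquilibrium u x p ↔ HZ.IsEquilibrium (Function.update u i v) x p) := by
  refine ⟨⟨HZ.Program.solve, HZ.solve_stronglyPolynomial, fun n u a b hb => ?_⟩,
    fun n u hu => ⟨HZ.algorithm1NeverStuck u, fun x p h => h.isEquilibrium hu⟩,
    fun n u i v h x p => HZ.isEquilibrium_update_iff h x p⟩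
  obtain ⟨t, ht, halg⟩ := HZ.solve_run (u := u) (a := a) (b := b)
  obtain ⟨he, hp⟩ := halg.isEquilibrium (HZ.isUnit01_toUnit u b)
  exact ⟨_, _, ⟨_, by rw [ht], by rw [ht], by rw [ht]⟩, hb.isEquilibrium he, hp, halg⟩
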